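/- Let $n\ge 0$, $e,Z>0$, $y\in\mathbb R^3$, and let $$H_A=\sum_{i=1}^{N}\Big(-\Delta_{x_i}-\frac{e^2Z}{|x_i-y|}\Big)+\sum_{1\le i<j\le N}\frac{e^2}{|x_i-x_j|},\qquad N=n+1,$$ be the Hamiltonian of an atom or ion with $N$ electrons and a nucleus of charge $eZ$ fixed at $y$, acting on $L^2(\mathbb R^{3N};\mathbb C)$ with domain $H^2(\mathbb R^{3N})$. For an irreducible complex representation $\alpha$ of $S_N$ (a symmetry type) let $H_A^\alpha$ be the restriction of $H_A$ to the subspace $\mathcal H^\alpha\subset L^2(\mathbb R^{3N})$ on which the representation of $S_N$ by permutations of the electrons is a multiple of $\alpha$. The ground state subspace of an operator $A$ is $\{\psi\in D(A): A\psi=\inf\sigma(A)\,\psi\}$. For $R\in O(3)$ let $(t_Rf)(z)=f(y+R^{-1}(z-y))$ on $L^2(\mathbb R^3)$ and $(T_R\Phi)(x_1,\dots,x_N)=\Phi(y+R^{-1}(x_1-y),\dots,y+R^{-1}(x_N-y))$ on $L^2(\mathbb R^{3N})$. Let $P$ be the orthogonal projection onto the ground state subspace $G$ of $H_A^\alpha$,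 or of $H_A$ on the entire space $L^2(\mathbb R^{3N})$. A bounded operator $\rho$ on $L^2(\mathbb R^3)$ is called a one-electron density of $P$ if, for every bounded operator $b$ on $L^2(\mathbb R^3)$, $b\rho$ and $(b\otimes\mathbf 1)P$ are trace class and $$\operatorname{Tr}(b\rho)=\operatorname{Tr}[(b\otimes \mathbf 1)P],$$ where $b\otimes\mathbf 1$ acts as $b$ on the first electron. If $G$ is finite-dimensional, then $\rho$ exists and is unique. The one-electron density is spherically symmetric: $\rho=t_R\,\rho\,t_R^{-1}$ for all $R\in O(3)$. Likewise, for every finite orthonormal basis $(\Psi_i)$ of $G$ and every $R\in O(3)$, the density function $$\rho(z)=\sum_i\int|\Psi_i(z,z_2,\dots,z_N)|^2\,dz_2\cdots dz_N$$ satisfies $\rho(y+R(z-y))=\rho(z)$ for almost every $z\in\mathbb R^3$. If there is no symmetry restriction, then the ground state itself is spherically symmetric: $T_R\Phi=\Phi$ for every $\Phi$ in the ground state subspace of $H_A$ on $L^2(\mathbb R^{3N})$ and every $R\in O(3)$. -/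

import Mathlib

open MeasureTheory
open scoped ContDiff ENNReal

noncomputable section

namespace AtomDensity

/-! ### State spaces -/

/-- Physical space `ℝ³` with its Euclidean norm. -/
abbrev Space : Type := EuclideanSpace ℝ (Fin 3)

/-- Configurations `(x₁, …, x_N)` of `N` electrons. Its `volume` is Lebesgue measure on `ℝ^{3N}`. -/
abbrev Config (N : ℕ) : Type := Fin N → Space

/-- `L²(ℝ³; ℂ)`, the state space of one electron. -/
abbrev L2One : Type := Lp ℂ 2 (volume : Measure Space)

/-- `L²(ℝ^{3N}; ℂ)`, the state space of `N` electrons. -/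
abbrev L2 (N : ℕ) : Type := Lp ℂ 2 (volume : Measure (Config N))

/-! ### The Hamiltonian of an atom or ion -/

/-- The Laplacian `∑ᵢ Δ_{xᵢ}` on `ℝ^{3N}` of a smooth function. -/
def laplacian {N : ℕ} (φ : Config N → ℝ) (x : Config N) : ℝ :=
  ∑ i : Fin N, ∑ k : Fin 3,
    iteratedFDeriv ℝ 2 φ x (fun _ => Pi.single i (EuclideanSpace.single k (1 : ℝ)))

/-- `l = ∑ᵢ Δ_{xᵢ} ψ` in the sense of distributions, for `ψ, l ∈ L²(ℝ^{3N})`. -/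
def IsWeakLaplacian {N : ℕ} (ψ l : L2 N) : Prop :=
  ∀ φ : Config N → ℝ, ContDiff ℝ ∞ φ → HasCompactSupport φ →
    ∫ x, (laplacian φ x) • (ψ x : ℂ) = ∫ x, (φ x) • (l x : ℂ)

/-- The potential energy of `N` electrons of charge `-e` in the field of a nucleus of charge `e Z`
fixed at `y`:
`V(x) = - ∑ᵢ e² Z / |xᵢ - y| + ∑_{i<j} e² / |xᵢ - xⱼ|`. -/
def potential {N : ℕ} (e Z : ℝ) (y : Space) (x : Config N) : ℝ :=
  (∑ i : Fin N, -(e ^ 2 * Z / ‖x i - y‖)) +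
    ∑ i : Fin N, ∑ j ∈ Finset.Ioi i, e ^ 2 / ‖x i - x j‖

lemma laplacian_continuous {N : ℕ} {φ : Config N → ℝ} (h : ContDiff ℝ ∞ φ) :
    Continuous (laplacian φ) := by
  unfold laplacian
  have h2 : Continuous (iteratedFDeriv ℝ 2 φ) :=
    h.continuous_iteratedFDeriv (WithTop.coe_le_coe.2 (le_top : (2 : ℕ∞) ≤ ⊤))
  refine continuous_finsetSum _ fun i _ => continuous_finsetSum _ fun k _ => ?_
  exact (ContinuousMultilinearMap.apply ℝ (fun _ : Fin 2 => Config N) ℝ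
    (fun _ => Pi.single i (EuclideanSpace.single k (1 : ℝ)))).continuous.comp h2

lemma laplacian_hasCompactSupport {N : ℕ} {φ : Config N → ℝ} (h : HasCompactSupport φ) :
    HasCompactSupport (laplacian φ) := by
  refine (h.iteratedFDeriv (𝕜 := ℝ) 2).mono fun x hx => ?_
  contrapose! hx
  have hx' : iteratedFDeriv ℝ 2 φ x = 0 := by simpa using hx
  simp [laplacian, hx']

lemma integrable_smul_of_hasCompactSupport {N : ℕ} {f : Config N → ℝ} (hf : Continuous f)
    (hs : HasCompactSupport f) (ψ : L2 N) : Integrable (fun x => f x • (ψ x : ℂ)) :=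
  (((Lp.memLp ψ).locallyIntegrable (by norm_num)).integrable_smul_left_of_hasCompactSupport hf hs)

/-- The graph of the Hamiltonian: all `(ψ, g)` with `ψ, Δψ, g ∈ L²` and `g = - Δψ + V ψ`. -/
def hamiltonianGraph (N : ℕ) (e Z : ℝ) (y : Space) : Submodule ℂ (L2 N × L2 N) where
  carrier := {p | ∃ l : L2 N, IsWeakLaplacian p.1 l ∧
    ∀ᵐ x, (p.2 x : ℂ) = -(l x) + (potential e Z y x : ℂ) * p.1 x}
  zero_mem' := by
    refine ⟨0, ?_, ?_⟩
    · intro φ _ _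
      have h0 : ∀ᵐ x : Config N, ((0 : L2 N) x : ℂ) = 0 := Lp.coeFn_zero ℂ 2 volume
      have e1 : ∫ x, laplacian φ x • ((0 : L2 N) x : ℂ) = 0 := integral_eq_zero_of_ae
        (by filter_upwards [h0] with x hx; rw [hx, smul_zero, Pi.zero_apply])
      have e2 : ∫ x, φ x • ((0 : L2 N) x : ℂ) = 0 := integral_eq_zero_of_ae
        (by filter_upwards [h0] with x hx; rw [hx, smul_zero, Pi.zero_apply])
      exact e1.trans e2.symm
    · have h0 : ∀ᵐ x : Config N, ((0 : L2 N) x : ℂ) = 0 := Lp.coeFn_zero ℂ 2 volume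
      filter_upwards [h0] with x hx
      change ((0 : L2 N) x : ℂ) = -((0 : L2 N) x : ℂ) + _ * ((0 : L2 N) x : ℂ)
      rw [hx]
      simp
  add_mem' := by
    rintro ⟨a, b⟩ ⟨c, d⟩ ⟨l, hl, hl'⟩ ⟨m, hm, hm'⟩
    refine ⟨l + m, ?_, ?_⟩
    · intro φ h1 h2
      have i1 := integrable_smul_of_hasCompactSupport (laplacian_continuous h1)
        (laplacian_hasCompactSupport h2)
      have i2 := integrable_smul_of_hasCompactSupport h1.continuous h2
      have e1 : ∫ x, laplacian φ x • ((a + c : L2 N) x : ℂ) =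
          ∫ x, (laplacian φ x • (a x : ℂ) + laplacian φ x • (c x : ℂ)) := integral_congr_ae
        (by filter_upwards [Lp.coeFn_add a c] with x hx; rw [hx, Pi.add_apply, smul_add])
      have e2 : ∫ x, φ x • ((l + m : L2 N) x : ℂ) =
          ∫ x, (φ x • (l x : ℂ) + φ x • (m x : ℂ)) := integral_congr_ae
        (by filter_upwards [Lp.coeFn_add l m] with x hx; rw [hx, Pi.add_apply, smul_add])
      refine e1.trans (Eq.trans ?_ e2.symm)
      rw [integral_add (i1 a) (i1 c), integral_add (i2 l) (i2 m)]
      exact congrArg₂ (· + ·) (hl φ h1 h2) (hm φ h1 h2)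
    · filter_upwards [hl', hm', Lp.coeFn_add a c, Lp.coeFn_add b d, Lp.coeFn_add l m]
        with x h1 h2 h3 h4 h5
      change ((b + d : L2 N) x : ℂ) = -((l + m : L2 N) x : ℂ) + _ * ((a + c : L2 N) x : ℂ)
      change (b x : ℂ) = -(l x) + _ * (a x : ℂ) at h1
      change (d x : ℂ) = -(m x) + _ * (c x : ℂ) at h2
      rw [h3, h4, h5, Pi.add_apply, Pi.add_apply, Pi.add_apply, h1, h2]
      ring
  smul_mem' := by
    rintro z ⟨a, b⟩ ⟨l, hl, hl'⟩
    refine ⟨z • l, ?_, ?_⟩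
    · intro φ h1 h2
      have e1 : ∫ x, laplacian φ x • ((z • a : L2 N) x : ℂ) =
          ∫ x, z • (laplacian φ x • (a x : ℂ)) := integral_congr_ae
        (by filter_upwards [Lp.coeFn_smul z a] with x hx; rw [hx, Pi.smul_apply, smul_comm])
      have e2 : ∫ x, φ x • ((z • l : L2 N) x : ℂ) = ∫ x, z • (φ x • (l x : ℂ)) :=
        integral_congr_ae
        (by filter_upwards [Lp.coeFn_smul z l] with x hx; rw [hx, Pi.smul_apply, smul_comm])
      refine e1.trans (Eq.trans ?_ e2.symm)
      rw [integral_smul, integral_smul]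
      exact congrArg (z • ·) (hl φ h1 h2)
    · filter_upwards [hl', Lp.coeFn_smul z a, Lp.coeFn_smul z b, Lp.coeFn_smul z l]
        with x h1 h2 h3 h4
      change ((z • b : L2 N) x : ℂ) = -((z • l : L2 N) x : ℂ) + _ * ((z • a : L2 N) x : ℂ)
      change (b x : ℂ) = -(l x) + _ * (a x : ℂ) at h1
      rw [h2, h3, h4, Pi.smul_apply, Pi.smul_apply, Pi.smul_apply, h1]
      simp only [smul_eq_mul]
      ring

/-- The Hamiltonian of the atom or ion,
`H = ∑ᵢ (- Δ_{xᵢ} - e² Z / |xᵢ - y|) + ∑_{i<j} e² / |xᵢ - xⱼ|`,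
as an unbounded operator on `L²(ℝ^{3N})` with domain `{ψ ∈ L² | Δψ ∈ L², V ψ ∈ L²}`. Since
`V ψ ∈ L²` is automatic for `ψ ∈ H²`, the domain is the Sobolev space `H²(ℝ^{3N})`. -/
def hamiltonian (N : ℕ) (e Z : ℝ) (y : Space) : L2 N →ₗ.[ℂ] L2 N :=
  (hamiltonianGraph N e Z y).toLinearPMap

lemma hamiltonianGraph_single_valued (N : ℕ) (e Z : ℝ) (y : Space) :
    ∀ p ∈ hamiltonianGraph N e Z y, p.1 = 0 → p.2 = 0 := by
  rintro ⟨a, b⟩ ⟨l, hl, hl'⟩ (rfl : a = 0)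
  have h0 : ∀ᵐ x : Config N, ((0 : L2 N) x : ℂ) = 0 := Lp.coeFn_zero ℂ 2 volume
  have hl0 : ∀ᵐ x, (l x : ℂ) = 0 := by
    refine ae_eq_zero_of_integral_contDiff_smul_eq_zero
      ((Lp.memLp l).locallyIntegrable (by norm_num)) fun φ h1 h2 => ?_
    rw [← hl φ h1 h2]
    exact integral_eq_zero_of_ae
      (by filter_upwards [h0] with x hx; rw [hx, smul_zero, Pi.zero_apply])
  refine Lp.ext ?_
  filter_upwards [hl', hl0, h0] with x h1 h2 h3
  change (b x : ℂ) = -(l x) + _ * ((0 : L2 N) x : ℂ) at h1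
  rw [h1, h2, h3]
  simp

/-- The Hamiltonian has the intended graph. -/
lemma hamiltonian_graph (N : ℕ) (e Z : ℝ) (y : Space) :
    (hamiltonian N e Z y).graph = hamiltonianGraph N e Z y :=
  Submodule.toLinearPMap_graph_eq _ fun p hp h => hamiltonianGraph_single_valued N e Z y p hp h

/-! ### Spectrum, restriction to a subspace, ground state subspace -/

section Operators

variable {X : Type*} [NormedAddCommGroup X] [InnerProductSpace ℂ X]

/-- `z` is in the resolvent set of the unbounded operator `A`: `A - z` is a bijection from the
domain of `A` onto the whole space with a bounded inverse `B`. -/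
def IsResolventPoint (A : X →ₗ.[ℂ] X) (z : ℂ) : Prop :=
  ∃ B : X →L[ℂ] X,
    (∀ g : X, ∃ h : B g ∈ A.domain, A ⟨B g, h⟩ - z • B g = g) ∧
    ∀ ψ : A.domain, B (A ψ - z • (ψ : X)) = ψ

/-- The spectrum of an unbounded operator. -/
def spec (A : X →ₗ.[ℂ] X) : Set ℂ := {z | ¬ IsResolventPoint A z}

/-- The ground state energy `inf σ(A)` of a self-adjoint operator `A`. -/
def groundEnergy (A : X →ₗ.[ℂ] X) : ℝ := sInf {t : ℝ | (t : ℂ) ∈ spec A}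

/-- The ground state subspace of `A`: all `ψ` in the domain with `A ψ = inf σ(A) ψ`. -/
def groundSpace (A : X →ₗ.[ℂ] X) : Submodule ℂ X where
  carrier := {ψ | ∃ h : ψ ∈ A.domain, A ⟨ψ, h⟩ = (groundEnergy A : ℂ) • ψ}
  zero_mem' := ⟨A.domain.zero_mem, by
    rw [smul_zero]; exact A.map_zero⟩
  add_mem' := by
    rintro a b ⟨ha, ha'⟩ ⟨hb, hb'⟩
    refine ⟨A.domain.add_mem ha hb, ?_⟩
    rw [smul_add, ← ha', ← hb']
    exact A.map_add ⟨a, ha⟩ ⟨b, hb⟩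
  smul_mem' := by
    rintro z a ⟨ha, ha'⟩
    refine ⟨A.domain.smul_mem z ha, ?_⟩
    rw [smul_comm, ← ha']
    exact A.map_smul z ⟨a, ha⟩

/-- The restriction of `A` to a subspace `K`, as an operator on the space `K`: its domain consists
of the `ψ ∈ K` in the domain of `A` with `A ψ ∈ K` (if `K` is invariant, this is the intersection
of `K` with the domain of `A`). -/
def restrict (A : X →ₗ.[ℂ] X) (K : Submodule ℂ X) : K →ₗ.[ℂ] K where
  domain :=
    { carrier := {ψ | ∃ h : (ψ : X) ∈ A.domain, A ⟨ψ, h⟩ ∈ K}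
      zero_mem' := ⟨A.domain.zero_mem, by
        have h : A ⟨((0 : K) : X), A.domain.zero_mem⟩ = 0 := A.map_zero
        rw [h]; exact K.zero_mem⟩
      add_mem' := by
        rintro a b ⟨ha, ha'⟩ ⟨hb, hb'⟩
        refine ⟨A.domain.add_mem ha hb, ?_⟩
        have h := A.map_add ⟨(a : X), ha⟩ ⟨(b : X), hb⟩
        exact h ▸ K.add_mem ha' hb'
      smul_mem' := by
        rintro z a ⟨ha, ha'⟩
        refine ⟨A.domain.smul_mem z ha, ?_⟩
        have h := A.map_smul z ⟨(a : X), ha⟩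
        exact h ▸ K.smul_mem z ha' }
  toFun :=
    { toFun := fun ψ => ⟨A ⟨((ψ : K) : X), ψ.2.choose⟩, ψ.2.choose_spec⟩
      map_add' := fun a b => Subtype.ext
        (A.map_add ⟨((a : K) : X), a.2.choose⟩ ⟨((b : K) : X), b.2.choose⟩)
      map_smul' := fun z a => Subtype.ext (A.map_smul z ⟨((a : K) : X), a.2.choose⟩) }

/-- `A` is a trace class operator with trace `t`: the sum `∑ₖ ⟨eₖ, A eₖ⟩` converges to `t` for
every orthonormal (Hilbert) basis. -/
def HasTrace {X : Type} [NormedAddCommGroup X] [InnerProductSpace ℂ X] (A : X →L[ℂ] X) (t : ℂ) :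
    Prop :=
  ∀ (ι : Type) (b : HilbertBasis ι ℂ X), HasSum (fun k => inner ℂ (b k) (A (b k))) t

end Operators

/-! ### Symmetry types -/

lemma measurePreserving_perm {N : ℕ} (π : Equiv.Perm (Fin N)) :
    MeasurePreserving (fun x : Config N => x ∘ π) := by
  have h := volume_measurePreserving_piCongrLeft (fun _ : Fin N => Space) π.symm
  have h' : (MeasurableEquiv.piCongrLeft (fun _ : Fin N => Space) π.symm : Config N → Config N)
      = fun x => x ∘ π := by
    funext x i
    have := Equiv.piCongrLeft_apply_apply (P := fun _ : Fin N => Space) π.symm x (π i)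
    rw [Equiv.symm_apply_apply] at this
    exact this
  rwa [h'] at h

/-- The unitary representation of the symmetric group on `L²(ℝ^{3N})`,
`(T_π Ψ)(x₁, …, x_N) = Ψ(x_{π(1)}, …, x_{π(N)})`. -/
def permRep (N : ℕ) : Representation ℂ (Equiv.Perm (Fin N)) (L2 N) where
  toFun π := Lp.compMeasurePreservingₗ ℂ (fun x : Config N => x ∘ π) (measurePreserving_perm π)
  map_one' := by
    ext1 ψ
    exact Lp.compMeasurePreserving_id_apply ψ
  map_mul' π τ := by
    ext1 ψ
    exact Lp.compMeasurePreserving_comp_apply ψ (measurePreserving_perm τ)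
      (measurePreserving_perm π)

/-- The subspace of `L²(ℝ^{3N})` of symmetry type `α`: the isotypic component of the
representation `α`, i.e. the sum of all images of `α` under intertwining maps, on which the
representation of the symmetric group is a multiple of `α`. -/
def symmetrySubspace {N : ℕ} {V : Type*} [AddCommGroup V] [Module ℂ V]
    (α : Representation ℂ (Equiv.Perm (Fin N)) V) : Submodule ℂ (L2 N) :=
  ⨆ f : Representation.IntertwiningMap α (permRep N), LinearMap.range f.toLinearMap

/-- The ground state subspace, as a subspace of `L²(ℝ^{3N})`, of the Hamiltonian restricted to the
subspace `K`. -/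
def groundSpaceOn {N : ℕ} (e Z : ℝ) (y : Space) (K : Submodule ℂ (L2 N)) : Submodule ℂ (L2 N) :=
  (groundSpace (restrict (hamiltonian N e Z y) K)).map K.subtype

/-! ### Rotations -/

/-- The orthogonal transformation `R ∈ O(3)` acting on space with the point `y` as its centre. -/
def rotatePoint (y : Space) (R : Space ≃ₗᵢ[ℝ] Space) (z : Space) : Space := y + R (z - y)

lemma measurePreserving_rotatePoint (y : Space) (R : Space ≃ₗᵢ[ℝ] Space) :
    MeasurePreserving (rotatePoint y R) :=
  (measurePreserving_add_left volume y).comp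
    (R.measurePreserving.comp (measurePreserving_sub_right volume y))

/-- One-electron rotation, `(t_R f)(z) = f(R⁻¹ z)` with `y` as the origin. -/
def rotateOne (y : Space) (R : Space ≃ₗᵢ[ℝ] Space) : L2One →L[ℂ] L2One :=
  (Lp.compMeasurePreservingₗᵢ ℂ (rotatePoint y R.symm)
    (measurePreserving_rotatePoint y R.symm)).toContinuousLinearMap

/-- `N`-electron rotation, `(T_R Ψ)(z₁, …, z_N) = Ψ(R⁻¹ z₁, …, R⁻¹ z_N)` with `y` as the origin. -/
def rotate {N : ℕ} (y : Space) (R : Space ≃ₗᵢ[ℝ] Space) : L2 N →L[ℂ] L2 N :=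
  (Lp.compMeasurePreservingₗᵢ ℂ (fun (x : Config N) (i : Fin N) => rotatePoint y R.symm (x i))
    (volume_preserving_pi fun _ => measurePreserving_rotatePoint y R.symm)).toContinuousLinearMap

/-! ### The one-electron density -/

/-- `F = f ⊗ g`, with `f` a function of the first electron and `g` of the other ones. -/
def IsTensor {n : ℕ} (f : L2One) (g : L2 n) (F : L2 (n + 1)) : Prop :=
  ∀ᵐ x : Config (n + 1), (F x : ℂ) = f (x 0) * g (Fin.tail x)

/-- `B = b ⊗ 1`: the bounded operator that acts as `b` on the first electron and trivially on the
others; it is determined by `B (f ⊗ g) = (b f) ⊗ g`. -/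
def IsOneElectronLift {n : ℕ} (b : L2One →L[ℂ] L2One) (B : L2 (n + 1) →L[ℂ] L2 (n + 1)) : Prop :=
  ∀ (f : L2One) (g : L2 n) (F : L2 (n + 1)), IsTensor f g F → IsTensor (b f) g (B F)

/-- `ρ` is the one-electron density (operator) of `P`:
`Tr (b ρ) = Tr [(b ⊗ 1) P]` for every bounded one-electron operator `b`. -/
def IsOneElectronDensity {n : ℕ} (P : L2 (n + 1) →L[ℂ] L2 (n + 1)) (ρ : L2One →L[ℂ] L2One) :
    Prop :=
  ∀ (b : L2One →L[ℂ] L2One) (B : L2 (n + 1) →L[ℂ] L2 (n + 1)), IsOneElectronLift b B →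
    ∃ t : ℂ, HasTrace (B ∘L P) t ∧ HasTrace (b ∘L ρ) t

/-- `P` is the orthogonal projection onto the subspace `G`. -/
def IsOrthogonalProjectionOnto {N : ℕ} (P : L2 N →L[ℂ] L2 N) (G : Submodule ℂ (L2 N)) : Prop :=
  IsStarProjection P ∧ LinearMap.range (P : L2 N →ₗ[ℂ] L2 N) = G

/-- The one-electron density as a function,
`ρ(z) = ∑ᵢ ∫ |Ψᵢ(z, z₂, …, z_N)|² dz₂ ⋯ dz_N`. -/
def densityFunction {n : ℕ} {ι : Type} [Fintype ι] (Ψ : ι → L2 (n + 1)) (z : Space) : ℝ≥0∞ :=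
  ∑ i, ∫⁻ x : Config n, ‖(Ψ i (Fin.cons z x : Config (n + 1)) : ℂ)‖ₑ ^ 2

/-- The one-electron density of a subspace `G` (that is, of the orthogonal projection `P` onto `G`)
is spherically symmetric about `y`:
* if `G` is finite-dimensional, then `P` has a one-electron density operator, and only one;
* a density operator `ρ` of `P` satisfies `t_R ρ = ρ t_R`, i.e. `ρ = t_R ρ t_R⁻¹`, for all
  `R ∈ O(3)`;
* the density function given by any finite orthonormal basis of `G` is invariant under `O(3)`. -/
def HasSphericalDensity {n : ℕ} (y : Space) (G : Submodule ℂ (L2 (n + 1))) : Prop :=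
  (FiniteDimensional ℂ G → ∃ P, IsOrthogonalProjectionOnto P G ∧ ∃! ρ, IsOneElectronDensity P ρ) ∧
  (∀ P ρ, IsOrthogonalProjectionOnto P G → IsOneElectronDensity P ρ →
    ∀ R : Space ≃ₗᵢ[ℝ] Space, rotateOne y R ∘L ρ = ρ ∘L rotateOne y R) ∧
  (∀ (ι : Type) [Fintype ι] (Ψ : OrthonormalBasis ι ℂ G) (R : Space ≃ₗᵢ[ℝ] Space),
    ∀ᵐ z : Space, densityFunction (fun i => (Ψ i : L2 (n + 1))) (rotatePoint y R z) =
      densityFunction (fun i => (Ψ i : L2 (n + 1))) z)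

end AtomDensity

end

/-!
The ground state subspaces are invariant under rotations about the nucleus: the Laplacian is
invariant under rotations and so are all distances between the particles, hence the graph of the
Hamiltonian is invariant (`rotate_mem_hamiltonianGraph`), and rotations commute with the
permutations of the electrons, hence they preserve every symmetry type. The orthogonal projection
onto a rotation invariant subspace commutes with rotations.

**The one-electron density.** The partial inner product `slice f Ψ` of a wave function with a
function `f` of the first electron is the adjoint of `g ↦ f ⊗ g`. For an orthonormal basis `e` of
`L²(ℝ³)` one has `∑ₖ ⟨slice eₖ Ψ, slice eₖ Ψ'⟩ = ⟨Ψ, Ψ'⟩` (`hasSum_inner_slice`), because the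
tensor products are total. Since the adjoint of `b ⊗ 1` is `b† ⊗ 1`, the operator with the matrix
elements `⟨f, ρ g⟩ = ⟨slice g Ψ, slice f Ψ⟩` satisfies `Tr (b ρ) = ⟨Ψ, (b ⊗ 1) Ψ⟩`, and the sum of
these operators over an orthonormal basis of a finite-dimensional `G` is a density operator of the
projection onto `G`. It is unique, as the choice `b = |u⟩⟨v|` recovers the matrix element
`⟨v, ρ u⟩` as a trace (`IsOneElectronDensity.hasTrace_rankOneLift`). The invariance of the trace
under conjugation with a rotation then gives the invariance of `ρ`. For the density function one
uses that `∑ᵢ |Ψᵢ|²` does not depend on the orthonormal basis `Ψ` of `G`, and that a rotation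
carries one orthonormal basis to another.

**The ground state without symmetry restriction.** The last claim is Perron-Frobenius theory. By
Hardy's inequality the potential is infinitesimally small relative to the Laplacian, so that for
large `c` the operator `H + c` has a bounded inverse `K`, constructed from the resolvent of the free
Laplacian by Neumann series. The weak maximum principle shows that the free resolvent preserves
positivity; this passes to the resolvent with the repulsive potential (approximated by bounded
potentials) and then to `K`, as the attraction enters its Neumann series with the favourable sign
(`posPres_resolvent`). The ground states of `H` are eigenvectors of `K` for the eigenvalue `‖K‖`, so
the positive part `u` of a real ground state is again a ground state, and the indicator function
`1_S` of `S = {u > 0}` commutes with `K` (`posCut_comm`). Consequently multiplication by `1_S`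
commutes with the Laplacian in the sense of distributions. Applied to test functions times
coordinates, this says that `1_S` has zero distributional gradient, so `S` is null or conull
(`null_or_conull_of_resolvent_comm`): a real ground state does not change sign. If `Φ` is a real
ground state and `R` a rotation, then both `Φ` and `R Φ - Φ` have constant sign, while `Φ` and `R Φ`
have the same norm; this forces `R Φ = Φ` (`rotate_eq_self_of_mem_groundSpace`). Real and imaginary
parts of a ground state are ground states, so real ground states suffice.
-/

noncomputable section

namespace AtomDensity

open Filter Topology

/-! ### Test functions -/

/-- A test function: smooth, real-valued and compactly supported. -/
structure IsTest {N : ℕ} (φ : Config N → ℝ) : Prop where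
  smooth : ContDiff ℝ ∞ φ
  compact : HasCompactSupport φ

/-- The derivative of `φ` in the direction `v`. -/
def dirDeriv {N : ℕ} (v : Config N) (φ : Config N → ℝ) (x : Config N) : ℝ := fderiv ℝ φ x v

/-- The unit vector in the direction of the `k`-th coordinate of the `i`-th electron. -/
def unitVec {N : ℕ} (i : Fin N) (k : Fin 3) : Config N :=
  Pi.single i (EuclideanSpace.single k (1 : ℝ))

lemma dirDeriv_contDiff {N : ℕ} {φ : Config N → ℝ} (h : ContDiff ℝ ∞ φ) (v : Config N) :
    ContDiff ℝ ∞ (dirDeriv v φ) :=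
  (h.fderiv_right (m := ∞) le_rfl).clm_apply contDiff_const

lemma IsTest.dirDeriv {N : ℕ} {φ : Config N → ℝ} (h : IsTest φ) (v : Config N) :
    IsTest (dirDeriv v φ) :=
  ⟨dirDeriv_contDiff h.smooth v, h.compact.fderiv_apply ℝ v⟩

lemma IsTest.continuous {N : ℕ} {φ : Config N → ℝ} (h : IsTest φ) : Continuous φ :=
  h.smooth.continuous

lemma IsTest.add {N : ℕ} {φ η : Config N → ℝ} (h : IsTest φ) (h' : IsTest η) :
    IsTest (fun x => φ x + η x) :=
  ⟨h.smooth.add h'.smooth, h.compact.add h'.compact⟩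

lemma IsTest.const_mul {N : ℕ} {φ : Config N → ℝ} (h : IsTest φ) (c : ℝ) :
    IsTest (fun x => c * φ x) :=
  ⟨contDiff_const.mul h.smooth, h.compact.mul_left⟩

lemma IsTest.smooth_mul {N : ℕ} {φ f : Config N → ℝ} (h : IsTest φ) (hf : ContDiff ℝ ∞ f) :
    IsTest (fun x => f x * φ x) :=
  ⟨hf.mul h.smooth, h.compact.mul_left⟩

/-- The reflected translate `y ↦ φ (x - y)`, against which mollification integrates. -/
lemma IsTest.comp_sub {N : ℕ} {φ : Config N → ℝ} (h : IsTest φ) (x : Config N) :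
    IsTest (fun y => φ (x - y)) :=
  ⟨h.smooth.comp (contDiff_const.sub contDiff_id),
    h.compact.comp_homeomorph (Homeomorph.subLeft x)⟩

lemma IsTest.memLp {N : ℕ} {φ : Config N → ℝ} (h : IsTest φ) (p : ℝ≥0∞) : MemLp φ p volume :=
  h.continuous.memLp_of_hasCompactSupport h.compact

lemma laplacian_eq_sum_dirDeriv {N : ℕ} {φ : Config N → ℝ} (h : ContDiff ℝ ∞ φ) (x : Config N) :
    laplacian φ x = ∑ i : Fin N, ∑ k : Fin 3,
      dirDeriv (unitVec i k) (dirDeriv (unitVec i k) φ) x := by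
  unfold laplacian
  refine Finset.sum_congr rfl fun i _ => Finset.sum_congr rfl fun k _ => ?_
  rw [iteratedFDeriv_two_apply]
  have hd : DifferentiableAt ℝ (fderiv ℝ φ) x :=
    ((h.fderiv_right (m := ∞) le_rfl).differentiable (by simp)).differentiableAt
  have : fderiv ℝ (dirDeriv (unitVec i k) φ) x =
      (fderiv ℝ (fderiv ℝ φ) x).flip (unitVec i k) := by
    have := fderiv_clm_apply hd (differentiableAt_const (unitVec i k))
    simpa using! this
  change _ = fderiv ℝ (dirDeriv (unitVec i k) φ) x (unitVec i k)
  rw [this]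
  rfl

lemma IsTest.laplacian {N : ℕ} {φ : Config N → ℝ} (h : IsTest φ) : IsTest (laplacian φ) := by
  have : AtomDensity.laplacian φ = fun x => ∑ i : Fin N, ∑ k : Fin 3,
      AtomDensity.dirDeriv (unitVec i k) (AtomDensity.dirDeriv (unitVec i k) φ) x :=
    funext fun x => laplacian_eq_sum_dirDeriv h.smooth x
  refine ⟨?_, laplacian_hasCompactSupport h.compact⟩
  rw [this]
  exact ContDiff.sum fun i _ => ContDiff.sum fun k _ => ((h.dirDeriv _).dirDeriv _).smooth

lemma IsTest.integrable_mul {N : ℕ} {φ w : Config N → ℝ} (h : IsTest φ)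
    (hw : LocallyIntegrable w volume) : Integrable (fun x => w x * φ x) :=
  hw.integrable_smul_right_of_hasCompactSupport h.continuous h.compact

instance config_isNegInvariant (N : ℕ) : (volume : Measure (Config N)).IsNegInvariant :=
  ⟨(volume_preserving_pi fun _ : Fin N => Measure.measurePreserving_neg (volume : Measure Space)).map_eq⟩

/-! ### Mollification -/

/-- The convolution `w ⋆ η`. -/
def mollify {N : ℕ} (w η : Config N → ℝ) (x : Config N) : ℝ := ∫ y, w y * η (x - y)

lemma mollify_eq_convolution {N : ℕ} (w η : Config N → ℝ) :
    mollify w η = convolution w η (ContinuousLinearMap.lsmul ℝ ℝ) volume := rfl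

lemma mollify_hasFDerivAt_apply {N : ℕ} {w η : Config N → ℝ} (hw : LocallyIntegrable w volume)
    (hη : IsTest η) (x : Config N) :
    DifferentiableAt ℝ (mollify w η) x ∧
      ∀ v, fderiv ℝ (mollify w η) x v = mollify w (dirDeriv v η) x := by
  have h := hη.compact.hasFDerivAt_convolution_right (ContinuousLinearMap.lsmul ℝ ℝ) hw
    (hη.smooth.of_le (by simp)) x
  refine ⟨h.differentiableAt, fun v => ?_⟩
  rw [mollify_eq_convolution, h.fderiv, convolution_precompR_apply _ hw (hη.compact.fderiv ℝ)
    (hη.smooth.continuous_fderiv (by simp))]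
  rfl

/-- The derivative of a mollification along a line. -/
lemma mollify_hasDerivAt_line {N : ℕ} {w η : Config N → ℝ} (hw : LocallyIntegrable w volume)
    (hη : IsTest η) (x v : Config N) (s : ℝ) :
    HasDerivAt (fun t : ℝ => mollify w η (x + t • v)) (mollify w (dirDeriv v η) (x + s • v)) s := by
  obtain ⟨h1, h2⟩ := mollify_hasFDerivAt_apply hw hη (x + s • v)
  rw [← h2 v]
  have hl : HasDerivAt (fun t : ℝ => x + t • v) v s := by
    simpa using ((hasDerivAt_id s).smul_const v).const_add x
  exact h1.hasFDerivAt.comp_hasDerivAt s hl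

/-- A family of bump functions at the origin with radii tending to zero. -/
def shrinkingBump (N : ℕ) (n : ℕ) : ContDiffBump (0 : Config N) :=
  ⟨1 / (n + 1), 2 / (n + 1), by positivity, by gcongr; norm_num⟩

lemma shrinkingBump_isTest (N n : ℕ) :
    IsTest ((shrinkingBump N n).normed volume) :=
  ⟨(shrinkingBump N n).contDiff_normed, (shrinkingBump N n).hasCompactSupport_normed⟩

/-- Mollifications converge almost everywhere, by Lebesgue's differentiation theorem. -/
lemma ae_tendsto_mollify {N : ℕ} {w : Config N → ℝ} (hw : LocallyIntegrable w volume) :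
    ∀ᵐ x, Tendsto (fun n => mollify w ((shrinkingBump N n).normed volume) x) atTop (𝓝 (w x)) := by
  have h1 : Tendsto (fun n => (shrinkingBump N n).rOut) atTop (𝓝 0) := by
    have := (tendsto_one_div_add_atTop_nhds_zero_nat (𝕜 := ℝ)).const_mul 2
    simpa [shrinkingBump, mul_one_div, div_eq_mul_inv] using this
  have h2 : ∀ᶠ n in atTop, (shrinkingBump N n).rOut ≤ 2 * (shrinkingBump N n).rIn :=
    Eventually.of_forall fun n => by simp [shrinkingBump, div_eq_mul_inv]
  filter_upwards [ContDiffBump.ae_convolution_tendsto_right_of_locallyIntegrable h1 h2 hw]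
    with x hx
  refine hx.congr fun n => ?_
  rw [convolution_eq_swap]
  exact integral_congr_ae (Eventually.of_forall fun y => mul_comm _ _)

lemma ae_nonneg_of_forall_test {N : ℕ} {w : Config N → ℝ} (hw : LocallyIntegrable w volume)
    (h : ∀ φ, IsTest φ → (∀ x, 0 ≤ φ x) → 0 ≤ ∫ x, w x * φ x) : ∀ᵐ x, 0 ≤ w x := by
  filter_upwards [ae_tendsto_mollify hw] with x hx
  exact ge_of_tendsto' hx fun n => h _ ((shrinkingBump_isTest N n).comp_sub x)
    fun y => (shrinkingBump N n).nonneg_normed _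

/-- A locally integrable function with vanishing weak gradient is constant. -/
lemma ae_const_of_weak_gradient_eq_zero {N : ℕ} {w : Config N → ℝ}
    (hw : LocallyIntegrable w volume)
    (h : ∀ φ, IsTest φ → ∀ i k, ∫ x, w x * dirDeriv (unitVec i k) φ x = 0) :
    ∃ c : ℝ, ∀ᵐ x, w x = c := by
  have hv : ∀ φ, IsTest φ → ∀ v : Config N, ∫ x, w x * dirDeriv v φ x = 0 := by
    intro φ hφ v
    have hdec : v = ∑ i, ∑ k, (v i k) • unitVec i k := by
      funext i
      ext k
      simp only [unitVec, Finset.sum_apply, Pi.smul_apply, WithLp.ofLp_sum, WithLp.ofLp_smul,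
        smul_eq_mul, Pi.single_apply, apply_ite, ite_apply]
      simp [Finset.sum_ite_eq]
    have : ∀ x, w x * dirDeriv v φ x =
        ∑ i, ∑ k, (v i k) * (w x * dirDeriv (unitVec i k) φ x) := by
      intro x
      conv_lhs => rw [hdec]
      simp only [dirDeriv, map_sum, map_smul, smul_eq_mul, Finset.mul_sum]
      refine Finset.sum_congr rfl fun i _ => Finset.sum_congr rfl fun k _ => ?_
      ring
    simp_rw [this]
    rw [integral_finsetSum _ fun i _ => integrable_finsetSum _ fun k _ =>
      ((hφ.dirDeriv _).integrable_mul hw).const_mul _]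
    refine Finset.sum_eq_zero fun i _ => ?_
    rw [integral_finsetSum _ fun k _ => ((hφ.dirDeriv _).integrable_mul hw).const_mul _]
    refine Finset.sum_eq_zero fun k _ => ?_
    rw [integral_const_mul, h φ hφ, mul_zero]
  have hconst : ∀ η, IsTest η → ∀ x, mollify w η x = mollify w η 0 := by
    intro η hη x
    have hd : ∀ t : ℝ, HasDerivAt (fun t : ℝ => mollify w η (0 + t • x)) 0 t := by
      intro t
      convert mollify_hasDerivAt_line hw hη 0 x t using 1
      have hz := hv _ (hη.comp_sub (0 + t • x)) (-x)
      rw [mollify, ← hz]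
      refine integral_congr_ae (Eventually.of_forall fun y => ?_)
      change w y * _ = w y * _
      congr 1
      have h1 : HasFDerivAt (fun y => η (0 + t • x - y))
          ((fderiv ℝ η (0 + t • x - y)).comp (-(ContinuousLinearMap.id ℝ (Config N)))) y :=
        (hη.smooth.differentiable (by simp)).differentiableAt.hasFDerivAt.comp y
          ((hasFDerivAt_id y).const_sub _)
      rw [dirDeriv, dirDeriv, h1.fderiv]
      simp
    have := is_const_of_deriv_eq_zero (fun t => (hd t).differentiableAt)
      (fun t => (hd t).deriv) 1 0
    simpa using this
  have hae := ae_tendsto_mollify hw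
  obtain ⟨x₀, hx₀⟩ := hae.exists
  refine ⟨w x₀, ?_⟩
  filter_upwards [hae] with x hx
  refine tendsto_nhds_unique hx (hx₀.congr fun n => ?_)
  rw [hconst _ (shrinkingBump_isTest N n) x, hconst _ (shrinkingBump_isTest N n) x₀]


/-! ### The weak maximum principle -/

lemma second_deriv_nonneg_of_min {f g : ℝ → ℝ} {h : ℝ} (hf : ∀ s, HasDerivAt f (g s) s)
    (hg : HasDerivAt g h 0) (hmin : ∀ s, f 0 ≤ f s) : 0 ≤ h := by
  by_contra! hneg
  have hlmin : IsLocalMin f 0 := Eventually.of_forall hmin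
  have hfg : deriv f = g := funext fun s => (hf s).deriv
  have hlmax : IsLocalMax f 0 := by
    refine isLocalMax_of_deriv_deriv_neg ?_ hlmin.deriv_eq_zero (hf 0).continuousAt
    rw [hfg, hg.deriv]
    exact hneg
  have hc : f =ᶠ[𝓝 0] fun _ => f 0 := by
    filter_upwards [hlmin, hlmax] with s h1 h2 using le_antisymm h2 h1
  have hc' : g =ᶠ[𝓝 0] fun _ => 0 := by
    have := hc.deriv
    rw [hfg] at this
    simpa using this
  have := (hc'.hasDerivAt_iff.1 hg).unique (hasDerivAt_const _ _)
  linarith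

open scoped Pointwise in
lemma mollify_eventually_small {N : ℕ} {w η : Config N → ℝ} (hw : MemLp w 2 volume)
    (hη : IsTest η) {δ : ℝ} (hδ : 0 < δ) : ∀ᶠ x in cocompact (Config N), |mollify w η x| ≤ δ := by
  have hw2 : Integrable (fun y => w y ^ 2) := hw.integrable_sq
  have hη2 : Integrable (fun y => η y ^ 2) := (hη.memLp 2).integrable_sq
  set A := ∫ y, η y ^ 2
  have hA : 0 ≤ A := integral_nonneg fun y => sq_nonneg _
  set lam := (A + 1) / δ
  have hlam : 0 < lam := by positivity
  -- The mass of `w` far away is small.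
  have htail : ∃ n : ℕ, ∫ y in (Metric.closedBall (0 : Config N) n)ᶜ, w y ^ 2 < δ / lam := by
    have := tendsto_setIntegral_of_antitone (μ := volume) (f := fun y => w y ^ 2)
      (s := fun n : ℕ => (Metric.closedBall (0 : Config N) n)ᶜ)
      (fun n => Metric.isClosed_closedBall.measurableSet.compl)
      (fun m n hmn => Set.compl_subset_compl.2 (Metric.closedBall_subset_closedBall (by simpa)))
      ⟨0, hw2.integrableOn⟩
    have he : ⋂ n : ℕ, (Metric.closedBall (0 : Config N) n)ᶜ = ∅ := by
      rw [← Set.compl_iUnion, Metric.iUnion_closedBall_nat, Set.compl_univ]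
    rw [he, setIntegral_empty] at this
    exact (this.eventually (gt_mem_nhds (by positivity))).exists
  obtain ⟨n, hn⟩ := htail
  have hK : IsCompact (Metric.closedBall (0 : Config N) n + tsupport η) :=
    (isCompact_closedBall _ _).add hη.compact
  filter_upwards [hK.compl_mem_cocompact] with x hx
  set T := (Metric.closedBall (0 : Config N) n)ᶜ
  have hT : MeasurableSet T := Metric.isClosed_closedBall.measurableSet.compl
  -- Young's inequality on `T`; elsewhere `x - y` lies outside the support of `η`.
  have hpt : ∀ y, |w y * η (x - y)| ≤
      T.indicator (fun y => lam / 2 * w y ^ 2) y + 1 / (2 * lam) * η (x - y) ^ 2 := by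
    intro y
    by_cases hy : y ∈ T
    · rw [Set.indicator_of_mem hy, abs_mul]
      have h1 : (1 / (2 * lam)) * (lam * |w y| - |η (x - y)|) ^ 2 =
          lam / 2 * w y ^ 2 + 1 / (2 * lam) * η (x - y) ^ 2 - |w y| * |η (x - y)| := by
        rw [← sq_abs (w y), ← sq_abs (η (x - y))]
        field_simp
        ring
      have h2 : 0 ≤ (1 / (2 * lam)) * (lam * |w y| - |η (x - y)|) ^ 2 := by positivity
      linarith
    · have hy' : y ∈ Metric.closedBall (0 : Config N) n := by simpa [T] using hy
      have : η (x - y) = 0 := by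
        by_contra hne
        exact hx ⟨y, hy', x - y, subset_tsupport _ hne, add_sub_cancel y x⟩
      simp [this, hy]
  have hη2x : ∫ y, η (x - y) ^ 2 = A := integral_sub_left_eq_self (fun y => η y ^ 2) volume x
  have hi1 : Integrable (T.indicator fun y => lam / 2 * w y ^ 2) :=
    (hw2.const_mul _).indicator hT
  have hi2 : Integrable fun y => 1 / (2 * lam) * η (x - y) ^ 2 :=
    ((((hη.comp_sub x).memLp 2).integrable_sq)).const_mul _
  calc |mollify w η x| ≤ ∫ y, |w y * η (x - y)| := abs_integral_le_integral_abs
    _ ≤ ∫ y, (T.indicator (fun y => lam / 2 * w y ^ 2) y + 1 / (2 * lam) * η (x - y) ^ 2) :=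
        integral_mono_of_nonneg (Eventually.of_forall fun y => abs_nonneg _) (hi1.add hi2)
          (Eventually.of_forall hpt)
    _ = lam / 2 * (∫ y in T, w y ^ 2) + 1 / (2 * lam) * A := by
        rw [integral_add hi1 hi2, integral_indicator hT, integral_const_mul, integral_const_mul,
          hη2x]
    _ ≤ lam / 2 * (δ / lam) + 1 / (2 * lam) * A := by gcongr
    _ ≤ δ := by
        have : 1 / (2 * lam) * A ≤ δ / 2 := by
          simp only [lam]
          field_simp
          linarith
        have h2 : lam / 2 * (δ / lam) = δ / 2 := by field_simp
        linarith

lemma dirDeriv_dirDeriv_comp_sub {N : ℕ} {η : Config N → ℝ} (hη : IsTest η) (x v : Config N) :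
    dirDeriv v (dirDeriv v fun y => η (x - y)) = fun y => dirDeriv v (dirDeriv v η) (x - y) := by
  have key : ∀ {θ : Config N → ℝ}, IsTest θ → ∀ y,
      dirDeriv v (fun y => θ (x - y)) y = -dirDeriv v θ (x - y) := by
    intro θ hθ y
    have h1 : HasFDerivAt (fun y => θ (x - y))
        ((fderiv ℝ θ (x - y)).comp (-(ContinuousLinearMap.id ℝ (Config N)))) y :=
      (hθ.smooth.differentiable (by simp)).differentiableAt.hasFDerivAt.comp y
        ((hasFDerivAt_id y).const_sub _)
    rw [dirDeriv, dirDeriv, h1.fderiv]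
    simp
  funext y
  rw [show (dirDeriv v fun y => η (x - y)) = fun y => (-1) * dirDeriv v η (x - y) from
    funext fun z => by rw [key hη]; ring]
  have h2 := key (hη.dirDeriv v) y
  have h3 : DifferentiableAt ℝ (fun y => dirDeriv v η (x - y)) y :=
    ((((hη.dirDeriv v).comp_sub x).smooth).differentiable (by simp)).differentiableAt
  rw [dirDeriv, fderiv_const_mul h3]
  change (-1) * dirDeriv v (fun y => dirDeriv v η (x - y)) y = _
  rw [h2]
  ring

lemma laplacian_comp_sub {N : ℕ} {η : Config N → ℝ} (hη : IsTest η) (x y : Config N) :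
    laplacian (fun y => η (x - y)) y = laplacian η (x - y) := by
  rw [laplacian_eq_sum_dirDeriv (hη.comp_sub x).smooth, laplacian_eq_sum_dirDeriv hη.smooth]
  refine Finset.sum_congr rfl fun i _ => Finset.sum_congr rfl fun k _ => ?_
  rw [dirDeriv_dirDeriv_comp_sub hη]

/-- The weak maximum principle: an `L²` function `w` with `-Δw + c w ≥ 0` in the sense of
distributions, `c > 0`, is nonnegative. A mollification of `w` vanishes at infinity, so a negative
value would give a negative minimum, where its Laplacian cannot be negative. -/
lemma ae_nonneg_of_weak_supersolution {N : ℕ} {w : Config N → ℝ} (hw : MemLp w 2 volume) {c : ℝ}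
    (hc : 0 < c)
    (h : ∀ φ, IsTest φ → (∀ x, 0 ≤ φ x) → ∫ x, w x * laplacian φ x ≤ c * ∫ x, w x * φ x) :
    ∀ᵐ x, 0 ≤ w x := by
  have hwl : LocallyIntegrable w volume := hw.locallyIntegrable (by norm_num)
  -- At a negative minimum `x₀` of the mollification, testing with `η (x₀ - ·)` gives a contradiction.
  have hmoll : ∀ η, IsTest η → (∀ x, 0 ≤ η x) → ∀ x, 0 ≤ mollify w η x := by
    intro η hη hη0 x₁
    by_contra! hneg
    have hcont : Continuous (mollify w η) :=
      continuous_iff_continuousAt.2 fun x =>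
        (mollify_hasFDerivAt_apply hwl hη x).1.continuousAt
    obtain ⟨x₀, hx₀⟩ := hcont.exists_forall_le' x₁ (by
      filter_upwards [mollify_eventually_small hw hη (neg_pos.2 hneg)] with x hx
      linarith [neg_abs_le (mollify w η x)])
    have h2 : ∀ i k, 0 ≤ mollify w (dirDeriv (unitVec i k) (dirDeriv (unitVec i k) η)) x₀ := by
      intro i k
      have := second_deriv_nonneg_of_min
        (f := fun t => mollify w η (x₀ + t • unitVec i k))
        (fun s => mollify_hasDerivAt_line hwl hη x₀ (unitVec i k) s)
        (mollify_hasDerivAt_line hwl (hη.dirDeriv (unitVec i k)) x₀ (unitVec i k) 0)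
        (fun s => by simpa using hx₀ _)
      simpa using this
    have h3 : ∫ y, w y * laplacian (fun y => η (x₀ - y)) y =
        ∑ i, ∑ k, mollify w (dirDeriv (unitVec i k) (dirDeriv (unitVec i k) η)) x₀ := by
      have hint : ∀ i k, Integrable (fun y => w y *
          dirDeriv (unitVec i k) (dirDeriv (unitVec i k) η) (x₀ - y)) := fun i k =>
        (((hη.dirDeriv (unitVec i k)).dirDeriv (unitVec i k)).comp_sub x₀).integrable_mul hwl
      simp_rw [laplacian_comp_sub hη, laplacian_eq_sum_dirDeriv hη.smooth, Finset.mul_sum]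
      rw [integral_finsetSum _ fun i _ => integrable_finsetSum _ fun k _ => hint i k]
      refine Finset.sum_congr rfl fun i _ => ?_
      rw [integral_finsetSum _ fun k _ => hint i k]
      rfl
    have h4 := h _ (hη.comp_sub x₀) fun y => hη0 _
    rw [h3] at h4
    have h5 : 0 ≤ c * mollify w η x₀ :=
      le_trans (Finset.sum_nonneg fun i _ => Finset.sum_nonneg fun k _ => h2 i k) h4
    have h6 := hx₀ x₁
    have h7 : 0 ≤ mollify w η x₀ := nonneg_of_mul_nonneg_right h5 hc
    linarith
  refine ae_nonneg_of_forall_test hwl fun φ hφ hφ0 => ?_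
  have := hmoll (fun y => φ (0 - y)) (hφ.comp_sub 0) (fun _ => hφ0 _) 0
  simpa [mollify] using this


/-! ### The free Laplacian and its resolvent -/

lemma memLp_ofReal {N : ℕ} {φ : Config N → ℝ} (h : IsTest φ) :
    MemLp (fun x => (φ x : ℂ)) 2 volume := (h.memLp 2).ofReal

open Classical in
/-- A test function as a vector of `L²(ℝ^{3N}; ℂ)`; zero if `φ` is not a test function. -/
def testVec {N : ℕ} (φ : Config N → ℝ) : L2 N :=
  if h : IsTest φ then (memLp_ofReal h).toLp _ else 0

lemma testVec_ae {N : ℕ} {φ : Config N → ℝ} (h : IsTest φ) :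
    ∀ᵐ x, (testVec φ x : ℂ) = φ x := by
  rw [testVec, dif_pos h]
  exact (memLp_ofReal h).coeFn_toLp

lemma inner_testVec {N : ℕ} {φ : Config N → ℝ} (h : IsTest φ) (ψ : L2 N) :
    inner ℂ (testVec φ) ψ = ∫ x, φ x • (ψ x : ℂ) := by
  rw [L2.inner_def]
  refine integral_congr_ae ?_
  filter_upwards [testVec_ae h] with x hx
  rw [hx, RCLike.inner_apply, Complex.conj_ofReal, Complex.real_smul, mul_comm]

lemma inner_testVec_testVec {N : ℕ} {φ η : Config N → ℝ} (h : IsTest φ) (h' : IsTest η) :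
    inner ℂ (testVec φ) (testVec η) = ((∫ x, φ x * η x : ℝ) : ℂ) := by
  rw [inner_testVec h]
  refine Eq.trans (integral_congr_ae ?_) (integral_ofReal (𝕜 := ℂ))
  filter_upwards [testVec_ae h'] with x hx
  rw [hx, Complex.real_smul]
  exact (Complex.ofReal_mul _ _).symm

lemma isWeakLaplacian_iff {N : ℕ} {ψ l : L2 N} : IsWeakLaplacian ψ l ↔
    ∀ φ, IsTest φ → inner ℂ (testVec (laplacian φ)) ψ = inner ℂ (testVec φ) l := by
  constructor
  · intro h φ hφ
    rw [inner_testVec hφ, inner_testVec hφ.laplacian, h φ hφ.smooth hφ.compact]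
  · intro h φ h1 h2
    have hφ : IsTest φ := ⟨h1, h2⟩
    rw [← inner_testVec hφ, ← inner_testVec hφ.laplacian, h φ hφ]

/-- The graph of the distributional Laplacian in `L²`. -/
def laplaceGraph (N : ℕ) : Submodule ℂ (L2 N × L2 N) where
  carrier := {p | IsWeakLaplacian p.1 p.2}
  zero_mem' := isWeakLaplacian_iff.2 fun φ _ => by simp
  add_mem' := fun {a b} ha hb => isWeakLaplacian_iff.2 fun φ hφ => by
    simp [inner_add_right, isWeakLaplacian_iff.1 ha φ hφ, isWeakLaplacian_iff.1 hb φ hφ]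
  smul_mem' := fun z a ha => isWeakLaplacian_iff.2 fun φ hφ => by
    simp [inner_smul_right, isWeakLaplacian_iff.1 ha φ hφ]

lemma mem_laplaceGraph {N : ℕ} {p : L2 N × L2 N} :
    p ∈ laplaceGraph N ↔ IsWeakLaplacian p.1 p.2 := Iff.rfl

lemma isClosed_laplaceGraph (N : ℕ) : IsClosed (laplaceGraph N : Set (L2 N × L2 N)) := by
  have : (laplaceGraph N : Set (L2 N × L2 N)) = ⋂ φ : {φ : Config N → ℝ // IsTest φ},
      {p | inner ℂ (testVec (laplacian φ.1)) p.1 = inner ℂ (testVec φ.1) p.2} := by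
    ext p
    simp only [SetLike.mem_coe, mem_laplaceGraph, isWeakLaplacian_iff, Set.mem_iInter,
      Set.mem_ofPred_eq, Subtype.forall]
  rw [this]
  exact isClosed_iInter fun φ => isClosed_eq (by fun_prop) (by fun_prop)

lemma re_memLp {N : ℕ} (ψ : L2 N) : MemLp (fun x => (ψ x).re) 2 volume := (Lp.memLp ψ).re
lemma im_memLp {N : ℕ} (ψ : L2 N) : MemLp (fun x => (ψ x).im) 2 volume := (Lp.memLp ψ).im

lemma re_integral_smul {N : ℕ} {φ : Config N → ℝ} (h : IsTest φ) (ψ : L2 N) :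
    (∫ x, φ x • (ψ x : ℂ)).re = ∫ x, (ψ x).re * φ x := by
  have := integral_re (integrable_smul_of_hasCompactSupport h.continuous h.compact ψ)
  simp only [RCLike.re_eq_complex_re] at this
  rw [← this]
  exact integral_congr_ae (Eventually.of_forall fun x => by simp [mul_comm])

lemma im_integral_smul {N : ℕ} {φ : Config N → ℝ} (h : IsTest φ) (ψ : L2 N) :
    (∫ x, φ x • (ψ x : ℂ)).im = ∫ x, (ψ x).im * φ x := by
  have := integral_im (integrable_smul_of_hasCompactSupport h.continuous h.compact ψ)
  simp only [RCLike.im_eq_complex_im] at this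
  rw [← this]
  exact integral_congr_ae (Eventually.of_forall fun x => by simp [mul_comm])

lemma ae_eq_zero_of_weak_solution {N : ℕ} {w : Config N → ℝ} (hw : MemLp w 2 volume) {c : ℝ}
    (hc : 0 < c) (h : ∀ φ, IsTest φ → ∫ x, w x * laplacian φ x = c * ∫ x, w x * φ x) :
    ∀ᵐ x, w x = 0 := by
  have h1 := ae_nonneg_of_weak_supersolution hw hc fun φ hφ _ => (h φ hφ).le
  have h2 := ae_nonneg_of_weak_supersolution hw.neg hc fun φ hφ _ => by
    simp only [Pi.neg_apply, neg_mul, integral_neg]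
    rw [h φ hφ]
    linarith
  filter_upwards [h1, h2] with x h1 h2
  simp only [Pi.neg_apply] at h2
  linarith

/-- `-Δψ + cψ = 0` has no nonzero solution in `L²`. -/
lemma eq_zero_of_inner_laplacian {N : ℕ} {ψ : L2 N} {c : ℝ} (hc : 0 < c)
    (h : ∀ φ, IsTest φ → inner ℂ (testVec (laplacian φ)) ψ = c * inner ℂ (testVec φ) ψ) :
    ψ = 0 := by
  have h1 := ae_eq_zero_of_weak_solution (re_memLp ψ) hc fun φ hφ => by
    have := congrArg Complex.re (h φ hφ)
    rwa [inner_testVec hφ, inner_testVec hφ.laplacian, Complex.re_ofReal_mul,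
      re_integral_smul hφ, re_integral_smul hφ.laplacian] at this
  have h2 := ae_eq_zero_of_weak_solution (im_memLp ψ) hc fun φ hφ => by
    have := congrArg Complex.im (h φ hφ)
    rwa [inner_testVec hφ, inner_testVec hφ.laplacian, Complex.im_ofReal_mul,
      im_integral_smul hφ, im_integral_smul hφ.laplacian] at this
  refine Lp.ext ?_
  filter_upwards [h1, h2, Lp.coeFn_zero ℂ 2 (volume : Measure (Config N))] with x h1 h2 h3
  rw [h3]
  exact Complex.ext h1 h2

/-- Integration by parts. -/
lemma integral_mul_dirDeriv {N : ℕ} {f η : Config N → ℝ} (hf : ContDiff ℝ 1 f) (hη : IsTest η)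
    (v : Config N) : ∫ x, f x * dirDeriv v η x = -∫ x, dirDeriv v f x * η x := by
  refine integral_mul_fderiv_eq_neg_fderiv_mul_of_integrable ?_ ?_ ?_
    (fun x _ => (hf.differentiable (by simp)).differentiableAt)
    (fun x _ => (hη.smooth.differentiable (by simp)).differentiableAt)
  · have : Continuous (fun x => fderiv ℝ f x v) :=
      (hf.continuous_fderiv (by simp)).clm_apply continuous_const
    exact (this.mul hη.continuous).integrable_of_hasCompactSupport hη.compact.mul_left
  · exact (hf.continuous.mul (hη.dirDeriv v).continuous).integrable_of_hasCompactSupport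
      (hη.dirDeriv v).compact.mul_left
  · exact (hf.continuous.mul hη.continuous).integrable_of_hasCompactSupport hη.compact.mul_left

/-- Green's first identity. -/
lemma integral_mul_laplacian {N : ℕ} {φ η : Config N → ℝ} (hφ : IsTest φ) (hη : IsTest η) :
    ∫ x, φ x * laplacian η x =
      -∑ i, ∑ k, ∫ x, dirDeriv (unitVec i k) φ x * dirDeriv (unitVec i k) η x := by
  simp_rw [laplacian_eq_sum_dirDeriv hη.smooth, Finset.mul_sum]
  have hint : ∀ i k, Integrable (fun x => φ x *
      dirDeriv (unitVec i k) (dirDeriv (unitVec i k) η) x) := fun i k =>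
    (((hη.dirDeriv _).dirDeriv _)).integrable_mul
      (hφ.continuous.locallyIntegrable)
  rw [integral_finsetSum _ fun i _ => integrable_finsetSum _ fun k _ => hint i k,
    ← Finset.sum_neg_distrib]
  refine Finset.sum_congr rfl fun i _ => ?_
  rw [integral_finsetSum _ fun k _ => hint i k, ← Finset.sum_neg_distrib]
  refine Finset.sum_congr rfl fun k _ => ?_
  rw [integral_mul_dirDeriv (hφ.smooth.of_le (by simp)) (hη.dirDeriv _)]

lemma isWeakLaplacian_testVec {N : ℕ} {φ : Config N → ℝ} (h : IsTest φ) :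
    IsWeakLaplacian (testVec φ) (testVec (laplacian φ)) := by
  refine isWeakLaplacian_iff.2 fun η hη => ?_
  rw [inner_testVec_testVec hη.laplacian h, inner_testVec_testVec hη h.laplacian,
    integral_mul_laplacian hη h]
  simp_rw [mul_comm (laplacian η _)]
  rw [integral_mul_laplacian h hη]
  simp_rw [mul_comm (dirDeriv _ φ _)]

/-- The graph of the Laplacian on complex test functions `a + i b`. -/
def testGraph (N : ℕ) : Submodule ℂ (L2 N × L2 N) :=
  Submodule.span ℂ {p | ∃ φ, IsTest φ ∧ p = (testVec φ, testVec (laplacian φ))}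

lemma testGraph_le {N : ℕ} : testGraph N ≤ laplaceGraph N := by
  refine Submodule.span_le.2 ?_
  rintro _ ⟨φ, hφ, rfl⟩
  exact isWeakLaplacian_testVec hφ

lemma testVec_congr_ae {N : ℕ} {φ : Config N → ℝ} (h : IsTest φ) {ψ : L2 N}
    (hψ : ∀ᵐ x, (ψ x : ℂ) = φ x) : testVec φ = ψ := by
  refine Lp.ext ?_
  filter_upwards [hψ, testVec_ae h] with x h1 h2
  rw [h1, h2]

lemma laplacian_add_mul {N : ℕ} {a b : Config N → ℝ} (ha : IsTest a) (hb : IsTest b) (s t : ℝ) :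
    laplacian (fun x => s * a x + t * b x) = fun x => s * laplacian a x + t * laplacian b x := by
  have key : ∀ {f g : Config N → ℝ}, IsTest f → IsTest g → ∀ v,
      dirDeriv v (fun x => s * f x + t * g x) = fun x => s * dirDeriv v f x + t * dirDeriv v g x := by
    intro f g hf hg v
    funext x
    have h1 := (hf.smooth.differentiable (by simp)).differentiableAt (x := x)
    have h2 := (hg.smooth.differentiable (by simp)).differentiableAt (x := x)
    simp only [dirDeriv]
    have h3 : HasFDerivAt (fun x => s * f x + t * g x) _ x :=
      (h1.hasFDerivAt.const_mul s).add (h2.hasFDerivAt.const_mul t)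
    rw [h3.fderiv]
    rfl
  funext x
  rw [laplacian_eq_sum_dirDeriv ((ha.const_mul s).add (hb.const_mul t)).smooth,
    laplacian_eq_sum_dirDeriv ha.smooth, laplacian_eq_sum_dirDeriv hb.smooth]
  simp_rw [Finset.mul_sum, ← Finset.sum_add_distrib]
  refine Finset.sum_congr rfl fun i _ => Finset.sum_congr rfl fun k _ => ?_
  rw [key ha hb, key (ha.dirDeriv _) (hb.dirDeriv _)]

lemma testVec_add_mul {N : ℕ} {a b : Config N → ℝ} (ha : IsTest a) (hb : IsTest b) (s t : ℝ) :
    testVec (fun x => s * a x + t * b x) = (s : ℂ) • testVec a + (t : ℂ) • testVec b := by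
  refine testVec_congr_ae ((ha.const_mul s).add (hb.const_mul t)) ?_
  filter_upwards [Lp.coeFn_add ((s : ℂ) • testVec a) ((t : ℂ) • testVec b),
    Lp.coeFn_smul (s : ℂ) (testVec a), Lp.coeFn_smul (t : ℂ) (testVec b),
    testVec_ae ha, testVec_ae hb] with x h1 h2 h3 h4 h5
  rw [h1, Pi.add_apply, h2, h3, Pi.smul_apply, Pi.smul_apply, h4, h5]
  push_cast
  simp

lemma mem_testGraph {N : ℕ} {p : L2 N × L2 N} (hp : p ∈ testGraph N) :
    ∃ a b, IsTest a ∧ IsTest b ∧ p.1 = testVec a + Complex.I • testVec b ∧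
      p.2 = testVec (laplacian a) + Complex.I • testVec (laplacian b) := by
  have h0 : IsTest (fun _ : Config N => (0 : ℝ)) := ⟨contDiff_const, HasCompactSupport.zero⟩
  have hL : laplacian (fun _ : Config N => (0 : ℝ)) = fun _ => 0 := by
    simpa using laplacian_add_mul h0 h0 0 0
  have hz : testVec (fun _ : Config N => (0 : ℝ)) = 0 := by
    simpa using testVec_add_mul h0 h0 0 0
  refine Submodule.span_induction ?_ ?_ ?_ ?_ hp
  · rintro _ ⟨φ, hφ, rfl⟩
    exact ⟨φ, fun _ => 0, hφ, h0, by simp [hz], by simp [hL, hz]⟩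
  · exact ⟨fun _ => 0, fun _ => 0, h0, h0, by simp [hz], by simp [hL, hz]⟩
  · rintro p q - - ⟨a, b, ha, hb, h1, h2⟩ ⟨a', b', ha', hb', h1', h2'⟩
    refine ⟨fun x => 1 * a x + 1 * a' x, fun x => 1 * b x + 1 * b' x,
      (ha.const_mul 1).add (ha'.const_mul 1), (hb.const_mul 1).add (hb'.const_mul 1), ?_, ?_⟩
    · rw [testVec_add_mul ha ha', testVec_add_mul hb hb', Prod.fst_add, h1, h1']
      simp only [Complex.ofReal_one]
      module
    · rw [laplacian_add_mul ha ha', laplacian_add_mul hb hb',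
        testVec_add_mul ha.laplacian ha'.laplacian, testVec_add_mul hb.laplacian hb'.laplacian,
        Prod.snd_add, h2, h2']
      simp only [Complex.ofReal_one]
      module
  · rintro z p - ⟨a, b, ha, hb, h1, h2⟩
    refine ⟨fun x => z.re * a x + (-z.im) * b x, fun x => z.re * b x + z.im * a x,
      (ha.const_mul _).add (hb.const_mul _), (hb.const_mul _).add (ha.const_mul _), ?_, ?_⟩
    · rw [testVec_add_mul ha hb, testVec_add_mul hb ha, Prod.smul_fst, h1]
      conv_lhs => rw [← Complex.re_add_im z]
      push_cast
      match_scalars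
      · ring
      · linear_combination (z.im : ℂ) * Complex.I_sq
    · rw [laplacian_add_mul ha hb, laplacian_add_mul hb ha,
        testVec_add_mul ha.laplacian hb.laplacian, testVec_add_mul hb.laplacian ha.laplacian,
        Prod.smul_snd, h2]
      conv_lhs => rw [← Complex.re_add_im z]
      push_cast
      match_scalars
      · ring
      · linear_combination (z.im : ℂ) * Complex.I_sq

/-- `⟨a + i b, c + i d⟩` has real part `⟨a, c⟩ + ⟨b, d⟩` for real functions. -/
lemma re_inner_testVec_complex {N : ℕ} {a b c d : Config N → ℝ} (ha : IsTest a) (hb : IsTest b)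
    (hc : IsTest c) (hd : IsTest d) :
    (inner ℂ (testVec a + Complex.I • testVec b) (testVec c + Complex.I • testVec d)).re =
      (∫ x, a x * c x) + ∫ x, b x * d x := by
  simp only [inner_add_left, inner_add_right, inner_smul_left, inner_smul_right,
    inner_testVec_testVec ha hc, inner_testVec_testVec ha hd, inner_testVec_testVec hb hc,
    inner_testVec_testVec hb hd]
  simp

lemma integral_mul_laplacian_self {N : ℕ} {φ : Config N → ℝ} (hφ : IsTest φ) :
    ∫ x, φ x * laplacian φ x = -∑ i, ∑ k, ∫ x, dirDeriv (unitVec i k) φ x ^ 2 := by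
  rw [integral_mul_laplacian hφ hφ]
  simp_rw [sq]

lemma testGraph_re_inner_nonpos {N : ℕ} {p : L2 N × L2 N} (hp : p ∈ testGraph N) :
    (inner ℂ p.1 p.2).re ≤ 0 := by
  obtain ⟨a, b, ha, hb, h1, h2⟩ := mem_testGraph hp
  rw [h1, h2, re_inner_testVec_complex ha hb ha.laplacian hb.laplacian,
    integral_mul_laplacian_self ha, integral_mul_laplacian_self hb]
  have key : ∀ φ : Config N → ℝ, 0 ≤ ∑ i, ∑ k, ∫ x, dirDeriv (unitVec i k) φ x ^ 2 := fun φ =>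
    Finset.sum_nonneg fun i _ => Finset.sum_nonneg fun k _ => integral_nonneg fun x => sq_nonneg _
  linarith [key a, key b]

lemma closure_testGraph_re_inner_nonpos {N : ℕ} {p : L2 N × L2 N}
    (hp : p ∈ (testGraph N).topologicalClosure) : (inner ℂ p.1 p.2).re ≤ 0 := by
  have hcl : IsClosed {p : L2 N × L2 N | (inner ℂ p.1 p.2).re ≤ 0} :=
    isClosed_le (Complex.continuous_re.comp (by fun_prop)) continuous_const
  exact closure_minimal (fun q hq => testGraph_re_inner_nonpos hq) hcl hp

lemma norm_resolvent_le {N : ℕ} {p : L2 N × L2 N} {c : ℝ} (hc : 0 < c)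
    (hp : (inner ℂ p.1 p.2).re ≤ 0) :
    c * ‖p.1‖ ≤ ‖(c : ℂ) • p.1 - p.2‖ ∧ ‖p.2‖ ≤ ‖(c : ℂ) • p.1 - p.2‖ := by
  have h : ‖(c : ℂ) • p.1 - p.2‖ ^ 2 =
      (c * ‖p.1‖) ^ 2 - 2 * (c * (inner ℂ p.1 p.2).re) + ‖p.2‖ ^ 2 := by
    rw [@norm_sub_sq ℂ, norm_smul, inner_smul_left]
    simp only [Complex.conj_ofReal, RCLike.re_eq_complex_re, Complex.re_ofReal_mul,
      Complex.norm_real, Real.norm_eq_abs, mul_pow, sq_abs]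
  have h1 : c * (inner ℂ p.1 p.2).re ≤ 0 := mul_nonpos_of_nonneg_of_nonpos hc.le hp
  constructor
  · refine (pow_le_pow_iff_left₀ (by positivity) (norm_nonneg _) two_ne_zero).1 ?_
    have := sq_nonneg (‖p.2‖)
    linarith
  · refine (pow_le_pow_iff_left₀ (norm_nonneg _) (norm_nonneg _) two_ne_zero).1 ?_
    have := sq_nonneg (c * ‖p.1‖)
    linarith

/-- For `c > 0`, the map `ψ ↦ cψ - Δψ` on the closure of the test functions is onto: its range is
closed, since it is bounded below, and dense, by uniqueness. -/
lemma exists_mem_closure_testGraph {N : ℕ} {c : ℝ} (hc : 0 < c) (f : L2 N) :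
    ∃ p ∈ (testGraph N).topologicalClosure, (c : ℂ) • p.1 - p.2 = f := by
  let K := (testGraph N).topologicalClosure
  have hKc : IsClosed (K : Set (L2 N × L2 N)) := (testGraph N).isClosed_topologicalClosure
  have : CompleteSpace K := hKc.completeSpace_coe
  let T : (L2 N × L2 N) →L[ℂ] L2 N :=
    (c : ℂ) • ContinuousLinearMap.fst ℂ (L2 N) (L2 N) - ContinuousLinearMap.snd ℂ (L2 N) (L2 N)
  let TK : K →L[ℂ] L2 N := T ∘L K.subtypeL
  have hlow : ∀ p : K, min c 1 * ‖p‖ ≤ ‖TK p‖ := by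
    intro p
    have h := norm_resolvent_le hc (closure_testGraph_re_inner_nonpos p.2)
    have h1 : TK p = (c : ℂ) • (p : L2 N × L2 N).1 - (p : L2 N × L2 N).2 := rfl
    rw [← h1] at h
    obtain ⟨h2, h3⟩ := h
    have h4 : ‖p‖ = max ‖(p : L2 N × L2 N).1‖ ‖(p : L2 N × L2 N).2‖ := rfl
    rw [h4, mul_max_of_nonneg _ _ (by positivity)]
    refine max_le ?_ ?_
    · exact le_trans (mul_le_mul_of_nonneg_right (min_le_left _ _) (norm_nonneg _)) h2
    · exact le_trans (mul_le_mul_of_nonneg_right (min_le_right _ _) (norm_nonneg _)) (by simpa)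
  have hanti : AntilipschitzWith (Real.toNNReal (min c 1)⁻¹) TK := by
    refine TK.antilipschitz_of_bound fun p => ?_
    have hm : 0 < min c 1 := lt_min hc one_pos
    rw [Real.coe_toNNReal _ (inv_nonneg.2 hm.le), ← div_eq_inv_mul, le_div_iff₀ hm, mul_comm]
    exact hlow p
  have hclosed : IsClosed (Set.range TK) := hanti.isClosed_range TK.uniformContinuous
  let Rg : Submodule ℂ (L2 N) := LinearMap.range (TK : K →ₗ[ℂ] L2 N)
  have hRg : IsClosed (Rg : Set (L2 N)) := by
    rw [show (Rg : Set (L2 N)) = Set.range TK from LinearMap.coe_range _]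
    exact hclosed
  have : CompleteSpace Rg := hRg.completeSpace_coe
  have htop : Rg = ⊤ := by
    rw [← Submodule.orthogonal_eq_bot_iff, Submodule.eq_bot_iff]
    intro w hw
    refine eq_zero_of_inner_laplacian hc fun φ hφ => ?_
    have hmem : (testVec φ, testVec (laplacian φ)) ∈ K :=
      (testGraph N).le_topologicalClosure (Submodule.subset_span ⟨φ, hφ, rfl⟩)
    have := (Submodule.mem_orthogonal _ _).1 hw (TK ⟨_, hmem⟩) ⟨⟨_, hmem⟩, rfl⟩
    change inner ℂ ((c : ℂ) • testVec φ - testVec (laplacian φ)) w = 0 at this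
    rw [inner_sub_left, inner_smul_left, Complex.conj_ofReal] at this
    exact (sub_eq_zero.1 this).symm
  have hf : f ∈ Rg := htop ▸ Submodule.mem_top
  obtain ⟨p, hp⟩ := hf
  exact ⟨p, p.2, hp⟩

/-- The test functions are a core of the Laplacian on `L²`. -/
lemma mem_closure_testGraph {N : ℕ} {p : L2 N × L2 N} (hp : p ∈ laplaceGraph N) :
    p ∈ (testGraph N).topologicalClosure := by
  obtain ⟨q, hq, he⟩ := exists_mem_closure_testGraph (c := 1) one_pos (((1 : ℝ) : ℂ) • p.1 - p.2)
  have hqΓ : q ∈ laplaceGraph N :=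
    (testGraph N).topologicalClosure_minimal testGraph_le (isClosed_laplaceGraph N) hq
  have hd := isWeakLaplacian_iff.1 (mem_laplaceGraph.1 ((laplaceGraph N).sub_mem hp hqΓ))
  simp only [Complex.ofReal_one, one_smul] at he
  have he' : (p - q).2 = (p - q).1 := by
    rw [Prod.fst_sub, Prod.snd_sub, ← sub_eq_zero, ← sub_eq_zero.2 he]
    abel
  rw [he'] at hd
  have h1 : (p - q).1 = 0 := eq_zero_of_inner_laplacian (c := 1) one_pos fun φ hφ => by
    rw [hd φ hφ, Complex.ofReal_one, one_mul]
  have : p - q = 0 := Prod.ext h1 (he'.trans h1)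
  rwa [sub_eq_zero.1 this]

lemma laplaceGraph_re_inner_nonpos {N : ℕ} {p : L2 N × L2 N} (hp : p ∈ laplaceGraph N) :
    (inner ℂ p.1 p.2).re ≤ 0 :=
  closure_testGraph_re_inner_nonpos (mem_closure_testGraph hp)

/-- The Laplacian is symmetric on its maximal domain. -/
lemma laplaceGraph_symmetric {N : ℕ} {p q : L2 N × L2 N} (hp : p ∈ laplaceGraph N)
    (hq : q ∈ laplaceGraph N) : inner ℂ p.2 q.1 = inner ℂ p.1 q.2 := by
  have hcl : IsClosed {p : L2 N × L2 N | inner ℂ p.2 q.1 = inner ℂ p.1 q.2} :=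
    isClosed_eq (by fun_prop) (by fun_prop)
  refine closure_minimal (fun r hr => ?_) hcl (mem_closure_testGraph hp)
  obtain ⟨a, b, ha, hb, h1, h2⟩ := mem_testGraph hr
  have hq' := isWeakLaplacian_iff.1 (mem_laplaceGraph.1 hq)
  simp only [Set.mem_ofPred_eq]
  rw [h1, h2, inner_add_left, inner_add_left, inner_smul_left, inner_smul_left, hq' a ha, hq' b hb]

lemma exists_freeResolvent (N : ℕ) {c : ℝ} (hc : 0 < c) : ∃ R : L2 N →L[ℂ] L2 N,
    ∀ f, IsWeakLaplacian (R f) ((c : ℂ) • R f - f) := by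
  choose p hp he using fun f : L2 N => exists_mem_closure_testGraph hc f
  have hpΓ : ∀ f, p f ∈ laplaceGraph N := fun f =>
    (testGraph N).topologicalClosure_minimal testGraph_le (isClosed_laplaceGraph N) (hp f)
  -- Linearity of the solution operator follows from uniqueness of the solution.
  have huniq : ∀ q ∈ laplaceGraph N, (c : ℂ) • q.1 - q.2 = 0 → q.1 = 0 := by
    intro q hq h0
    refine eq_zero_of_inner_laplacian hc fun φ hφ => ?_
    rw [isWeakLaplacian_iff.1 (mem_laplaceGraph.1 hq) φ hφ, ← sub_eq_zero.1 h0, inner_smul_right]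
  let Rl : L2 N →ₗ[ℂ] L2 N :=
    { toFun := fun f => (p f).1
      map_add' := fun f g => by
        have := huniq (p (f + g) - (p f + p g))
          ((laplaceGraph N).sub_mem (hpΓ _) ((laplaceGraph N).add_mem (hpΓ _) (hpΓ _))) (by
            have h3 : (c : ℂ) • (p (f + g)).1 - (p (f + g)).2 -
                (((c : ℂ) • (p f).1 - (p f).2) + ((c : ℂ) • (p g).1 - (p g).2)) = 0 := by
              rw [he, he, he, sub_self]
            rw [← h3]
            simp only [Prod.fst_sub, Prod.snd_sub, Prod.fst_add, Prod.snd_add]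
            module)
        exact sub_eq_zero.1 this
      map_smul' := fun z f => by
        have := huniq (p (z • f) - z • p f)
          ((laplaceGraph N).sub_mem (hpΓ _) ((laplaceGraph N).smul_mem z (hpΓ _))) (by
            have h3 : (c : ℂ) • (p (z • f)).1 - (p (z • f)).2 - z • ((c : ℂ) • (p f).1 - (p f).2)
                = 0 := by rw [he, he, sub_self]
            rw [← h3]
            simp only [Prod.fst_sub, Prod.snd_sub, Prod.smul_fst, Prod.smul_snd]
            module)
        exact sub_eq_zero.1 this }
  have hbound : ∀ f, ‖Rl f‖ ≤ c⁻¹ * ‖f‖ := by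
    intro f
    have h := norm_resolvent_le hc (laplaceGraph_re_inner_nonpos (hpΓ f))
    rw [he f] at h
    rw [← div_eq_inv_mul, le_div_iff₀ hc, mul_comm]
    exact h.1
  refine ⟨Rl.mkContinuous c⁻¹ hbound, fun f => ?_⟩
  have h1 : (c : ℂ) • (p f).1 - f = (p f).2 := by
    nth_rewrite 2 [← he f]
    abel
  change IsWeakLaplacian (p f).1 ((c : ℂ) • (p f).1 - f)
  rw [h1]
  exact hpΓ f

open Classical in
/-- The resolvent `(-Δ + c)⁻¹` of the free Laplacian, for `c > 0`. -/
def freeResolvent (N : ℕ) (c : ℝ) : L2 N →L[ℂ] L2 N :=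
  if hc : 0 < c then (exists_freeResolvent N hc).choose else 0

section FreeResolvent

variable {N : ℕ} {c : ℝ}

lemma freeResolvent_spec (hc : 0 < c) (f : L2 N) :
    IsWeakLaplacian (freeResolvent N c f) ((c : ℂ) • freeResolvent N c f - f) := by
  rw [freeResolvent, dif_pos hc]
  exact (exists_freeResolvent N hc).choose_spec f

lemma eq_freeResolvent (hc : 0 < c) {ψ l f : L2 N} (h : IsWeakLaplacian ψ l)
    (hf : (c : ℂ) • ψ - l = f) : ψ = freeResolvent N c f := by
  have hd := (laplaceGraph N).sub_mem (x := (ψ, l)) h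
    (y := (freeResolvent N c f, (c : ℂ) • freeResolvent N c f - f)) (freeResolvent_spec hc f)
  have hd' := isWeakLaplacian_iff.1 (mem_laplaceGraph.1 hd)
  refine sub_eq_zero.1 (eq_zero_of_inner_laplacian hc fun φ hφ => ?_)
  rw [← inner_smul_right]
  refine (hd' φ hφ).trans ?_
  congr 1
  change l - ((c : ℂ) • freeResolvent N c f - f) = _
  rw [← hf]
  module

lemma norm_freeResolvent_apply_le (hc : 0 < c) (f : L2 N) :
    ‖freeResolvent N c f‖ ≤ c⁻¹ * ‖f‖ := by
  have h := norm_resolvent_le hc (laplaceGraph_re_inner_nonpos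
    (p := (_, _)) (freeResolvent_spec hc f))
  simp only [sub_sub_cancel] at h
  rw [← div_eq_inv_mul, le_div_iff₀ hc, mul_comm]
  exact h.1

lemma norm_laplacian_freeResolvent_le (hc : 0 < c) (f : L2 N) :
    ‖(c : ℂ) • freeResolvent N c f - f‖ ≤ ‖f‖ := by
  have h := norm_resolvent_le hc (laplaceGraph_re_inner_nonpos
    (p := (_, _)) (freeResolvent_spec hc f))
  simp only [sub_sub_cancel] at h
  exact h.2

end FreeResolvent


/-! ### Multiplication operators -/

/-- `W` is a bounded measurable function. -/
structure IsBddMul {N : ℕ} (W : Config N → ℝ) : Prop where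
  meas : Measurable W
  bdd : ∃ C, ∀ x, |W x| ≤ C

lemma memLp_mul_of_bdd {N : ℕ} {W : Config N → ℝ} (h : IsBddMul W) (ψ : L2 N) :
    MemLp (fun x => (W x : ℂ) * ψ x) 2 volume := by
  obtain ⟨C, hC⟩ := h.bdd
  refine (Lp.memLp ψ).of_le_mul (c := C) ?_ (Eventually.of_forall fun x => ?_)
  · exact (Complex.measurable_ofReal.comp h.meas).aestronglyMeasurable.mul
      (Lp.memLp ψ).aestronglyMeasurable
  · rw [norm_mul, Complex.norm_real]
    exact mul_le_mul_of_nonneg_right (hC x) (norm_nonneg _)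

lemma exists_mulOp {N : ℕ} {W : Config N → ℝ} (h : IsBddMul W) :
    ∃ T : L2 N →L[ℂ] L2 N, ∀ ψ, ∀ᵐ x, (T ψ x : ℂ) = W x * ψ x := by
  obtain ⟨C, hC⟩ := h.bdd
  let Tl : L2 N →ₗ[ℂ] L2 N :=
    { toFun := fun ψ => (memLp_mul_of_bdd h ψ).toLp
      map_add' := fun ψ χ => by
        refine Lp.ext ?_
        filter_upwards [(memLp_mul_of_bdd h (ψ + χ)).coeFn_toLp, Lp.coeFn_add ψ χ,
          Lp.coeFn_add ((memLp_mul_of_bdd h ψ).toLp) ((memLp_mul_of_bdd h χ).toLp),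
          (memLp_mul_of_bdd h ψ).coeFn_toLp, (memLp_mul_of_bdd h χ).coeFn_toLp]
          with x h1 h2 h3 h4 h5
        rw [h1, h2, h3, Pi.add_apply, Pi.add_apply, h4, h5]
        ring
      map_smul' := fun z ψ => by
        refine Lp.ext ?_
        filter_upwards [(memLp_mul_of_bdd h (z • ψ)).coeFn_toLp, Lp.coeFn_smul z ψ,
          Lp.coeFn_smul z ((memLp_mul_of_bdd h ψ).toLp), (memLp_mul_of_bdd h ψ).coeFn_toLp]
          with x h1 h2 h3 h4
        simp only [RingHom.id_apply]
        rw [h1, h2, h3, Pi.smul_apply, Pi.smul_apply, h4, smul_eq_mul, smul_eq_mul]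
        ring }
  refine ⟨Tl.mkContinuous C fun ψ => ?_, fun ψ => (memLp_mul_of_bdd h ψ).coeFn_toLp⟩
  refine Lp.norm_le_mul_norm_of_ae_le_mul ?_
  filter_upwards [(memLp_mul_of_bdd h ψ).coeFn_toLp] with x hx
  change ‖((memLp_mul_of_bdd h ψ).toLp : Config N → ℂ) x‖ ≤ _
  rw [hx, norm_mul, Complex.norm_real]
  exact mul_le_mul_of_nonneg_right (hC x) (norm_nonneg _)

open Classical in
/-- The operator of multiplication by a bounded measurable function `W`; zero for other `W`. -/
def mulOp {N : ℕ} (W : Config N → ℝ) : L2 N →L[ℂ] L2 N :=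
  if h : IsBddMul W then (exists_mulOp h).choose else 0

lemma mulOp_ae {N : ℕ} {W : Config N → ℝ} (h : IsBddMul W) (ψ : L2 N) :
    ∀ᵐ x, (mulOp W ψ x : ℂ) = W x * ψ x := by
  rw [mulOp, dif_pos h]
  exact (exists_mulOp h).choose_spec ψ

lemma norm_mulOp_apply_le {N : ℕ} {W : Config N → ℝ} (h : IsBddMul W) {C : ℝ}
    (hC : ∀ x, |W x| ≤ C) (ψ : L2 N) : ‖mulOp W ψ‖ ≤ C * ‖ψ‖ := by
  refine Lp.norm_le_mul_norm_of_ae_le_mul ?_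
  filter_upwards [mulOp_ae h ψ] with x hx
  rw [hx, norm_mul, Complex.norm_real]
  exact mul_le_mul_of_nonneg_right (hC x) (norm_nonneg _)

lemma norm_sq_eq_integral {N : ℕ} (ψ : L2 N) : ‖ψ‖ ^ 2 = ∫ x, ‖ψ x‖ ^ 2 := by
  have h1 : (inner ℂ ψ ψ : ℂ) = ((∫ x, ‖ψ x‖ ^ 2 : ℝ) : ℂ) := by
    rw [L2.inner_def]
    refine Eq.trans (integral_congr_ae (Eventually.of_forall fun x => ?_))
      (integral_ofReal (𝕜 := ℂ))
    change inner ℂ (ψ x) (ψ x) = _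
    rw [inner_self_eq_norm_sq_to_K]
    simp
  rw [← inner_self_eq_norm_sq (𝕜 := ℂ), h1]
  rfl

/-! ### Hardy's inequality and Coulomb potentials -/

section Hardy

variable {N : ℕ} {i : Fin N} {ℓ : Config N → Space}

/-- `ℓ` is a relative position `xᵢ - a`, where `a` does not depend on `xᵢ`. -/
structure IsRelPos (i : Fin N) (ℓ : Config N → Space) : Prop where
  smooth : ContDiff ℝ ∞ ℓ
  shift : ∀ x k (t : ℝ), ℓ (x + t • unitVec i k) = ℓ x + t • EuclideanSpace.single k 1

/-- The regularization `1 / (|ℓ|² + ε)` of `1 / |ℓ|²`. -/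
def hardyWeight (ℓ : Config N → Space) (ε : ℝ) (x : Config N) : ℝ := 1 / (‖ℓ x‖ ^ 2 + ε)

lemma hardyWeight_contDiff (hℓ : IsRelPos i ℓ) {ε : ℝ} (hε : 0 < ε) :
    ContDiff ℝ ∞ (hardyWeight ℓ ε) :=
  contDiff_const.div ((hℓ.smooth.norm_sq ℝ).add contDiff_const) fun x => by positivity

lemma coord_contDiff (hℓ : IsRelPos i ℓ) (k : Fin 3) : ContDiff ℝ ∞ fun x => ℓ x k :=
  (EuclideanSpace.proj (𝕜 := ℝ) k).contDiff.comp hℓ.smooth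

lemma hardyField_contDiff (hℓ : IsRelPos i ℓ) {ε : ℝ} (hε : 0 < ε) (k : Fin 3) :
    ContDiff ℝ ∞ fun x => ℓ x k * hardyWeight ℓ ε x :=
  (coord_contDiff hℓ k).mul (hardyWeight_contDiff hℓ hε)

lemma dirDeriv_hardyField (hℓ : IsRelPos i ℓ) {ε : ℝ} (hε : 0 < ε) (k : Fin 3) (x : Config N) :
    dirDeriv (unitVec i k) (fun x => ℓ x k * hardyWeight ℓ ε x) x =
      hardyWeight ℓ ε x - 2 * ℓ x k ^ 2 * hardyWeight ℓ ε x ^ 2 := by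
  have hl : HasDerivAt (fun t : ℝ => x + t • unitVec i k) (unitVec i k) 0 := by
    simpa using ((hasDerivAt_id (0 : ℝ)).smul_const (unitVec i k)).const_add x
  have hd : DifferentiableAt ℝ (fun x => ℓ x k * hardyWeight ℓ ε x) (x + (0 : ℝ) • unitVec i k) :=
    ((hardyField_contDiff hℓ hε k).differentiable (by simp)).differentiableAt
  have h1 := hd.hasFDerivAt.comp_hasDerivAt (0 : ℝ) hl
  have hq : ∀ t : ℝ, ‖ℓ x + t • EuclideanSpace.single k (1 : ℝ)‖ ^ 2 =
      ‖ℓ x‖ ^ 2 + 2 * (t * ℓ x k) + t ^ 2 := by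
    intro t
    rw [norm_add_sq_real, inner_smul_right, EuclideanSpace.inner_single_right, norm_smul]
    simp
  have h2 : HasDerivAt (fun t : ℝ => (ℓ x k + t) * (1 / (‖ℓ x‖ ^ 2 + 2 * (t * ℓ x k) + t ^ 2 + ε)))
      (hardyWeight ℓ ε x - 2 * ℓ x k ^ 2 * hardyWeight ℓ ε x ^ 2) 0 := by
    have hden : HasDerivAt (fun t : ℝ => ‖ℓ x‖ ^ 2 + 2 * (t * ℓ x k) + t ^ 2 + ε)
        (2 * ℓ x k) 0 := by
      have a : HasDerivAt (fun t : ℝ => 2 * (t * ℓ x k)) (2 * (1 * ℓ x k)) 0 :=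
        ((hasDerivAt_id' (0 : ℝ)).mul_const _).const_mul 2
      have b : HasDerivAt (fun t : ℝ => t ^ 2) 0 0 := by simpa using hasDerivAt_pow 2 (0 : ℝ)
      have ab : HasDerivAt (fun t : ℝ => ‖ℓ x‖ ^ 2 + 2 * (t * ℓ x k) + t ^ 2 + ε) _ 0 :=
        ((a.const_add _).add b).add_const ε
      exact ab.congr_deriv (by ring)
    have hne : ‖ℓ x‖ ^ 2 + 2 * ((0 : ℝ) * ℓ x k) + (0 : ℝ) ^ 2 + ε ≠ 0 := by
      simp only [zero_mul, mul_zero, add_zero, ne_eq, OfNat.ofNat_ne_zero, not_false_eq_true,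
        zero_pow]
      positivity
    have hnum : HasDerivAt (fun t : ℝ => ℓ x k + t) 1 0 := (hasDerivAt_id (0 : ℝ)).const_add _
    have h4 : HasDerivAt
        (fun t : ℝ => (ℓ x k + t) * (1 / (‖ℓ x‖ ^ 2 + 2 * (t * ℓ x k) + t ^ 2 + ε))) _ 0 :=
      hnum.mul ((hasDerivAt_const (0 : ℝ) (1 : ℝ)).div hden hne)
    refine h4.congr_deriv ?_
    have h5 : ‖ℓ x‖ ^ 2 + ε ≠ 0 := by positivity
    have h6 : ‖ℓ x‖ ^ 2 + 2 * ((0 : ℝ) * ℓ x k) + (0 : ℝ) ^ 2 + ε = ‖ℓ x‖ ^ 2 + ε := by ring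
    rw [h6, hardyWeight]
    field_simp
    ring
  have h3 : (fun x => ℓ x k * hardyWeight ℓ ε x) ∘ (fun t : ℝ => x + t • unitVec i k) =
      fun t : ℝ => (ℓ x k + t) * (1 / (‖ℓ x‖ ^ 2 + 2 * (t * ℓ x k) + t ^ 2 + ε)) := by
    funext t
    simp only [Function.comp, hardyWeight, hℓ.shift, hq]
    simp
  rw [h3] at h1
  have := h1.unique h2
  rw [zero_smul, add_zero] at this
  exact this

lemma dirDeriv_sq {φ : Config N → ℝ} (hφ : IsTest φ) (v x : Config N) :
    dirDeriv v (fun x => φ x * φ x) x = 2 * φ x * dirDeriv v φ x := by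
  have h := (hφ.smooth.differentiable (by simp)).differentiableAt (x := x)
  have h3 : HasFDerivAt (fun x => φ x * φ x) _ x := h.hasFDerivAt.mul h.hasFDerivAt
  rw [dirDeriv, h3.fderiv]
  simp [dirDeriv]
  ring

/-- Hardy's inequality, in regularized form. The divergence of the vector field `ℓ / (|ℓ|² + ε)` is
at least `1 / (|ℓ|² + ε)` in three dimensions; integrate it against `φ²` by parts. -/
lemma hardy_regularized (hℓ : IsRelPos i ℓ) {ε : ℝ} (hε : 0 < ε) {φ : Config N → ℝ}
    (hφ : IsTest φ) :
    ∫ x, φ x ^ 2 * hardyWeight ℓ ε x ≤ 4 * ∑ k, ∫ x, dirDeriv (unitVec i k) φ x ^ 2 := by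
  have hsq : IsTest fun x => φ x * φ x := hφ.smooth_mul hφ.smooth
  set F : Fin 3 → Config N → ℝ := fun k x => ℓ x k * hardyWeight ℓ ε x with hF
  have hFs : ∀ k, ContDiff ℝ ∞ (F k) := hardyField_contDiff hℓ hε
  have hibp : ∀ k, ∫ x, (F k x * dirDeriv (unitVec i k) (fun x => φ x * φ x) x +
      dirDeriv (unitVec i k) (F k) x * (φ x * φ x)) = 0 := by
    intro k
    rw [integral_add ((hsq.dirDeriv _).integrable_mul (hFs k).continuous.locallyIntegrable)
      (hsq.integrable_mul (dirDeriv_contDiff (hFs k) _).continuous.locallyIntegrable),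
      integral_mul_dirDeriv ((hFs k).of_le (by simp)) hsq]
    ring
  have hint : ∀ k, Integrable fun x => F k x * dirDeriv (unitVec i k) (fun x => φ x * φ x) x +
      dirDeriv (unitVec i k) (F k) x * (φ x * φ x) := fun k =>
    ((hsq.dirDeriv _).integrable_mul (hFs k).continuous.locallyIntegrable).add
      (hsq.integrable_mul (dirDeriv_contDiff (hFs k) _).continuous.locallyIntegrable)
  have hw : Integrable fun x => φ x ^ 2 * hardyWeight ℓ ε x := by
    have := hsq.integrable_mul (hardyWeight_contDiff hℓ hε).continuous.locallyIntegrable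
    refine this.congr (Eventually.of_forall fun x => ?_)
    simp only
    ring
  have hd2 : ∀ k, Integrable fun x => dirDeriv (unitVec i k) φ x ^ 2 := fun k =>
    ((hφ.dirDeriv _).memLp 2).integrable_sq
  have hpt : ∀ x, (1 / 2 : ℝ) * (φ x ^ 2 * hardyWeight ℓ ε x) -
      2 * ∑ k, dirDeriv (unitVec i k) φ x ^ 2 ≤
      ∑ k, (F k x * dirDeriv (unitVec i k) (fun x => φ x * φ x) x +
      dirDeriv (unitVec i k) (F k) x * (φ x * φ x)) := by
    intro x
    simp only [hF, dirDeriv_hardyField hℓ hε, dirDeriv_sq hφ]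
    have hq : ‖ℓ x‖ ^ 2 = ∑ k, ℓ x k ^ 2 := by
      rw [EuclideanSpace.norm_sq_eq]
      simp
    set h := hardyWeight ℓ ε x with hh
    have hh0 : 0 < h := by rw [hh, hardyWeight]; positivity
    have hqh : (∑ k, ℓ x k ^ 2) * h ≤ 1 := by
      rw [← hq, hh, hardyWeight, mul_one_div, div_le_one (by positivity)]
      linarith
    rw [Fin.sum_univ_three] at hqh ⊢
    rw [Fin.sum_univ_three]
    set a := ℓ x 0
    set b := ℓ x 1
    set c := ℓ x 2
    set A := dirDeriv (unitVec i 0) φ x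
    set B := dirDeriv (unitVec i 1) φ x
    set C := dirDeriv (unitVec i 2) φ x
    -- Complete the squares in the cross terms `2 φ ℓₖ h ∂ₖφ`.
    have e1 := sq_nonneg (φ x * a * h + 2 * A)
    have e2 := sq_nonneg (φ x * b * h + 2 * B)
    have e3 := sq_nonneg (φ x * c * h + 2 * C)
    have e4 : 0 ≤ φ x ^ 2 * h * (1 - (a ^ 2 + b ^ 2 + c ^ 2) * h) :=
      mul_nonneg (by positivity) (by linarith)
    linarith
  have h2 := integral_mono ((hw.const_mul (1 / 2)).sub
    ((integrable_finsetSum _ fun k _ => hd2 k).const_mul 2))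
    (integrable_finsetSum _ fun k _ => hint k) hpt
  simp only [Pi.sub_apply] at h2
  rw [integral_sub (hw.const_mul (1 / 2)) ((integrable_finsetSum _ fun k _ => hd2 k).const_mul 2),
    integral_const_mul, integral_const_mul, integral_finsetSum _ fun k _ => hd2 k,
    integral_finsetSum _ fun k _ => hint k, Finset.sum_eq_zero fun k _ => hibp k] at h2
  linarith

/-- The regularization `|ℓ| / (|ℓ|² + ε)` of `1 / |ℓ|`. -/
def regInv (ℓ : Config N → Space) (ε : ℝ) (x : Config N) : ℝ := ‖ℓ x‖ * hardyWeight ℓ ε x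

lemma regInv_isBddMul (hℓ : IsRelPos i ℓ) {ε : ℝ} (hε : 0 < ε) : IsBddMul (regInv ℓ ε) := by
  refine ⟨(hℓ.smooth.continuous.norm.mul
    (hardyWeight_contDiff hℓ hε).continuous).measurable, 1 + 1 / ε, fun x => ?_⟩
  have h0 : 0 ≤ regInv ℓ ε x := by rw [regInv, hardyWeight]; positivity
  rw [abs_of_nonneg h0, regInv, hardyWeight, mul_one_div, div_le_iff₀ (by positivity)]
  have : (1 + 1 / ε) * (‖ℓ x‖ ^ 2 + ε) = ‖ℓ x‖ ^ 2 + ε + ‖ℓ x‖ ^ 2 / ε + 1 := by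
    field_simp
    ring
  rw [this]
  have h1 : 0 ≤ ‖ℓ x‖ ^ 2 / ε := by positivity
  nlinarith [sq_nonneg (‖ℓ x‖ - 1 / 2)]

lemma regInv_sq_le {ε : ℝ} (hε : 0 < ε) (x : Config N) : regInv ℓ ε x ^ 2 ≤ hardyWeight ℓ ε x := by
  have hh0 : 0 < hardyWeight ℓ ε x := by rw [hardyWeight]; positivity
  have hqh : ‖ℓ x‖ ^ 2 * hardyWeight ℓ ε x ≤ 1 := by
    rw [hardyWeight, mul_one_div, div_le_one (by positivity)]
    linarith
  rw [regInv, mul_pow, sq (hardyWeight ℓ ε x), ← mul_assoc]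
  exact mul_le_of_le_one_left hh0.le hqh

lemma integral_regInv_le (hℓ : IsRelPos i ℓ) {ε : ℝ} (hε : 0 < ε) {φ : Config N → ℝ}
    (hφ : IsTest φ) :
    ∫ x, φ x ^ 2 * regInv ℓ ε x ^ 2 ≤ -4 * ∫ x, φ x * laplacian φ x := by
  have hsq : IsTest fun x => φ x * φ x := hφ.smooth_mul hφ.smooth
  have hw : Integrable fun x => φ x ^ 2 * hardyWeight ℓ ε x := by
    have := hsq.integrable_mul (hardyWeight_contDiff hℓ hε).continuous.locallyIntegrable
    refine this.congr (Eventually.of_forall fun x => ?_)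
    simp only
    ring
  calc ∫ x, φ x ^ 2 * regInv ℓ ε x ^ 2 ≤ ∫ x, φ x ^ 2 * hardyWeight ℓ ε x :=
        integral_mono_of_nonneg (Eventually.of_forall fun x => by positivity) hw
          (Eventually.of_forall fun x =>
            mul_le_mul_of_nonneg_left (regInv_sq_le hε x) (sq_nonneg _))
    _ ≤ 4 * ∑ k, ∫ x, dirDeriv (unitVec i k) φ x ^ 2 := hardy_regularized hℓ hε hφ
    _ ≤ 4 * ∑ i, ∑ k, ∫ x, dirDeriv (unitVec i k) φ x ^ 2 := by
        gcongr
        exact Finset.single_le_sum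
          (f := fun i => ∑ k, ∫ x, dirDeriv (unitVec i k) φ x ^ 2)
          (fun j _ => Finset.sum_nonneg fun k _ => integral_nonneg fun x => sq_nonneg _)
          (Finset.mem_univ i)
    _ = _ := by
        rw [integral_mul_laplacian_self hφ]
        ring

lemma norm_mulOp_regInv_sq_le (hℓ : IsRelPos i ℓ) {ε : ℝ} (hε : 0 < ε) {p : L2 N × L2 N}
    (hp : p ∈ laplaceGraph N) : ‖mulOp (regInv ℓ ε) p.1‖ ^ 2 ≤ -4 * (inner ℂ p.1 p.2).re := by
  have hcl : IsClosed {p : L2 N × L2 N |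
      ‖mulOp (regInv ℓ ε) p.1‖ ^ 2 ≤ -4 * (inner ℂ p.1 p.2).re} :=
    isClosed_le (by fun_prop) (continuous_const.mul (Complex.continuous_re.comp (by fun_prop)))
  refine closure_minimal (fun q hq => ?_) hcl (mem_closure_testGraph hp)
  obtain ⟨a, b, ha, hb, h1, h2⟩ := mem_testGraph hq
  have hB := regInv_isBddMul hℓ hε
  have hi : ∀ {φ : Config N → ℝ}, IsTest φ →
      Integrable fun x => φ x ^ 2 * regInv ℓ ε x ^ 2 := by
    intro φ hφ
    have hsq : IsTest fun x => φ x * φ x := hφ.smooth_mul hφ.smooth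
    have hcont : Continuous fun x => regInv ℓ ε x ^ 2 :=
      (hℓ.smooth.continuous.norm.mul (hardyWeight_contDiff hℓ hε).continuous).pow 2
    refine (hsq.integrable_mul hcont.locallyIntegrable).congr (Eventually.of_forall fun x => ?_)
    simp only
    ring
  have hn : ‖mulOp (regInv ℓ ε) q.1‖ ^ 2 =
      (∫ x, a x ^ 2 * regInv ℓ ε x ^ 2) + ∫ x, b x ^ 2 * regInv ℓ ε x ^ 2 := by
    rw [norm_sq_eq_integral, ← integral_add (hi ha) (hi hb)]
    refine integral_congr_ae ?_
    filter_upwards [mulOp_ae hB q.1, testVec_ae ha, testVec_ae hb,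
      Lp.coeFn_add (testVec a) (Complex.I • testVec b), Lp.coeFn_smul Complex.I (testVec b)]
      with x e1 e2 e3 e4 e5
    rw [e1, h1, e4, Pi.add_apply, e5, Pi.smul_apply, e2, e3, norm_mul, mul_pow,
      ← Complex.normSq_eq_norm_sq, ← Complex.normSq_eq_norm_sq, smul_eq_mul, mul_comm Complex.I,
      Complex.normSq_add_mul_I, Complex.normSq_ofReal]
    ring
  rw [Set.mem_ofPred_eq, hn, h1, h2, re_inner_testVec_complex ha hb ha.laplacian hb.laplacian]
  linarith [integral_regInv_le hℓ hε ha, integral_regInv_le hℓ hε hb]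

/-- A potential that is infinitesimally bounded relative to the Laplacian. -/
def IsKato {N : ℕ} (W : Config N → ℝ) : Prop :=
  Measurable W ∧ ∀ δ : ℝ, 0 < δ → ∃ C : ℝ, 0 ≤ C ∧ ∀ ψ l : L2 N, IsWeakLaplacian ψ l →
    eLpNorm (fun x => (W x : ℂ) * ψ x) 2 volume ≤ ENNReal.ofReal (δ * ‖l‖ + C * ‖ψ‖)

lemma eLpNorm_mul_eq {W : Config N → ℝ} (hW : IsBddMul W) (ψ : L2 N) :
    eLpNorm (fun x => (W x : ℂ) * ψ x) 2 volume = ENNReal.ofReal ‖mulOp W ψ‖ := by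
  rw [Lp.norm_def, ENNReal.ofReal_toReal (Lp.eLpNorm_ne_top _)]
  exact eLpNorm_congr_ae ((mulOp_ae hW ψ).mono fun x hx => hx.symm)

/-- A Coulomb potential is infinitesimally bounded relative to the Laplacian, by Hardy's inequality
`‖ψ / |ℓ|‖² ≤ 4 ‖ψ‖ ‖Δψ‖`. -/
lemma isKato_inv_norm (hℓ : IsRelPos i ℓ) : IsKato fun x => ‖ℓ x‖⁻¹ := by
  refine ⟨hℓ.smooth.continuous.measurable.norm.inv, fun δ hδ => ⟨1 / δ, by positivity, ?_⟩⟩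
  intro ψ l h
  have hlim : ∀ x, Tendsto (fun n : ℕ => regInv ℓ (1 / ((n : ℝ) + 1)) x) atTop (𝓝 ‖ℓ x‖⁻¹) := by
    intro x
    rcases eq_or_ne (ℓ x) 0 with h0 | h0
    · simp [regInv, h0]
    · have hn : ‖ℓ x‖ ≠ 0 := norm_ne_zero_iff.2 h0
      have h2 : Tendsto (fun n : ℕ => ‖ℓ x‖ * (1 / (‖ℓ x‖ ^ 2 + 1 / ((n : ℝ) + 1)))) atTop
          (𝓝 (‖ℓ x‖ * (1 / (‖ℓ x‖ ^ 2 + 0)))) :=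
        (Tendsto.div tendsto_const_nhds
          ((tendsto_one_div_add_atTop_nhds_zero_nat (𝕜 := ℝ)).const_add _)
          (by simpa using hn)).const_mul _
      have h3 : ‖ℓ x‖ * (1 / (‖ℓ x‖ ^ 2 + 0)) = ‖ℓ x‖⁻¹ := by
        field_simp
        ring
      rw [h3] at h2
      exact h2
  refine (Lp.eLpNorm_lim_le_liminf_eLpNorm
    (f := fun (n : ℕ) x => (regInv ℓ (1 / ((n : ℝ) + 1)) x : ℂ) * ψ x)
    (fun n => (memLp_mul_of_bdd (regInv_isBddMul hℓ (by positivity)) ψ).aestronglyMeasurable) _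
    (Eventually.of_forall fun x => ?_)).trans ?_
  · exact ((Complex.continuous_ofReal.tendsto _).comp (hlim x)).mul_const _
  · refine liminf_le_of_le (by isBoundedDefault) fun b hb => ?_
    obtain ⟨n, hn⟩ := hb.exists
    refine hn.trans ?_
    have hε : (0 : ℝ) < 1 / ((n : ℝ) + 1) := by positivity
    rw [eLpNorm_mul_eq (regInv_isBddMul hℓ hε)]
    refine ENNReal.ofReal_le_ofReal ?_
    have h1 := norm_mulOp_regInv_sq_le hℓ hε (p := (ψ, l)) h
    have h2 : -(inner ℂ ψ l).re ≤ ‖ψ‖ * ‖l‖ :=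
      (neg_le_abs _).trans ((Complex.abs_re_le_norm _).trans (norm_inner_le_norm ψ l))
    refine (pow_le_pow_iff_left₀ (norm_nonneg _) (by positivity) two_ne_zero).1 ?_
    have h3 : (δ * ‖l‖ + 1 / δ * ‖ψ‖) ^ 2 =
        (δ * ‖l‖ - 1 / δ * ‖ψ‖) ^ 2 + 4 * (‖ψ‖ * ‖l‖) := by
      field_simp
      ring
    rw [h3]
    have h4 := sq_nonneg (δ * ‖l‖ - 1 / δ * ‖ψ‖)
    simp only at h1
    linarith

end Hardy

lemma IsKato.add {N : ℕ} {W W' : Config N → ℝ} (h : IsKato W) (h' : IsKato W') :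
    IsKato fun x => W x + W' x := by
  refine ⟨h.1.add h'.1, fun δ hδ => ?_⟩
  obtain ⟨C, hC, hW⟩ := h.2 (δ / 2) (by positivity)
  obtain ⟨C', hC', hW'⟩ := h'.2 (δ / 2) (by positivity)
  refine ⟨C + C', by positivity, fun ψ l hl => ?_⟩
  have e : (fun x => ((W x + W' x : ℝ) : ℂ) * ψ x) =
      (fun x => (W x : ℂ) * ψ x) + fun x => (W' x : ℂ) * ψ x := by
    funext x
    simp [add_mul]
  have m : ∀ {V : Config N → ℝ}, Measurable V →
      AEStronglyMeasurable (fun x => (V x : ℂ) * ψ x) volume := fun hV =>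
    (Complex.measurable_ofReal.comp hV).aestronglyMeasurable.mul (Lp.memLp ψ).aestronglyMeasurable
  rw [e]
  refine (eLpNorm_add_le (m h.1) (m h'.1) (by norm_num)).trans ?_
  refine (add_le_add (hW ψ l hl) (hW' ψ l hl)).trans ?_
  rw [← ENNReal.ofReal_add (by positivity) (by positivity)]
  refine ENNReal.ofReal_le_ofReal (le_of_eq ?_)
  ring

lemma IsKato.mono {N : ℕ} {W W' : Config N → ℝ} (h : IsKato W) (hm : Measurable W')
    (hle : ∀ x, |W' x| ≤ |W x|) : IsKato W' := by
  refine ⟨hm, fun δ hδ => ?_⟩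
  obtain ⟨C, hC, hW⟩ := h.2 δ hδ
  refine ⟨C, hC, fun ψ l hl => (eLpNorm_mono_ae (Eventually.of_forall fun x => ?_)).trans
    (hW ψ l hl)⟩
  rw [norm_mul, norm_mul, Complex.norm_real, Complex.norm_real]
  exact mul_le_mul_of_nonneg_right (hle x) (norm_nonneg _)

lemma isKato_zero {N : ℕ} : IsKato fun _ : Config N => 0 :=
  ⟨measurable_const, fun δ hδ => ⟨0, le_rfl, fun ψ l _ => by simp⟩⟩

lemma IsKato.const_mul {N : ℕ} {W : Config N → ℝ} (h : IsKato W) (c : ℝ) :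
    IsKato fun x => c * W x := by
  refine ⟨h.1.const_mul c, fun δ hδ => ?_⟩
  obtain ⟨C, hC, hW⟩ := h.2 (δ / (|c| + 1)) (by positivity)
  refine ⟨|c| * C, by positivity, fun ψ l hl => ?_⟩
  have h1 : eLpNorm (fun x => ((c * W x : ℝ) : ℂ) * ψ x) 2 volume ≤
      ENNReal.ofReal |c| * eLpNorm (fun x => (W x : ℂ) * ψ x) 2 volume := by
    refine eLpNorm_le_mul_eLpNorm_of_ae_le_mul (Eventually.of_forall fun x => ?_) 2
    rw [Complex.ofReal_mul, mul_assoc, norm_mul, Complex.norm_real, Real.norm_eq_abs]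
  refine h1.trans ((mul_le_mul_right (hW ψ l hl) _).trans ?_)
  rw [← ENNReal.ofReal_mul (abs_nonneg c)]
  refine ENNReal.ofReal_le_ofReal ?_
  have h2 : |c| * (δ / (|c| + 1)) ≤ δ := by
    rw [mul_div_assoc', div_le_iff₀ (by positivity)]
    nlinarith [abs_nonneg c]
  calc |c| * (δ / (|c| + 1) * ‖l‖ + C * ‖ψ‖)
      = (|c| * (δ / (|c| + 1))) * ‖l‖ + |c| * C * ‖ψ‖ := by ring
    _ ≤ δ * ‖l‖ + |c| * C * ‖ψ‖ := by gcongr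

lemma IsKato.sum {N : ℕ} {ι : Type*} (s : Finset ι) {W : ι → Config N → ℝ}
    (h : ∀ i ∈ s, IsKato (W i)) : IsKato fun x => ∑ i ∈ s, W i x := by
  classical
  induction s using Finset.induction_on with
  | empty => simpa using isKato_zero
  | insert a s ha ih =>
    simp_rw [Finset.sum_insert ha]
    exact (h a (Finset.mem_insert_self a s)).add
      (ih fun i hi => h i (Finset.mem_insert_of_mem hi))

lemma unitVec_apply {N : ℕ} (i j : Fin N) (k : Fin 3) :
    unitVec i k j = if j = i then EuclideanSpace.single k (1 : ℝ) else 0 := by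
  simp [unitVec, Pi.single_apply]

/-- The attraction of the nucleus, as a nonnegative function. -/
def attraction {N : ℕ} (e Z : ℝ) (y : Space) (x : Config N) : ℝ :=
  ∑ i : Fin N, e ^ 2 * Z * ‖x i - y‖⁻¹

/-- The repulsion between the electrons. -/
def repulsion {N : ℕ} (e : ℝ) (x : Config N) : ℝ :=
  ∑ i : Fin N, ∑ j ∈ Finset.Ioi i, e ^ 2 * ‖x i - x j‖⁻¹

lemma potential_eq {N : ℕ} (e Z : ℝ) (y : Space) (x : Config N) :
    potential e Z y x = repulsion e x - attraction e Z y x := by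
  simp only [potential, repulsion, attraction, div_eq_mul_inv, Finset.sum_neg_distrib]
  ring

lemma attraction_nonneg {N : ℕ} {e Z : ℝ} (hZ : 0 < Z) (y : Space) (x : Config N) :
    0 ≤ attraction e Z y x :=
  Finset.sum_nonneg fun i _ => by positivity

lemma repulsion_nonneg {N : ℕ} (e : ℝ) (x : Config N) : 0 ≤ repulsion e x :=
  Finset.sum_nonneg fun i _ => Finset.sum_nonneg fun j _ => by positivity

lemma isKato_attraction {N : ℕ} (e Z : ℝ) (y : Space) : IsKato (attraction (N := N) e Z y) := by
  refine IsKato.sum _ fun i _ => (isKato_inv_norm (i := i) ⟨?_, ?_⟩).const_mul _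
  · exact (contDiff_apply ℝ Space i).sub contDiff_const
  · intro x k t
    simp only [Pi.add_apply, Pi.smul_apply, unitVec_apply, if_true]
    abel

lemma isKato_repulsion {N : ℕ} (e : ℝ) : IsKato (repulsion (N := N) e) := by
  refine IsKato.sum _ fun i _ => IsKato.sum _ fun j hj =>
    (isKato_inv_norm (i := i) ⟨?_, ?_⟩).const_mul _
  · exact (contDiff_apply ℝ Space i).sub (contDiff_apply ℝ Space j)
  · intro x k t
    have hij : j ≠ i := (Finset.mem_Ioi.1 hj).ne'
    simp only [Pi.add_apply, Pi.smul_apply, unitVec_apply, if_true, if_neg hij, smul_zero, add_zero]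
    abel


/-! ### Positivity -/

section Positivity

variable {N : ℕ}

/-- `f ≥ 0` almost everywhere (in particular `f` is real). -/
def IsNonneg (f : L2 N) : Prop := ∀ᵐ x, 0 ≤ (f x).re ∧ (f x).im = 0

/-- A positivity preserving operator. -/
def PosPres (T : L2 N →L[ℂ] L2 N) : Prop := ∀ f, IsNonneg f → IsNonneg (T f)

lemma isNonneg_iff {f : L2 N} : IsNonneg f ↔ ∀ φ, IsTest φ → (∀ x, 0 ≤ φ x) →
    0 ≤ (inner ℂ (testVec φ) f).re ∧ (inner ℂ (testVec φ) f).im = 0 := by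
  constructor
  · intro h φ hφ h0
    rw [inner_testVec hφ, re_integral_smul hφ, im_integral_smul hφ]
    constructor
    · exact integral_nonneg_of_ae (h.mono fun x hx => mul_nonneg hx.1 (h0 x))
    · exact integral_eq_zero_of_ae (h.mono fun x hx => by simp [hx.2])
  · intro h
    have hre : LocallyIntegrable (fun x => (f x).re) volume :=
      (re_memLp f).locallyIntegrable (by norm_num)
    have him : LocallyIntegrable (fun x => (f x).im) volume :=
      (im_memLp f).locallyIntegrable (by norm_num)
    have h1 := ae_nonneg_of_forall_test hre fun φ hφ h0 => by
      have := (h φ hφ h0).1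
      rwa [inner_testVec hφ, re_integral_smul hφ] at this
    have him0 : ∀ φ, IsTest φ → (∀ x, 0 ≤ φ x) → ∫ x, (f x).im * φ x = 0 := fun φ hφ h0 => by
      have := (h φ hφ h0).2
      rwa [inner_testVec hφ, im_integral_smul hφ] at this
    have h2 := ae_nonneg_of_forall_test him fun φ hφ h0 => (him0 φ hφ h0).ge
    have h3 := ae_nonneg_of_forall_test him.neg fun φ hφ h0 => by
      simp [integral_neg, him0 φ hφ h0]
    filter_upwards [h1, h2, h3] with x h1 h2 h3
    refine ⟨h1, le_antisymm ?_ h2⟩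
    simpa using h3

lemma isClosed_isNonneg : IsClosed {f : L2 N | IsNonneg f} := by
  have : {f : L2 N | IsNonneg f} = ⋂ φ : {φ : Config N → ℝ // IsTest φ ∧ ∀ x, 0 ≤ φ x},
      {f | 0 ≤ (inner ℂ (testVec φ.1) f).re ∧ (inner ℂ (testVec φ.1) f).im = 0} := by
    ext f
    simp only [Set.mem_ofPred_eq, isNonneg_iff, Set.mem_iInter, Subtype.forall, and_imp]
  rw [this]
  refine isClosed_iInter fun φ => IsClosed.and ?_ ?_
  · exact isClosed_le continuous_const (Complex.continuous_re.comp (by fun_prop))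
  · exact isClosed_eq (Complex.continuous_im.comp (by fun_prop)) continuous_const

lemma IsNonneg.add {f g : L2 N} (hf : IsNonneg f) (hg : IsNonneg g) : IsNonneg (f + g) := by
  filter_upwards [hf, hg, Lp.coeFn_add f g] with x h1 h2 h3
  rw [h3, Pi.add_apply, Complex.add_re, Complex.add_im]
  exact ⟨add_nonneg h1.1 h2.1, by rw [h1.2, h2.2, add_zero]⟩

lemma isNonneg_zero : IsNonneg (0 : L2 N) := by
  filter_upwards [Lp.coeFn_zero ℂ 2 (volume : Measure (Config N))] with x h
  rw [h]
  simp

lemma isNonneg_of_mul {f g : L2 N} {W : Config N → ℝ} (hW : ∀ x, 0 ≤ W x) (hf : IsNonneg f)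
    (h : ∀ᵐ x, (g x : ℂ) = W x * f x) : IsNonneg g := by
  filter_upwards [hf, h] with x h1 h2
  rw [h2, Complex.re_ofReal_mul, Complex.im_ofReal_mul, h1.2, mul_zero]
  exact ⟨mul_nonneg (hW x) h1.1, rfl⟩

/-- A fixed point equation `χ = f + T χ` with a positivity preserving contraction `T` has a
nonnegative solution if `f ≥ 0`: it is the limit of the partial sums of the Neumann series. -/
lemma isNonneg_of_fixedPoint {T : L2 N →L[ℂ] L2 N} (hT : PosPres T) {r : ℝ} (hr1 : r < 1)
    (hr : ∀ g, ‖T g‖ ≤ r * ‖g‖) {f χ : L2 N} (hf : IsNonneg f) (h : χ = f + T χ) :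
    IsNonneg χ := by
  let s : ℕ → L2 N := fun n => (fun g => f + T g)^[n] 0
  have hs : ∀ n, s (n + 1) = f + T (s n) := fun n => Function.iterate_succ_apply' _ _ _
  have hpos : ∀ n, IsNonneg (s n) := by
    intro n
    induction n with
    | zero => exact isNonneg_zero
    | succ n ih =>
      rw [hs]
      exact hf.add (hT _ ih)
  rcases lt_or_ge r 0 with hneg | hr0
  · have : ‖χ‖ ≤ 0 := by
      have := (norm_nonneg (T χ)).trans (hr χ)
      nlinarith [norm_nonneg χ]
    rw [norm_le_zero_iff.1 this]
    exact isNonneg_zero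
  have hbound : ∀ n, ‖s n - χ‖ ≤ r ^ n * ‖χ‖ := by
    intro n
    induction n with
    | zero => simp [s]
    | succ n ih =>
      have e : s (n + 1) - χ = T (s n - χ) := by
        rw [hs, map_sub]
        nth_rewrite 1 [h]
        abel
      rw [e, pow_succ', mul_assoc]
      exact (hr _).trans (mul_le_mul_of_nonneg_left ih hr0)
  have hlim : Tendsto s atTop (𝓝 χ) := by
    rw [tendsto_iff_norm_sub_tendsto_zero]
    refine squeeze_zero (fun n => norm_nonneg _) hbound ?_
    simpa using (tendsto_pow_atTop_nhds_zero_of_lt_one hr0 hr1).mul_const ‖χ‖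
  exact isClosed_isNonneg.mem_of_tendsto hlim (Eventually.of_forall hpos)

lemma posPres_freeResolvent {c : ℝ} (hc : 0 < c) : PosPres (freeResolvent N c) := by
  intro f hf
  set ψ := freeResolvent N c f with hψ
  have hw := isWeakLaplacian_iff.1 (freeResolvent_spec hc f)
  rw [← hψ] at hw
  have key : ∀ φ, IsTest φ → (∫ x, (ψ x).re * laplacian φ x =
      c * (∫ x, (ψ x).re * φ x) - ∫ x, (f x).re * φ x) ∧
      (∫ x, (ψ x).im * laplacian φ x =
      c * (∫ x, (ψ x).im * φ x) - ∫ x, (f x).im * φ x) := by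
    intro φ hφ
    have := hw φ hφ
    rw [inner_sub_right, inner_smul_right, inner_testVec hφ, inner_testVec hφ.laplacian,
      inner_testVec hφ] at this
    constructor
    · have := congrArg Complex.re this
      rwa [Complex.sub_re, Complex.re_ofReal_mul, re_integral_smul hφ, re_integral_smul hφ,
        re_integral_smul hφ.laplacian] at this
    · have := congrArg Complex.im this
      rwa [Complex.sub_im, Complex.im_ofReal_mul, im_integral_smul hφ, im_integral_smul hφ,
        im_integral_smul hφ.laplacian] at this
  have h1 := ae_nonneg_of_weak_supersolution (re_memLp ψ) hc fun φ hφ h0 => by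
    rw [(key φ hφ).1]
    have : 0 ≤ ∫ x, (f x).re * φ x :=
      integral_nonneg_of_ae (hf.mono fun x hx => mul_nonneg hx.1 (h0 x))
    linarith
  have h2 := ae_eq_zero_of_weak_solution (im_memLp ψ) hc fun φ hφ => by
    have h0 : ∫ x, (f x).im * φ x = 0 :=
      integral_eq_zero_of_ae (hf.mono fun x hx => by simp [hx.2])
    rw [(key φ hφ).2, h0, sub_zero]
  filter_upwards [h1, h2] with x h1 h2 using ⟨h1, h2⟩

end Positivity

/-! ### The resolvent of a Schrödinger operator -/

section Resolvent

variable {N : ℕ}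

lemma exists_katoOp {W : Config N → ℝ} (hW : IsKato W) {c : ℝ} (hc : 0 < c) :
    ∃ B : L2 N →L[ℂ] L2 N, ∀ f, ∀ᵐ x, (B f x : ℂ) = W x * freeResolvent N c f x := by
  obtain ⟨C, hC, hb⟩ := hW.2 1 one_pos
  have hm : ∀ f, MemLp (fun x => (W x : ℂ) * freeResolvent N c f x) 2 volume := fun f =>
    ⟨(Complex.measurable_ofReal.comp hW.1).aestronglyMeasurable.mul
      (Lp.memLp _).aestronglyMeasurable,
      (hb _ _ (freeResolvent_spec hc f)).trans_lt ENNReal.ofReal_lt_top⟩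
  let Bl : L2 N →ₗ[ℂ] L2 N :=
    { toFun := fun f => (hm f).toLp
      map_add' := fun f g => by
        refine Lp.ext ?_
        filter_upwards [(hm (f + g)).coeFn_toLp, (hm f).coeFn_toLp, (hm g).coeFn_toLp,
          Lp.coeFn_add (hm f).toLp (hm g).toLp,
          Lp.coeFn_add (freeResolvent N c f) (freeResolvent N c g)] with x h1 h2 h3 h4 h5
        rw [h1, h4, Pi.add_apply, h2, h3, map_add, h5, Pi.add_apply]
        ring
      map_smul' := fun z f => by
        refine Lp.ext ?_
        filter_upwards [(hm (z • f)).coeFn_toLp, (hm f).coeFn_toLp,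
          Lp.coeFn_smul z (hm f).toLp, Lp.coeFn_smul z (freeResolvent N c f)] with x h1 h2 h3 h4
        simp only [RingHom.id_apply]
        rw [h1, h3, Pi.smul_apply, h2, map_smul, h4, Pi.smul_apply, smul_eq_mul, smul_eq_mul]
        ring }
  refine ⟨Bl.mkContinuous (1 + C * c⁻¹) fun f => ?_, fun f => (hm f).coeFn_toLp⟩
  have h1 : ‖Bl f‖ ≤ 1 * ‖(c : ℂ) • freeResolvent N c f - f‖ + C * ‖freeResolvent N c f‖ := by
    change ‖(hm f).toLp‖ ≤ _
    rw [Lp.norm_toLp]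
    exact ENNReal.toReal_le_of_le_ofReal (by positivity) (hb _ _ (freeResolvent_spec hc f))
  have h2 := norm_laplacian_freeResolvent_le hc f
  have h3 := mul_le_mul_of_nonneg_left (norm_freeResolvent_apply_le hc f) hC
  linarith

open Classical in
/-- The operator `W (-Δ + c)⁻¹`, for an infinitesimally bounded potential `W` and `c > 0`. -/
def katoOp (W : Config N → ℝ) (c : ℝ) : L2 N →L[ℂ] L2 N :=
  if h : IsKato W ∧ 0 < c then (exists_katoOp h.1 h.2).choose else 0

lemma katoOp_ae {W : Config N → ℝ} (hW : IsKato W) {c : ℝ} (hc : 0 < c) (f : L2 N) :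
    ∀ᵐ x, (katoOp W c f x : ℂ) = W x * freeResolvent N c f x := by
  rw [katoOp, dif_pos ⟨hW, hc⟩]
  exact (exists_katoOp hW hc).choose_spec f

lemma katoOp_eq {W : Config N → ℝ} (hW : IsKato W) {c : ℝ} (hc : 0 < c) {f u : L2 N}
    (hu : ∀ᵐ x, (u x : ℂ) = W x * freeResolvent N c f x) : katoOp W c f = u := by
  refine Lp.ext ?_
  filter_upwards [katoOp_ae hW hc f, hu] with x h1 h2
  rw [h1, h2]

lemma norm_katoOp_apply_mono {W W' : Config N → ℝ} (hW : IsKato W) (hW' : IsKato W')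
    (hle : ∀ x, |W' x| ≤ |W x|) {c : ℝ} (hc : 0 < c) (f : L2 N) :
    ‖katoOp W' c f‖ ≤ ‖katoOp W c f‖ := by
  refine Lp.norm_le_norm_of_ae_le ?_
  filter_upwards [katoOp_ae hW hc f, katoOp_ae hW' hc f] with x h1 h2
  rw [h1, h2, norm_mul, norm_mul, Complex.norm_real, Complex.norm_real]
  exact mul_le_mul_of_nonneg_right (hle x) (norm_nonneg _)

/-- `W (-Δ + c)⁻¹` is small for large `c`. -/
lemma exists_norm_katoOp_le {W : Config N → ℝ} (hW : IsKato W) {η : ℝ} (hη : 0 < η) :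
    ∃ c₀ : ℝ, 0 < c₀ ∧ ∀ c, c₀ ≤ c → ∀ f, ‖katoOp W c f‖ ≤ η * ‖f‖ := by
  obtain ⟨C, hC, hb⟩ := hW.2 (η / 2) (by positivity)
  refine ⟨2 * C / η + 1, by positivity, fun c hc f => ?_⟩
  have hc0 : 0 < c := lt_of_lt_of_le (by positivity) hc
  have h1 : ‖katoOp W c f‖ ≤ η / 2 * ‖(c : ℂ) • freeResolvent N c f - f‖ +
      C * ‖freeResolvent N c f‖ := by
    rw [Lp.norm_def, eLpNorm_congr_ae (katoOp_ae hW hc0 f)]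
    exact ENNReal.toReal_le_of_le_ofReal (by positivity) (hb _ _ (freeResolvent_spec hc0 f))
  have h2 := mul_le_mul_of_nonneg_left (norm_laplacian_freeResolvent_le hc0 f)
    (by positivity : 0 ≤ η / 2)
  have h3 := mul_le_mul_of_nonneg_left (norm_freeResolvent_apply_le hc0 f) hC
  have h4 : C * c⁻¹ ≤ η / 2 := by
    rw [← div_eq_mul_inv, div_le_iff₀ hc0]
    have : 2 * C / η ≤ c := by linarith
    rw [div_le_iff₀ hη] at this
    linarith
  have h5 := mul_le_mul_of_nonneg_right h4 (norm_nonneg f)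
  linarith

/-- `f = -Δψ + V ψ + c ψ`, where `l = Δψ`. -/
def IsSol (V : Config N → ℝ) (c : ℝ) (ψ l f : L2 N) : Prop :=
  IsWeakLaplacian ψ l ∧ ∀ᵐ x, (f x : ℂ) = -(l x) + (V x : ℂ) * ψ x + c * ψ x

/-- The resolvent `(-Δ + V + c)⁻¹ = (-Δ + c)⁻¹ (1 + V (-Δ + c)⁻¹)⁻¹`. -/
def schrodingerResolvent (V : Config N → ℝ) (c : ℝ) : L2 N →L[ℂ] L2 N :=
  freeResolvent N c ∘L Ring.inverse (1 + katoOp V c)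

/-- `V (-Δ + c)⁻¹` has norm at most `r < 1`. -/
structure IsSmall (V : Config N → ℝ) (c r : ℝ) : Prop where
  kato : IsKato V
  pos : 0 < c
  nonneg : 0 ≤ r
  lt_one : r < 1
  bound : ∀ f, ‖katoOp V c f‖ ≤ r * ‖f‖

section Small

variable {V : Config N → ℝ} {c r : ℝ}

lemma IsSmall.isUnit (h : IsSmall V c r) : IsUnit (1 + katoOp V c) := by
  have hn : ‖katoOp V c‖ < 1 :=
    (ContinuousLinearMap.opNorm_le_bound _ h.nonneg h.bound).trans_lt h.lt_one
  have := isUnit_one_sub_of_norm_lt_one (x := -katoOp V c) (by rwa [norm_neg])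
  rwa [sub_neg_eq_add] at this

lemma IsSmall.inverse_spec (h : IsSmall V c r) (f : L2 N) :
    Ring.inverse (1 + katoOp V c) f + katoOp V c (Ring.inverse (1 + katoOp V c) f) = f := by
  have := congrArg (fun T : L2 N →L[ℂ] L2 N => T f) (Ring.mul_inverse_cancel _ h.isUnit)
  simpa using this

lemma IsSmall.norm_le (h : IsSmall V c r) {f χ : L2 N} (hχ : χ + katoOp V c χ = f) :
    (1 - r) * ‖χ‖ ≤ ‖f‖ := by
  have h1 : ‖χ‖ ≤ ‖f‖ + ‖katoOp V c χ‖ := by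
    have : χ = f - katoOp V c χ := by rw [← hχ, add_sub_cancel_right]
    calc ‖χ‖ = ‖f - katoOp V c χ‖ := by rw [← this]
      _ ≤ _ := norm_sub_le _ _
  linarith [h.bound χ]

lemma IsSmall.inverse_eq (h : IsSmall V c r) {f χ : L2 N} (hχ : χ + katoOp V c χ = f) :
    Ring.inverse (1 + katoOp V c) f = χ := by
  have h1 : (Ring.inverse (1 + katoOp V c) f - χ) +
      katoOp V c (Ring.inverse (1 + katoOp V c) f - χ) = 0 := by
    rw [map_sub, ← sub_eq_zero.2 ((h.inverse_spec f).trans hχ.symm)]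
    abel
  have h2 := h.norm_le h1
  rw [norm_zero] at h2
  have h3 : 0 < 1 - r := by linarith [h.lt_one]
  exact sub_eq_zero.1 (norm_le_zero_iff.1 (nonpos_of_mul_nonpos_right h2 h3))

lemma IsSmall.resolvent_isSol (h : IsSmall V c r) (f : L2 N) :
    ∃ l, IsSol V c (schrodingerResolvent V c f) l f := by
  set χ := Ring.inverse (1 + katoOp V c) f with hχ
  have e : schrodingerResolvent V c f = freeResolvent N c χ := rfl
  refine ⟨(c : ℂ) • freeResolvent N c χ - χ, e ▸ freeResolvent_spec h.pos χ, ?_⟩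
  rw [e]
  have hs := h.inverse_spec f
  rw [← hχ] at hs
  filter_upwards [katoOp_ae h.kato h.pos χ, Lp.coeFn_add χ (katoOp V c χ),
    Lp.coeFn_sub ((c : ℂ) • freeResolvent N c χ) χ, Lp.coeFn_smul (c : ℂ) (freeResolvent N c χ)]
    with x h1 h2 h3 h4
  rw [hs] at h2
  rw [h2, Pi.add_apply, h1, h3, Pi.sub_apply, h4, Pi.smul_apply, smul_eq_mul]
  ring

lemma IsSmall.eq_resolvent (h : IsSmall V c r) {ψ l f : L2 N} (hs : IsSol V c ψ l f) :
    ψ = schrodingerResolvent V c f := by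
  have hψ : ψ = freeResolvent N c ((c : ℂ) • ψ - l) := eq_freeResolvent h.pos hs.1 rfl
  have hk : katoOp V c ((c : ℂ) • ψ - l) = f - ((c : ℂ) • ψ - l) := by
    refine katoOp_eq h.kato h.pos ?_
    rw [← hψ]
    filter_upwards [hs.2, Lp.coeFn_sub f ((c : ℂ) • ψ - l), Lp.coeFn_sub ((c : ℂ) • ψ) l,
      Lp.coeFn_smul (c : ℂ) ψ] with x h1 h2 h3 h4
    rw [h2, Pi.sub_apply, h3, Pi.sub_apply, h4, Pi.smul_apply, h1, smul_eq_mul]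
    ring
  rw [schrodingerResolvent, ContinuousLinearMap.comp_apply,
    h.inverse_eq (χ := (c : ℂ) • ψ - l) (by rw [hk]; abel)]
  exact hψ

end Small

/-- Positivity for a bounded repulsive potential `0 ≤ W ≤ m`: since
`ψ = (-Δ + c + m)⁻¹ (f + (m - W) ψ)`, it follows from the Neumann series. -/
lemma posPres_resolvent_of_bdd {W : Config N → ℝ} {c r m : ℝ} (h : IsSmall W c r)
    (h0 : ∀ x, 0 ≤ W x) (hm : ∀ x, W x ≤ m) (hm0 : 0 ≤ m) :
    PosPres (schrodingerResolvent W c) := by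
  intro f hf
  obtain ⟨l, hl, hs⟩ := h.resolvent_isSol f
  set ψ := schrodingerResolvent W c f
  have hB : IsBddMul fun x => m - W x :=
    ⟨measurable_const.sub h.kato.1, m, fun x => by
      rw [abs_of_nonneg (by linarith [hm x])]; linarith [h0 x]⟩
  have hcm : 0 < c + m := by linarith [h.pos]
  set χ := f + mulOp (fun x => m - W x) ψ with hχ
  have hψ : ψ = freeResolvent N (c + m) χ := by
    refine eq_freeResolvent hcm hl ?_
    refine Lp.ext ?_
    filter_upwards [hs, mulOp_ae hB ψ, Lp.coeFn_add f (mulOp (fun x => m - W x) ψ),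
      Lp.coeFn_sub (((c + m : ℝ) : ℂ) • ψ) l, Lp.coeFn_smul ((c + m : ℝ) : ℂ) ψ]
      with x h1 h2 h3 h4 h5
    rw [hχ, h3, Pi.add_apply, h2, h4, Pi.sub_apply, h5, Pi.smul_apply, h1, smul_eq_mul]
    push_cast
    ring
  have hpos : IsNonneg χ := by
    refine isNonneg_of_fixedPoint
      (T := mulOp (fun x => m - W x) ∘L freeResolvent N (c + m)) (r := m * (c + m)⁻¹)
      (fun g hg => isNonneg_of_mul (W := fun x => m - W x) (fun x => by linarith [hm x])
        (posPres_freeResolvent hcm g hg) (mulOp_ae hB _)) ?_ (fun g => ?_) hf ?_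
    · rw [← div_eq_mul_inv, div_lt_one hcm]
      linarith [h.pos]
    · have h1 := norm_mulOp_apply_le hB (C := m) (fun x => by
        rw [abs_of_nonneg (by linarith [hm x])]; linarith [h0 x]) (freeResolvent N (c + m) g)
      have h2 := mul_le_mul_of_nonneg_left (norm_freeResolvent_apply_le hcm g) hm0
      calc _ ≤ _ := h1
        _ ≤ _ := h2
        _ = _ := by ring
    · rw [ContinuousLinearMap.comp_apply, ← hψ]
  rw [hψ]
  exact posPres_freeResolvent hcm χ hpos

/-- Dominated convergence for truncated potentials. -/
lemma tendsto_katoOp_truncate {W : Config N → ℝ} (hW : IsKato W) (h0 : ∀ x, 0 ≤ W x) {c : ℝ}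
    (hc : 0 < c) (hWm : ∀ m : ℕ, IsKato fun x => min (W x) m) (χ : L2 N) :
    Tendsto (fun m : ℕ => katoOp (fun x => min (W x) m) c χ) atTop (𝓝 (katoOp W c χ)) := by
  rw [tendsto_iff_norm_sub_tendsto_zero]
  have hsq : Tendsto (fun m : ℕ => ‖katoOp (fun x => min (W x) m) c χ - katoOp W c χ‖ ^ 2) atTop
      (𝓝 0) := by
    simp_rw [norm_sq_eq_integral]
    have hz : (0 : ℝ) = ∫ x : Config N, (0 : ℝ) := by simp
    rw [hz]
    have hall : ∀ᵐ x, ∀ m : ℕ,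
        ((katoOp (fun x => min (W x) m) c χ - katoOp W c χ : L2 N) x : ℂ) =
        ((min (W x) m - W x : ℝ) : ℂ) * freeResolvent N c χ x := by
      refine ae_all_iff.2 fun m => ?_
      filter_upwards [Lp.coeFn_sub (katoOp (fun x => min (W x) m) c χ) (katoOp W c χ),
        katoOp_ae hW hc χ, katoOp_ae (hWm m) hc χ] with x h1 h2 h3
      rw [h1, Pi.sub_apply, h2, h3]
      push_cast
      ring
    refine tendsto_integral_of_dominated_convergence (fun x => ‖katoOp W c χ x‖ ^ 2)
      (fun m => ((Lp.memLp _).aestronglyMeasurable.norm.pow 2)) ?_ (fun m => ?_) ?_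
    · exact (Lp.memLp (katoOp W c χ)).norm.integrable_sq
    · filter_upwards [hall, katoOp_ae hW hc χ] with x h1 h2
      rw [h1 m, h2, norm_mul, norm_mul, Complex.norm_real, Complex.norm_real, Real.norm_eq_abs,
        Real.norm_eq_abs, abs_of_nonneg (sq_nonneg _)]
      have : |min (W x) (m : ℝ) - W x| ≤ |W x| := by
        have h1 : min (W x) (m : ℝ) ≤ W x := min_le_left _ _
        have h2 : 0 ≤ min (W x) (m : ℝ) := le_min (h0 x) (Nat.cast_nonneg m)
        rw [abs_of_nonpos (by linarith), abs_of_nonneg (h0 x)]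
        linarith
      exact pow_le_pow_left₀ (by positivity)
        (mul_le_mul_of_nonneg_right this (norm_nonneg _)) 2
    · filter_upwards [hall] with x h1
      refine tendsto_const_nhds.congr' ?_
      obtain ⟨M, hM⟩ := exists_nat_ge (W x)
      filter_upwards [eventually_ge_atTop M] with m hm
      have : W x ≤ (m : ℝ) := hM.trans (by exact_mod_cast hm)
      rw [h1 m, min_eq_left this]
      simp
  have := hsq.sqrt
  simpa [Real.sqrt_sq] using this

/-- Positivity for a repulsive potential, by truncation. -/
lemma posPres_resolvent_of_nonneg {W : Config N → ℝ} {c r : ℝ} (h : IsSmall W c r)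
    (h0 : ∀ x, 0 ≤ W x) : PosPres (schrodingerResolvent W c) := by
  intro f hf
  have habs : ∀ (m : ℕ) x, |min (W x) (m : ℝ)| ≤ |W x| := fun m x => by
    rw [abs_of_nonneg (le_min (h0 x) (Nat.cast_nonneg m)), abs_of_nonneg (h0 x)]
    exact min_le_left _ _
  have hk : ∀ m : ℕ, IsKato fun x => min (W x) m := fun m =>
    h.kato.mono (h.kato.1.min measurable_const) (habs m)
  have hsm : ∀ m : ℕ, IsSmall (fun x => min (W x) m) c r := fun m =>
    ⟨hk m, h.pos, h.nonneg, h.lt_one, fun f =>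
      (norm_katoOp_apply_mono h.kato (hk m) (habs m) h.pos f).trans (h.bound f)⟩
  set χ := Ring.inverse (1 + katoOp W c) f with hχ
  have hlim : Tendsto (fun m : ℕ => Ring.inverse (1 + katoOp (fun x => min (W x) m) c) f) atTop
      (𝓝 χ) := by
    rw [tendsto_iff_norm_sub_tendsto_zero]
    have h1r : 0 < 1 - r := by linarith [h.lt_one]
    have hlim0 := (tendsto_iff_norm_sub_tendsto_zero.1
      (tendsto_katoOp_truncate h.kato h0 h.pos hk χ)).const_mul (1 / (1 - r))
    rw [mul_zero] at hlim0
    refine squeeze_zero (fun m => norm_nonneg _) (fun m => ?_) hlim0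
    have e : (Ring.inverse (1 + katoOp (fun x => min (W x) m) c) f - χ) +
        katoOp (fun x => min (W x) m) c (Ring.inverse (1 + katoOp (fun x => min (W x) m) c) f - χ)
        = -(katoOp (fun x => min (W x) m) c χ - katoOp W c χ) := by
      have e1 := (hsm m).inverse_spec f
      have e2 := h.inverse_spec f
      rw [← hχ] at e2
      rw [map_sub, ← sub_eq_zero, ← sub_eq_zero.2 (e1.trans e2.symm)]
      abel
    have := (hsm m).norm_le e
    rw [norm_neg] at this
    rw [one_div, ← div_eq_inv_mul, le_div_iff₀ h1r, mul_comm]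
    exact this
  refine isClosed_isNonneg.mem_of_tendsto
    (((freeResolvent N c).continuous.tendsto χ).comp hlim) (Eventually.of_forall fun m => ?_)
  exact posPres_resolvent_of_bdd (hsm m) (fun x => le_min (h0 x) (Nat.cast_nonneg m))
    (fun x => min_le_right _ _) (Nat.cast_nonneg m) f hf

/-- Positivity for a general potential `W₊ - W₋`: a Neumann series in the attractive part. -/
lemma posPres_resolvent {W W' V : Config N → ℝ} {c r : ℝ} (h : IsSmall W c r)
    (h' : IsSmall W' c r) (hV : IsSmall V c r) (hr : 2 * r < 1) (h0 : ∀ x, 0 ≤ W x)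
    (h0' : ∀ x, 0 ≤ W' x) (hVW : ∀ x, V x = W x - W' x) :
    PosPres (schrodingerResolvent V c) := by
  intro f hf
  obtain ⟨l, hl, hs⟩ := hV.resolvent_isSol f
  set ψ := schrodingerResolvent V c f
  have hψ : ψ = freeResolvent N c ((c : ℂ) • ψ - l) := eq_freeResolvent h.pos hl rfl
  set u := katoOp W' c ((c : ℂ) • ψ - l) with hu
  have hue : ∀ᵐ x, (u x : ℂ) = W' x * ψ x := by
    have := katoOp_ae h'.kato h.pos ((c : ℂ) • ψ - l)
    rwa [← hψ] at this
  set g := f + u with hg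
  have hψg : ψ = schrodingerResolvent W c g := by
    refine h.eq_resolvent ⟨hl, ?_⟩
    filter_upwards [hs, hue, Lp.coeFn_add f u] with x h1 h2 h3
    rw [hg, h3, Pi.add_apply, h1, h2, hVW]
    push_cast
    ring
  have hSpos := posPres_resolvent_of_nonneg h h0
  have hgpos : IsNonneg g := by
    have h1r : 0 < 1 - r := by linarith [h.lt_one]
    refine isNonneg_of_fixedPoint (T := katoOp W' c ∘L Ring.inverse (1 + katoOp W c))
      (r := r / (1 - r)) (fun k hk => ?_) ?_ (fun k => ?_) hf ?_
    · exact isNonneg_of_mul h0' (hSpos k hk) (katoOp_ae h'.kato h.pos _)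
    · rw [div_lt_one h1r]
      linarith
    · have h1 := h'.bound (Ring.inverse (1 + katoOp W c) k)
      have h2 := h.norm_le (h.inverse_spec k)
      rw [ContinuousLinearMap.comp_apply, div_mul_eq_mul_div, le_div_iff₀ h1r]
      nlinarith [h.nonneg, mul_le_mul_of_nonneg_left h2 h.nonneg]
    · have : katoOp W' c (Ring.inverse (1 + katoOp W c) g) = u := by
        refine katoOp_eq h'.kato h.pos ?_
        change ∀ᵐ x, (u x : ℂ) = W' x * schrodingerResolvent W c g x
        rw [← hψg]
        exact hue
      rw [ContinuousLinearMap.comp_apply, this]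
  rw [hψg]
  exact hSpos g hgpos

/-- The resolvent is symmetric. -/
lemma IsSmall.inner_resolvent {V : Config N → ℝ} {c r : ℝ} (h : IsSmall V c r) (f g : L2 N) :
    inner ℂ (schrodingerResolvent V c f) g = inner ℂ f (schrodingerResolvent V c g) := by
  obtain ⟨l, hl, hs⟩ := h.resolvent_isSol f
  obtain ⟨m, hm, ht⟩ := h.resolvent_isSol g
  set ψ := schrodingerResolvent V c f
  set χ := schrodingerResolvent V c g
  have key : ∀ {ψ l f : L2 N}, IsSol V c ψ l f → ∀ᵐ x, ((f + l - (c : ℂ) • ψ : L2 N) x : ℂ) =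
      V x * ψ x := by
    intro ψ l f h
    filter_upwards [h.2, Lp.coeFn_sub (f + l) ((c : ℂ) • ψ), Lp.coeFn_add f l,
      Lp.coeFn_smul (c : ℂ) ψ] with x h1 h2 h3 h4
    rw [h2, Pi.sub_apply, h3, Pi.add_apply, h4, Pi.smul_apply, h1, smul_eq_mul]
    ring
  have hsym : inner ℂ (f + l - (c : ℂ) • ψ) χ = inner ℂ ψ (g + m - (c : ℂ) • χ) := by
    rw [L2.inner_def, L2.inner_def]
    refine integral_congr_ae ?_
    filter_upwards [key ⟨hl, hs⟩, key ⟨hm, ht⟩] with x h1 h2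
    rw [h1, h2, RCLike.inner_apply, RCLike.inner_apply, map_mul, Complex.conj_ofReal]
    ring
  have hlap := laplaceGraph_symmetric (p := (ψ, l)) hl (q := (χ, m)) hm
  simp only at hlap
  rw [inner_sub_left, inner_add_left, inner_smul_left, Complex.conj_ofReal, inner_sub_right,
    inner_add_right, inner_smul_right, hlap] at hsym
  linear_combination -hsym

end Resolvent


/-! ### The spectrum of the Hamiltonian below and at the ground state energy -/

section Spectrum

variable {N : ℕ} {e Z : ℝ} {y : Space}

lemma hamiltonian_apply_iff {ψ g : L2 N} :
    (∃ h : ψ ∈ (hamiltonian N e Z y).domain, hamiltonian N e Z y ⟨ψ, h⟩ = g) ↔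
      (ψ, g) ∈ hamiltonianGraph N e Z y := by
  rw [← hamiltonian_graph, LinearPMap.mem_graph_iff]
  constructor
  · rintro ⟨h, hg⟩
    exact ⟨⟨ψ, h⟩, rfl, hg⟩
  · rintro ⟨⟨ψ', h⟩, h1, h2⟩
    obtain rfl : ψ' = ψ := h1
    exact ⟨h, h2⟩

lemma mem_groundSpace_iff {Φ : L2 N} : Φ ∈ groundSpace (hamiltonian N e Z y) ↔
    (Φ, (groundEnergy (hamiltonian N e Z y) : ℂ) • Φ) ∈ hamiltonianGraph N e Z y :=
  hamiltonian_apply_iff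

lemma hamiltonianGraph_iff_isSol {ψ g : L2 N} (c : ℝ) :
    (ψ, g) ∈ hamiltonianGraph N e Z y ↔
      ∃ l, IsSol (potential e Z y) c ψ l (g + (c : ℂ) • ψ) := by
  refine exists_congr fun l => and_congr_right fun _ => ?_
  constructor
  · intro h
    filter_upwards [h, Lp.coeFn_add g ((c : ℂ) • ψ), Lp.coeFn_smul (c : ℂ) ψ] with x h1 h2 h3
    change (g x : ℂ) = -(l x) + (potential e Z y x : ℂ) * ψ x at h1
    rw [h2, Pi.add_apply, h3, Pi.smul_apply, h1, smul_eq_mul]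
  · intro h
    filter_upwards [h, Lp.coeFn_add g ((c : ℂ) • ψ), Lp.coeFn_smul (c : ℂ) ψ] with x h1 h2 h3
    rw [h2, Pi.add_apply, h3, Pi.smul_apply, smul_eq_mul] at h1
    linear_combination h1

lemma isKato_potential : IsKato (potential (N := N) e Z y) := by
  have h := (isKato_repulsion (N := N) e).add ((isKato_attraction (N := N) e Z y).const_mul (-1))
  have e1 : potential (N := N) e Z y = fun x => repulsion e x + -1 * attraction e Z y x :=
    funext fun x => by rw [potential_eq]; ring
  rwa [e1]

/-- For large `c`, the operator `H + c` has the resolvent constructed above, which is positivity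
preserving. -/
lemma exists_small_potential (hZ : 0 < Z) :
    ∃ c₀ : ℝ, 0 < c₀ ∧ ∀ c, c₀ ≤ c → IsSmall (potential (N := N) e Z y) c (1 / 4) ∧
      PosPres (schrodingerResolvent (potential (N := N) e Z y) c) := by
  have hq : (0 : ℝ) < 1 / 4 := by norm_num
  obtain ⟨c₁, h1, hc1⟩ := exists_norm_katoOp_le (isKato_potential (N := N) (e := e) (Z := Z) (y := y)) hq
  obtain ⟨c₂, h2, hc2⟩ := exists_norm_katoOp_le (isKato_repulsion (N := N) e) hq
  obtain ⟨c₃, h3, hc3⟩ := exists_norm_katoOp_le (isKato_attraction (N := N) e Z y) hq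
  refine ⟨max c₁ (max c₂ c₃), lt_max_of_lt_left h1, fun c hc => ?_⟩
  simp only [max_le_iff] at hc
  have hc0 : 0 < c := h1.trans_le hc.1
  have s1 : IsSmall (potential (N := N) e Z y) c (1 / 4) :=
    ⟨isKato_potential, hc0, by norm_num, by norm_num, hc1 c hc.1⟩
  exact ⟨s1, posPres_resolvent
    ⟨isKato_repulsion e, hc0, by norm_num, by norm_num, hc2 c hc.2.1⟩
    ⟨isKato_attraction e Z y, hc0, by norm_num, by norm_num, hc3 c hc.2.2⟩ s1 (by norm_num)
    (repulsion_nonneg e) (attraction_nonneg hZ y) (potential_eq e Z y)⟩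

lemma resolvent_mem_graph {c r : ℝ} (h : IsSmall (potential (N := N) e Z y) c r) (f : L2 N) :
    (schrodingerResolvent (potential e Z y) c f,
      f - (c : ℂ) • schrodingerResolvent (potential e Z y) c f) ∈ hamiltonianGraph N e Z y := by
  rw [hamiltonianGraph_iff_isSol c, sub_add_cancel]
  exact h.resolvent_isSol f

lemma resolvent_of_mem_graph {c r : ℝ} (h : IsSmall (potential (N := N) e Z y) c r) {ψ g : L2 N}
    (hg : (ψ, g) ∈ hamiltonianGraph N e Z y) :
    schrodingerResolvent (potential e Z y) c (g + (c : ℂ) • ψ) = ψ := by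
  obtain ⟨l, hl⟩ := (hamiltonianGraph_iff_isSol c).1 hg
  exact (h.eq_resolvent hl).symm

lemma isResolventPoint_of_small {c r : ℝ} (h : IsSmall (potential (N := N) e Z y) c r) :
    IsResolventPoint (hamiltonian N e Z y) ((-c : ℝ) : ℂ) := by
  refine ⟨schrodingerResolvent (potential e Z y) c, fun g => ?_, fun ψ => ?_⟩
  · obtain ⟨hd, hg⟩ := hamiltonian_apply_iff.2 (resolvent_mem_graph h g)
    refine ⟨hd, ?_⟩
    rw [hg]
    push_cast
    module
  · have := resolvent_of_mem_graph h (hamiltonian_apply_iff.1 ⟨ψ.2, rfl⟩)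
    push_cast
    rw [neg_smul, sub_neg_eq_add]
    exact this

lemma eigenvalue_mem_spec {Φ : L2 N} (h0 : Φ ≠ 0) {z : ℂ}
    (h : (Φ, z • Φ) ∈ hamiltonianGraph N e Z y) : z ∈ spec (hamiltonian N e Z y) := by
  rintro ⟨B, -, hB⟩
  obtain ⟨hd, hg⟩ := hamiltonian_apply_iff.2 h
  have := hB ⟨Φ, hd⟩
  rw [hg, sub_self, map_zero] at this
  exact h0 this.symm

/-- A nonzero spectral value `λ` of the resolvent `K = (H + c)⁻¹` gives the spectral value
`λ⁻¹ - c` of `H`. -/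
lemma mem_spec_of_mem_spectrum_resolvent {c r : ℝ}
    (h : IsSmall (potential (N := N) e Z y) c r) {lam : ℂ} (h0 : lam ≠ 0)
    (hl : lam ∈ spectrum ℂ (schrodingerResolvent (potential (N := N) e Z y) c)) :
    lam⁻¹ - c ∈ spec (hamiltonian N e Z y) := by
  rintro ⟨B, hB1, hB2⟩
  set K := schrodingerResolvent (potential (N := N) e Z y) c with hK
  have hKB : ∀ f, K (f + lam⁻¹ • B f) = B f := by
    intro f
    obtain ⟨hd, hf⟩ := hB1 f
    have := resolvent_of_mem_graph h (hamiltonian_apply_iff.1 ⟨hd, eq_add_of_sub_eq hf⟩)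
    rw [← hK] at this
    nth_rewrite 2 [← this]
    congr 1
    module
  have hBK : ∀ f, B (f - lam⁻¹ • K f) = K f := by
    intro f
    obtain ⟨hd, hf⟩ := hamiltonian_apply_iff.2 (resolvent_mem_graph h f)
    have h1 := hB2 ⟨_, hd⟩
    rw [hf] at h1
    have h2 : f - lam⁻¹ • K f = f - (c : ℂ) • K f - (lam⁻¹ - c) • K f := by module
    rw [h2]
    exact h1
  refine hl ?_
  let J : L2 N →L[ℂ] L2 N := lam⁻¹ • (1 + lam⁻¹ • B)
  refine ⟨⟨algebraMap ℂ _ lam - K, J, ?_, ?_⟩, rfl⟩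
  · ext1 f
    have : K (J f) = lam⁻¹ • B f := by
      change K (lam⁻¹ • (f + lam⁻¹ • B f)) = _
      rw [map_smul, hKB]
    change lam • J f - K (J f) = f
    rw [this]
    change lam • lam⁻¹ • (f + lam⁻¹ • B f) - lam⁻¹ • B f = f
    rw [smul_inv_smul₀ h0]
    abel
  · ext1 f
    change lam⁻¹ • ((lam • f - K f) + lam⁻¹ • B (lam • f - K f)) = f
    have : B (lam • f - K f) = lam • K f := by
      have h2 : lam • f - K f = lam • (f - lam⁻¹ • K f) := by rw [smul_sub, smul_inv_smul₀ h0]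
      rw [h2, map_smul, hBK]
    rw [this, inv_smul_smul₀ h0, sub_add_cancel, inv_smul_smul₀ h0]

/-- If `H` has a ground state, then for some `c` the resolvent `K = (H + c)⁻¹` is positivity
preserving and every ground state is an eigenvector of `K` for its largest eigenvalue `κ = ‖K‖`. -/
lemma exists_resolvent_of_groundState (hZ : 0 < Z) {Φ₀ : L2 N} (h0 : Φ₀ ≠ 0)
    (hΦ₀ : Φ₀ ∈ groundSpace (hamiltonian N e Z y)) :
    ∃ c r κ : ℝ, IsSmall (potential (N := N) e Z y) c r ∧
      PosPres (schrodingerResolvent (potential (N := N) e Z y) c) ∧ 0 < κ ∧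
      (∀ f, ‖schrodingerResolvent (potential (N := N) e Z y) c f‖ ≤ κ * ‖f‖) ∧
      ∀ Φ, Φ ∈ groundSpace (hamiltonian N e Z y) →
        schrodingerResolvent (potential e Z y) c Φ = (κ : ℂ) • Φ := by
  obtain ⟨c₀, hc₀, hsm⟩ := exists_small_potential (N := N) (e := e) (y := y) hZ
  obtain ⟨hs, hpos⟩ := hsm (c₀ + 1) (by linarith)
  set c := c₀ + 1 with hc
  set E := groundEnergy (hamiltonian N e Z y) with hE
  set S := {t : ℝ | (t : ℂ) ∈ spec (hamiltonian N e Z y)} with hS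
  -- `S` is bounded below and contains `E`, so that `E = sInf S` is not a junk value.
  have hbelow : ∀ t ∈ S, -c₀ ≤ t := by
    intro t ht
    by_contra! hlt
    refine ht ?_
    have := isResolventPoint_of_small (hsm (-t) (by linarith)).1
    rwa [neg_neg] at this
  have hbdd : BddBelow S := ⟨-c₀, hbelow⟩
  have hES : E ∈ S := eigenvalue_mem_spec h0 (mem_groundSpace_iff.1 hΦ₀)
  have hEc : 0 < E + c := by linarith [hbelow E hES]
  set K := schrodingerResolvent (potential (N := N) e Z y) c with hK
  refine ⟨c, 1 / 4, (E + c)⁻¹, hs, hpos, inv_pos.2 hEc, ?_, ?_⟩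
  · have hsa : IsSelfAdjoint K :=
      ContinuousLinearMap.isSelfAdjoint_iff_isSymmetric.2 fun f g => hs.inner_resolvent f g
    have : Nontrivial (L2 N) := ⟨Φ₀, 0, h0⟩
    obtain ⟨lam, hlam, hn⟩ := spectrum.exists_nnnorm_eq_spectralRadius K
    rw [hsa.spectralRadius_eq_nnnorm, ENNReal.coe_inj] at hn
    have hn' : ‖lam‖ = ‖K‖ := congrArg NNReal.toReal hn
    have hre := hsa.mem_spectrum_eq_re hlam
    -- The norm of the self-adjoint `K` is attained at a spectral value `lam`, and `lam⁻¹ - c ∈ S` is at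
    -- least `E`.
    have hle : ‖K‖ ≤ (E + c)⁻¹ := by
      rcases eq_or_ne lam 0 with hz | hz
      · rw [← hn', hz, norm_zero]
        exact (inv_pos.2 hEc).le
      · have hmem := mem_spec_of_mem_spectrum_resolvent hs hz hlam
        have hmem' : lam.re⁻¹ - c ∈ S := by
          change ((lam.re⁻¹ - c : ℝ) : ℂ) ∈ spec _
          rw [hre] at hmem
          push_cast
          exact hmem
        have h1 : E + c ≤ lam.re⁻¹ := by linarith [csInf_le hbdd hmem', hE, show E = sInf S from rfl]
        have h2 : 0 < lam.re := inv_pos.1 (hEc.trans_le h1)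
        rw [← hn', hre, Complex.norm_real, Real.norm_eq_abs, abs_of_pos h2]
        exact (le_inv_comm₀ hEc h2).1 h1
    exact fun f => (K.le_opNorm f).trans (mul_le_mul_of_nonneg_right hle (norm_nonneg f))
  · intro Φ hΦ
    have h1 := resolvent_of_mem_graph hs (mem_groundSpace_iff.1 hΦ)
    rw [← add_smul, map_smul, ← hK] at h1
    have h2 : ((E + c : ℝ) : ℂ) ≠ 0 := by exact_mod_cast hEc.ne'
    have h3 : ((E + c : ℝ) : ℂ) • K Φ = Φ := by
      push_cast
      exact h1
    rw [Complex.ofReal_inv, ← h3, inv_smul_smul₀ h2, h3]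

end Spectrum


/-! ### Real vectors and sign cuts -/

section PerronFrobenius

variable {N : ℕ}

/-- `f` is real-valued almost everywhere. -/
def IsRealVec (f : L2 N) : Prop := ∀ᵐ x, (f x).im = 0

/-- The indicator function of `S`. -/
def ind (S : Set (Config N)) : Config N → ℝ := S.indicator fun _ => 1

lemma ind_isBddMul {S : Set (Config N)} (hS : MeasurableSet S) : IsBddMul (ind S) :=
  ⟨measurable_const.indicator hS, 1, fun x => by
    by_cases h : x ∈ S <;> simp [ind, h]⟩

lemma ind_of_mem {S : Set (Config N)} {x : Config N} (h : x ∈ S) : ind S x = 1 := by simp [ind, h]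

lemma ind_of_notMem {S : Set (Config N)} {x : Config N} (h : x ∉ S) : ind S x = 0 := by
  simp [ind, h]

/-- The set where `f` is positive. -/
def posSet (f : L2 N) : Set (Config N) := {x | 0 < (f x).re}

lemma measurableSet_posSet (f : L2 N) : MeasurableSet (posSet f) :=
  measurableSet_lt measurable_const
    (Complex.measurable_re.comp (Lp.stronglyMeasurable f).measurable)

/-- Restriction to the set where `f` is positive. -/
def posCut (f : L2 N) : L2 N →L[ℂ] L2 N := mulOp (ind (posSet f))

lemma posCut_ae (f g : L2 N) : ∀ᵐ x, (posCut f g x : ℂ) = ind (posSet f) x * g x :=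
  mulOp_ae (ind_isBddMul (measurableSet_posSet f)) g

lemma isNonneg_posCut {f : L2 N} (hf : IsRealVec f) : IsNonneg (posCut f f) := by
  filter_upwards [posCut_ae f f, hf] with x h1 h2
  rw [h1, Complex.re_ofReal_mul, Complex.im_ofReal_mul, h2, mul_zero]
  refine ⟨?_, rfl⟩
  by_cases h : x ∈ posSet f
  · rw [ind_of_mem h, one_mul]
    exact le_of_lt h
  · rw [ind_of_notMem h, zero_mul]

lemma isNonneg_posCut_sub {f : L2 N} (hf : IsRealVec f) : IsNonneg (posCut f f - f) := by
  filter_upwards [posCut_ae f f, hf, Lp.coeFn_sub (posCut f f) f] with x h1 h2 h3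
  rw [h3, Pi.sub_apply, h1, Complex.sub_re, Complex.sub_im, Complex.re_ofReal_mul,
    Complex.im_ofReal_mul, h2, mul_zero, sub_zero]
  refine ⟨?_, rfl⟩
  by_cases h : x ∈ posSet f
  · rw [ind_of_mem h, one_mul, sub_self]
  · rw [ind_of_notMem h, zero_mul, zero_sub]
    exact neg_nonneg.2 (not_lt.1 h)

lemma inner_mulOp {W : Config N → ℝ} (hW : IsBddMul W) (f g : L2 N) :
    inner ℂ (mulOp W f) g = inner ℂ f (mulOp W g) := by
  rw [L2.inner_def, L2.inner_def]
  refine integral_congr_ae ?_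
  filter_upwards [mulOp_ae hW f, mulOp_ae hW g] with x h1 h2
  rw [h1, h2, RCLike.inner_apply, RCLike.inner_apply, map_mul, Complex.conj_ofReal]
  ring

lemma re_inner_nonneg {f g : L2 N} (hf : IsNonneg f) (hg : IsNonneg g) :
    0 ≤ (inner ℂ f g : ℂ).re := by
  have h := integral_re (L2.integrable_inner (𝕜 := ℂ) f g)
  rw [L2.inner_def]
  simp only [RCLike.re_eq_complex_re] at h
  rw [← h]
  refine integral_nonneg_of_ae ?_
  filter_upwards [hf, hg] with x h1 h2
  simp only [Pi.zero_apply, RCLike.inner_apply, Complex.mul_re, Complex.conj_re, Complex.conj_im,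
    h1.2, h2.2, mul_zero, neg_zero, sub_zero]
  exact mul_nonneg h2.1 h1.1

/-! ### Perron-Frobenius theory of the resolvent -/

/-- The positive part of a real eigenvector for the largest eigenvalue `κ` is an eigenvector: the
absolute value `a` satisfies `⟨a, K a⟩ ≥ ⟨f, K f⟩ = κ ‖a‖²`. -/
lemma posCut_eigenvector {K : L2 N →L[ℂ] L2 N} (hpos : PosPres K)
    (hsym : ∀ f g, inner ℂ (K f) g = inner ℂ f (K g)) {κ : ℝ} (hκ : 0 < κ)
    (hle : ∀ f, ‖K f‖ ≤ κ * ‖f‖) {f : L2 N} (hreal : IsRealVec f) (hf : K f = (κ : ℂ) • f) :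
    K (posCut f f) = (κ : ℂ) • posCut f f := by
  set p := posCut f f with hp
  set q := p - f with hq
  have hpn : IsNonneg p := isNonneg_posCut hreal
  have hqn : IsNonneg q := isNonneg_posCut_sub hreal
  have hfpq : f = p - q := by rw [hq]; abel
  have hpq : inner ℂ p q = 0 := by
    rw [L2.inner_def]
    refine integral_eq_zero_of_ae ?_
    filter_upwards [posCut_ae f f, Lp.coeFn_sub p f] with x h1 h2
    rw [h2, Pi.sub_apply, ← hp] at *
    rw [h1, Pi.zero_apply]
    by_cases h : x ∈ posSet f
    · simp [ind_of_mem h]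
    · simp [ind_of_notMem h]
  have hqp : inner ℂ q p = 0 := by rw [← inner_conj_symm, hpq, map_zero]
  clear_value p q
  set a := p + q with ha
  have hnorm : ‖a‖ ^ 2 = ‖f‖ ^ 2 := by
    have h1 : ‖f‖ ^ 2 = ‖p - q‖ ^ 2 := by rw [← hfpq]
    rw [h1, ha, @norm_add_sq ℂ, @norm_sub_sq ℂ, hpq]
    simp
  have hform : κ * ‖a‖ ^ 2 ≤ (inner ℂ a (K a)).re := by
    have h1 : (inner ℂ f (K f)).re = κ * ‖a‖ ^ 2 := by
      rw [hf, inner_smul_right, Complex.re_ofReal_mul, hnorm]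
      congr 1
      exact inner_self_eq_norm_sq (𝕜 := ℂ) f
    have h2 := re_inner_nonneg hpn (hpos q hqn)
    have h3 := re_inner_nonneg hqn (hpos p hpn)
    have h4 : inner ℂ a (K a) = inner ℂ f (K f) + 2 * inner ℂ p (K q) + 2 * inner ℂ q (K p) := by
      rw [hfpq, ha]
      simp only [map_add, map_sub, inner_add_left, inner_add_right, inner_sub_left,
        inner_sub_right]
      ring
    rw [h4, Complex.add_re, Complex.add_re, h1]
    simp only [Complex.mul_re, Complex.re_ofNat, Complex.im_ofNat, zero_mul, sub_zero]
    linarith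
  -- Expand `‖K a - κ a‖²` and use `‖K a‖ ≤ κ ‖a‖`: the quadratic form of `K` is maximal at `a`.
  have hKa : K a = (κ : ℂ) • a := by
    have h1 : ‖K a - (κ : ℂ) • a‖ ^ 2 ≤ 0 := by
      rw [@norm_sub_sq ℂ, inner_smul_right, norm_smul, hsym]
      simp only [RCLike.re_eq_complex_re, Complex.re_ofReal_mul, Complex.norm_real,
        Real.norm_eq_abs, abs_of_pos hκ]
      have h2 : ‖K a‖ ^ 2 ≤ (κ * ‖a‖) ^ 2 := pow_le_pow_left₀ (norm_nonneg _) (hle a) 2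
      have h3 := mul_le_mul_of_nonneg_left hform hκ.le
      nlinarith
    have h2 : ‖K a - (κ : ℂ) • a‖ = 0 := by
      have := sq_nonneg ‖K a - (κ : ℂ) • a‖
      exact pow_eq_zero_iff two_ne_zero |>.1 (le_antisymm h1 this)
    exact sub_eq_zero.1 (norm_eq_zero.1 h2)
  have hp2 : p = (1 / 2 : ℂ) • (a + f) := by
    rw [ha, hq]
    module
  rw [hp2, map_smul, map_add, hKa, hf]
  module

lemma eq_zero_of_testVec {T : L2 N →L[ℂ] L2 N} (h : ∀ φ, IsTest φ → T (testVec φ) = 0) :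
    T = 0 := by
  let D : Submodule ℂ (L2 N) := LinearMap.ker (T : L2 N →ₗ[ℂ] L2 N)
  have hD : IsClosed (D : Set (L2 N)) := T.isClosed_ker
  have : CompleteSpace D := hD.completeSpace_coe
  have htop : D = ⊤ := by
    rw [← Submodule.orthogonal_eq_bot_iff, Submodule.eq_bot_iff]
    intro w hw
    have h1 : ∀ φ, IsTest φ → inner ℂ (testVec φ) w = 0 := fun φ hφ =>
      (Submodule.mem_orthogonal _ _).1 hw _ (h φ hφ)
    -- A vector orthogonal to all test functions solves `-Δw + w = 0` weakly.
    exact eq_zero_of_inner_laplacian (c := 1) one_pos fun φ hφ => by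
      rw [h1 φ hφ, h1 _ hφ.laplacian, mul_zero]
  ext1 f
  have : f ∈ D := htop ▸ Submodule.mem_top
  exact this

/-- Restriction to the set where a nonnegative eigenvector `u` of `K` is positive commutes with `K`:
if `|g| ≤ n u` then `|K g| ≤ n κ u`, so `K` preserves functions supported in this set. -/
lemma posCut_comm {K : L2 N →L[ℂ] L2 N} (hpos : PosPres K)
    (hsym : ∀ f g, inner ℂ (K f) g = inner ℂ f (K g)) {κ : ℝ} {u : L2 N} (hu : IsNonneg u)
    (hKu : K u = (κ : ℂ) • u) (g : L2 N) : posCut u (K g) = K (posCut u g) := by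
  set P := posCut u with hP
  have hdom : ∀ (n : ℕ) (g : L2 N), IsNonneg ((n : ℂ) • u + g) → IsNonneg ((n : ℂ) • u - g) →
      P (K g) = K g := by
    intro n g h1 h2
    have h1' := hpos _ h1
    have h2' := hpos _ h2
    rw [map_add, map_smul, hKu] at h1'
    rw [map_sub, map_smul, hKu] at h2'
    refine Lp.ext ?_
    filter_upwards [posCut_ae u (K g), h1', h2', hu,
      Lp.coeFn_add ((n : ℂ) • (κ : ℂ) • u) (K g), Lp.coeFn_sub ((n : ℂ) • (κ : ℂ) • u) (K g),
      Lp.coeFn_smul (n : ℂ) ((κ : ℂ) • u), Lp.coeFn_smul (κ : ℂ) u] with x e1 e2 e3 e4 e5 e6 e7 e8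
    rw [e1]
    by_cases hx : x ∈ posSet u
    · rw [ind_of_mem hx, Complex.ofReal_one, one_mul]
    · have hz : (u x : ℂ) = 0 := Complex.ext (le_antisymm (not_lt.1 hx) e4.1) e4.2
      rw [e5, Pi.add_apply, e7, Pi.smul_apply, e8, Pi.smul_apply, hz, smul_zero, smul_zero,
        zero_add] at e2
      rw [e6, Pi.sub_apply, e7, Pi.smul_apply, e8, Pi.smul_apply, hz, smul_zero, smul_zero,
        zero_sub, Complex.neg_re] at e3
      have : (K g x : ℂ) = 0 := Complex.ext (by
        rw [Complex.zero_re]; linarith [e2.1, e3.1]) e2.2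
      rw [this, mul_zero]
  have hPKP : P ∘L K ∘L P - K ∘L P = 0 := by
    refine eq_zero_of_testVec fun φ hφ => ?_
    change P (K (P (testVec φ))) - K (P (testVec φ)) = 0
    rw [sub_eq_zero]
    -- The cutoffs `gn` of `φ` to the sets `{|φ| ≤ n u}` satisfy `|gn| ≤ n u` and converge to `P φ`.
    let T : ℕ → Set (Config N) := fun n => posSet u ∩ {x | |φ x| ≤ n * (u x).re}
    have hT : ∀ n, MeasurableSet (T n) := fun n => (measurableSet_posSet u).inter
      (measurableSet_le hφ.continuous.abs.measurable (measurable_const.mul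
        (Complex.measurable_re.comp (Lp.stronglyMeasurable u).measurable)))
    let gn : ℕ → L2 N := fun n => mulOp (ind (T n)) (testVec φ)
    have hgn : ∀ n, ∀ᵐ x, (gn n x : ℂ) = ((ind (T n) x * φ x : ℝ) : ℂ) := by
      intro n
      filter_upwards [mulOp_ae (ind_isBddMul (hT n)) (testVec φ), testVec_ae hφ] with x h1 h2
      rw [h1, h2, Complex.ofReal_mul]
    have habs : ∀ n x, 0 ≤ (u x).re → |ind (T n) x * φ x| ≤ n * (u x).re := by
      intro n x hx
      by_cases h : x ∈ T n
      · rw [ind_of_mem h, one_mul]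
        exact h.2
      · rw [ind_of_notMem h, zero_mul, abs_zero]
        positivity
    have hfix : ∀ n, P (K (gn n)) = K (gn n) := by
      intro n
      refine hdom n _ ?_ ?_
      · filter_upwards [hgn n, hu, Lp.coeFn_add ((n : ℂ) • u) (gn n), Lp.coeFn_smul (n : ℂ) u]
          with x h1 h2 h3 h4
        have h5 := abs_le.1 (habs n x h2.1)
        rw [h3, Pi.add_apply, h4, Pi.smul_apply, h1, smul_eq_mul, ← Complex.ofReal_natCast,
          Complex.add_re, Complex.add_im, Complex.re_ofReal_mul, Complex.im_ofReal_mul,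
          Complex.ofReal_re, Complex.ofReal_im, h2.2]
        exact ⟨by linarith [h5.1], by simp⟩
      · filter_upwards [hgn n, hu, Lp.coeFn_sub ((n : ℂ) • u) (gn n), Lp.coeFn_smul (n : ℂ) u]
          with x h1 h2 h3 h4
        have h5 := abs_le.1 (habs n x h2.1)
        rw [h3, Pi.sub_apply, h4, Pi.smul_apply, h1, smul_eq_mul, ← Complex.ofReal_natCast,
          Complex.sub_re, Complex.sub_im, Complex.re_ofReal_mul, Complex.im_ofReal_mul,
          Complex.ofReal_re, Complex.ofReal_im, h2.2]
        exact ⟨by linarith [h5.2], by simp⟩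
    have hlim : Tendsto gn atTop (𝓝 (P (testVec φ))) := by
      rw [tendsto_iff_norm_sub_tendsto_zero]
      have hall : ∀ᵐ x, ∀ n, ((gn n - P (testVec φ) : L2 N) x : ℂ) =
          (((ind (T n) x - ind (posSet u) x) * φ x : ℝ) : ℂ) := by
        refine ae_all_iff.2 fun n => ?_
        filter_upwards [hgn n, posCut_ae u (testVec φ), testVec_ae hφ,
          Lp.coeFn_sub (gn n) (P (testVec φ))] with x h1 h2 h3 h4
        rw [h4, Pi.sub_apply, h1, h2, h3]
        push_cast
        ring
      have hsq : Tendsto (fun n => ‖gn n - P (testVec φ)‖ ^ 2) atTop (𝓝 0) := by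
        simp_rw [norm_sq_eq_integral]
        have hz : (0 : ℝ) = ∫ x : Config N, (0 : ℝ) := by simp
        rw [hz]
        refine tendsto_integral_of_dominated_convergence (fun x => φ x ^ 2)
          (fun m => ((Lp.memLp _).aestronglyMeasurable.norm.pow 2))
          (hφ.memLp 2).integrable_sq (fun m => ?_) ?_
        · filter_upwards [hall] with x h1
          rw [h1 m, Complex.norm_real, Real.norm_eq_abs, Real.norm_eq_abs, sq_abs,
            abs_of_nonneg (sq_nonneg _), mul_pow]
          refine mul_le_of_le_one_left (sq_nonneg _) ?_
          by_cases h : x ∈ posSet u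
          · by_cases h' : x ∈ T m
            · simp [ind_of_mem h, ind_of_mem h']
            · simp [ind_of_mem h, ind_of_notMem h']
          · have h' : x ∉ T m := fun h' => h h'.1
            simp [ind_of_notMem h, ind_of_notMem h']
        · filter_upwards [hall] with x h1
          refine tendsto_const_nhds.congr' ?_
          by_cases h : x ∈ posSet u
          · have hx : 0 < (u x).re := h
            obtain ⟨M, hM⟩ := exists_nat_ge (|φ x| / (u x).re)
            filter_upwards [eventually_ge_atTop M] with m hm
            have h' : x ∈ T m := ⟨h, by
              have : |φ x| / (u x).re ≤ m := hM.trans (by exact_mod_cast hm)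
              exact (div_le_iff₀ hx).1 this⟩
            rw [h1 m, ind_of_mem h, ind_of_mem h']
            simp
          · refine Eventually.of_forall fun m => ?_
            have h' : x ∉ T m := fun h' => h h'.1
            change (0 : ℝ) = ‖((gn m - P (testVec φ) : L2 N) x : ℂ)‖ ^ 2
            rw [h1 m, ind_of_notMem h, ind_of_notMem h']
            simp
      simpa [Real.sqrt_sq] using hsq.sqrt
    have hl1 := ((K.continuous.tendsto _).comp hlim)
    have hl2 := ((P.continuous.tendsto _).comp hl1)
    exact tendsto_nhds_unique hl2 (hl1.congr fun n => (hfix n).symm)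
  have hPKP' : ∀ g, P (K (P g)) = K (P g) := fun g =>
    sub_eq_zero.1 (congrArg (fun T : L2 N →L[ℂ] L2 N => T g) hPKP)
  have hPsym : ∀ f g, inner ℂ (P f) g = inner ℂ f (P g) :=
    inner_mulOp (ind_isBddMul (measurableSet_posSet u))
  -- Taking adjoints in `P K P = K P` gives `P K P = P K`.
  have : P (K g) = P (K (P g)) := by
    refine ext_inner_right ℂ fun w => ?_
    rw [hPsym, hsym, ← hPKP' w, hPsym, hsym, hPsym]
  rw [this, hPKP']

end PerronFrobenius


/-! ### Irreducibility -/

section Irreducible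

variable {N : ℕ}

/-- The `k`-th coordinate of the `i`-th electron. -/
def coord (i : Fin N) (k : Fin 3) : Config N →L[ℝ] ℝ :=
  (EuclideanSpace.proj (𝕜 := ℝ) k).comp (ContinuousLinearMap.proj (R := ℝ) i)

lemma coord_unitVec (i j : Fin N) (k m : Fin 3) :
    coord i k (unitVec j m) = if i = j then (if k = m then 1 else 0) else 0 := by
  change (unitVec j m i) k = _
  rw [unitVec_apply]
  split_ifs <;> simp_all

lemma dirDeriv_linear_mul (f : Config N →L[ℝ] ℝ) {η : Config N → ℝ} (hη : ContDiff ℝ ∞ η)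
    (v : Config N) : dirDeriv v (fun x => f x * η x) = fun x => f x * dirDeriv v η x + f v * η x := by
  funext x
  have h3 : HasFDerivAt (fun x => f x * η x) _ x :=
    f.hasFDerivAt.mul (hη.differentiable (by simp)).differentiableAt.hasFDerivAt
  rw [dirDeriv, h3.fderiv]
  simp [dirDeriv]
  ring

lemma laplacian_coord_mul {η : Config N → ℝ} (hη : IsTest η) (i : Fin N) (k : Fin 3)
    (x : Config N) : laplacian (fun x => coord i k x * η x) x =
      coord i k x * laplacian η x + 2 * dirDeriv (unitVec i k) η x := by
  rw [laplacian_eq_sum_dirDeriv (hη.smooth_mul (coord i k).contDiff).smooth,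
    laplacian_eq_sum_dirDeriv hη.smooth]
  have key : ∀ j m, dirDeriv (unitVec j m) (dirDeriv (unitVec j m) fun x => coord i k x * η x) x =
      coord i k x * dirDeriv (unitVec j m) (dirDeriv (unitVec j m) η) x +
        2 * (coord i k (unitVec j m) * dirDeriv (unitVec j m) η x) := by
    intro j m
    rw [dirDeriv_linear_mul _ hη.smooth]
    have h1 : IsTest fun x => coord i k x * dirDeriv (unitVec j m) η x :=
      (hη.dirDeriv _).smooth_mul (coord i k).contDiff
    have h2 : HasFDerivAt (fun x => coord i k x * dirDeriv (unitVec j m) η x +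
        coord i k (unitVec j m) * η x) _ x :=
      ((h1.smooth.differentiable (by simp)).differentiableAt.hasFDerivAt).add
        ((hη.smooth.differentiable (by simp)).differentiableAt.hasFDerivAt.const_mul _)
    rw [dirDeriv, h2.fderiv]
    change dirDeriv (unitVec j m) (fun x => coord i k x * dirDeriv (unitVec j m) η x) x +
      coord i k (unitVec j m) * dirDeriv (unitVec j m) η x = _
    rw [dirDeriv_linear_mul _ (hη.dirDeriv _).smooth]
    ring
  simp_rw [key, Finset.sum_add_distrib, ← Finset.mul_sum, coord_unitVec]
  congr 2
  simp [Finset.sum_ite_eq]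

lemma laplacian_const (c : ℝ) (x : Config N) : laplacian (fun _ => c) x = 0 := by
  rw [laplacian_eq_sum_dirDeriv contDiff_const]
  refine Finset.sum_eq_zero fun i _ => Finset.sum_eq_zero fun k _ => ?_
  have : dirDeriv (unitVec i k) (fun _ : Config N => c) = fun _ => 0 := by
    funext x
    simp [dirDeriv]
  rw [this]
  simp [dirDeriv]

lemma laplacian_coord (i : Fin N) (k : Fin 3) (x : Config N) :
    laplacian (fun x => coord i k x) x = 0 := by
  rw [laplacian_eq_sum_dirDeriv (coord i k).contDiff]
  refine Finset.sum_eq_zero fun j _ => Finset.sum_eq_zero fun m _ => ?_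
  have : dirDeriv (unitVec j m) (fun x => coord i k x) = fun _ => coord i k (unitVec j m) := by
    funext x
    rw [dirDeriv]
    exact congrArg (fun T : Config N →L[ℝ] ℝ => T (unitVec j m)) (coord i k).fderiv
  rw [this]
  simp [dirDeriv]

lemma laplacian_congr {φ η : Config N → ℝ} {x : Config N} (h : φ =ᶠ[𝓝 x] η) :
    laplacian φ x = laplacian η x := by
  have := (EventuallyEq.iteratedFDeriv ℝ h 2).eq_of_nhds
  simp only [laplacian, this]

/-- If the Laplacian on test functions commutes with restriction to `S`, then `S` is null or
conull: testing with cutoffs of `1` and of the coordinate functions shows that the indicator function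
of `S` has vanishing gradient. -/
lemma null_or_conull_of_laplacian_comm {S : Set (Config N)} (hS : MeasurableSet S)
    (h : ∀ φ, IsTest φ → IsWeakLaplacian (mulOp (ind S) (testVec φ))
      (mulOp (ind S) (testVec (laplacian φ)))) :
    (∀ᵐ x, x ∈ S) ∨ ∀ᵐ x, x ∉ S := by
  have hB := ind_isBddMul hS
  have hloc : LocallyIntegrable (ind S) volume :=
    (locallyIntegrable_const (1 : ℝ)).indicator hS
  -- `∫_S (φ Δη - η Δφ) = 0` for test functions.
  have hsym : ∀ φ η, IsTest φ → IsTest η →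
      ∫ x, ind S x * (φ x * laplacian η x) = ∫ x, ind S x * (η x * laplacian φ x) := by
    intro φ η hφ hη
    have h1 := isWeakLaplacian_iff.1 (h φ hφ) η hη
    have h2 : ∀ {a b : Config N → ℝ}, IsTest a → IsTest b →
        inner ℂ (testVec a) (mulOp (ind S) (testVec b)) =
          ((∫ x, ind S x * (b x * a x) : ℝ) : ℂ) := by
      intro a b ha hb
      rw [inner_testVec ha]
      refine Eq.trans (integral_congr_ae ?_) (integral_ofReal (𝕜 := ℂ))
      filter_upwards [mulOp_ae hB (testVec b), testVec_ae hb] with x h1 h2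
      rw [h1, h2, Complex.real_smul]
      change _ = ((ind S x * (b x * a x) : ℝ) : ℂ)
      push_cast
      ring
    rw [h2 hη.laplacian hφ, h2 hη hφ.laplacian] at h1
    rw [Complex.ofReal_injective h1]
    exact integral_congr_ae (Eventually.of_forall fun x => by
      simp only
      ring)
  -- A smooth `f` with `Δf = 0` may take the place of a test function.
  have hharm : ∀ f : Config N → ℝ, ContDiff ℝ ∞ f → (∀ x, laplacian f x = 0) → ∀ η, IsTest η →
      ∫ x, ind S x * (f x * laplacian η x) = 0 := by
    intro f hf hlf η hη
    obtain ⟨r, hr0, hr⟩ := hη.compact.isBounded.subset_ball_lt 0 (0 : Config N)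
    let χ : ContDiffBump (0 : Config N) := ⟨r, r + 1, hr0, by linarith⟩
    have hχ : IsTest χ := ⟨χ.contDiff, χ.hasCompactSupport⟩
    have hφ : IsTest fun x => f x * χ x := hχ.smooth_mul hf
    have hloceq : ∀ x ∈ Metric.ball (0 : Config N) r, (fun x => f x * χ x) =ᶠ[𝓝 x] f := by
      intro x hx
      filter_upwards [χ.eventuallyEq_one_of_mem_ball hx] with z hz
      rw [hz, Pi.one_apply, mul_one]
    have h1 := hsym _ η hφ hη
    have h2 : ∫ x, ind S x * (η x * laplacian (fun x => f x * χ x) x) = 0 := by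
      refine integral_eq_zero_of_ae (Eventually.of_forall fun x => ?_)
      by_cases hx : x ∈ tsupport η
      · simp [laplacian_congr (hloceq x (hr hx)), hlf x]
      · simp [image_eq_zero_of_notMem_tsupport hx]
    rw [h2] at h1
    rw [← h1]
    refine integral_congr_ae (Eventually.of_forall fun x => ?_)
    simp only
    by_cases hx : x ∈ Metric.ball (0 : Config N) r
    · rw [(hloceq x hx).eq_of_nhds]
    · have : laplacian η x = 0 := by
        have hx' : x ∉ tsupport η := fun h => hx (hr h)
        have : η =ᶠ[𝓝 x] fun _ => 0 := notMem_tsupport_iff_eventuallyEq.1 hx'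
        rw [laplacian_congr this, laplacian_const]
      simp [this]
  have hgrad : ∀ φ, IsTest φ → ∀ i k, ∫ x, ind S x * dirDeriv (unitVec i k) φ x = 0 := by
    intro φ hφ i k
    have hcφ : IsTest fun x => coord i k x * φ x := hφ.smooth_mul (coord i k).contDiff
    have h1 := hharm (fun _ => 1) contDiff_const (laplacian_const 1) _ hcφ
    have h2 := hharm (fun x => coord i k x) (coord i k).contDiff (laplacian_coord i k) φ hφ
    -- `Δ(x_ik φ) = x_ik Δφ + 2 ∂_ik φ`, and both Laplacians integrate to zero over `S`.
    have h3 : ∀ x, ind S x * (1 * laplacian (fun x => coord i k x * φ x) x) =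
        ind S x * (coord i k x * laplacian φ x) +
          2 * (ind S x * dirDeriv (unitVec i k) φ x) := by
      intro x
      rw [laplacian_coord_mul hφ]
      ring
    simp_rw [h3] at h1
    rw [integral_add ((hφ.laplacian.smooth_mul (coord i k).contDiff).integrable_mul hloc)
      (((hφ.dirDeriv _).integrable_mul hloc).const_mul 2), h2, integral_const_mul, zero_add] at h1
    linarith
  obtain ⟨c, hc⟩ := ae_const_of_weak_gradient_eq_zero hloc hgrad
  by_cases h1 : c = 1
  · left
    filter_upwards [hc] with x hx
    by_contra hn
    rw [ind_of_notMem hn, h1] at hx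
    exact zero_ne_one hx
  · right
    filter_upwards [hc] with x hx hn
    rw [ind_of_mem hn] at hx
    exact h1 hx.symm

lemma memLp_kato_mul {V : Config N → ℝ} (hV : IsKato V) {ψ l : L2 N} (h : IsWeakLaplacian ψ l) :
    MemLp (fun x => (V x : ℂ) * ψ x) 2 volume := by
  obtain ⟨C, hC, hb⟩ := hV.2 1 one_pos
  exact ⟨(Complex.measurable_ofReal.comp hV.1).aestronglyMeasurable.mul
    (Lp.memLp _).aestronglyMeasurable, (hb _ _ h).trans_lt ENNReal.ofReal_lt_top⟩

/-- The resolvent of a Schrödinger operator is irreducible: if it commutes with restriction to `S`,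
so does the Laplacian, since the potential does, and `S` is null or conull. -/
lemma null_or_conull_of_resolvent_comm {V : Config N → ℝ} {c r : ℝ} (hV : IsSmall V c r)
    {S : Set (Config N)} (hS : MeasurableSet S)
    (h : ∀ f, mulOp (ind S) (schrodingerResolvent V c f) =
      schrodingerResolvent V c (mulOp (ind S) f)) :
    (∀ᵐ x, x ∈ S) ∨ ∀ᵐ x, x ∉ S := by
  refine null_or_conull_of_laplacian_comm hS fun φ hφ => ?_
  have hB := ind_isBddMul hS
  have hm := memLp_kato_mul hV.kato (isWeakLaplacian_testVec hφ)
  set f : L2 N := -testVec (laplacian φ) + hm.toLp + (c : ℂ) • testVec φ with hf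
  have hfe : ∀ᵐ x, (f x : ℂ) = -(testVec (laplacian φ) x) + (V x : ℂ) * testVec φ x +
      c * testVec φ x := by
    filter_upwards [Lp.coeFn_add (-testVec (laplacian φ) + hm.toLp) ((c : ℂ) • testVec φ),
      Lp.coeFn_add (-testVec (laplacian φ)) hm.toLp, Lp.coeFn_neg (testVec (laplacian φ)),
      hm.coeFn_toLp, Lp.coeFn_smul (c : ℂ) (testVec φ)] with x h1 h2 h3 h4 h5
    rw [hf, h1, Pi.add_apply, h2, Pi.add_apply, h3, Pi.neg_apply, h4, h5, Pi.smul_apply,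
      smul_eq_mul]
  have h1 : testVec φ = schrodingerResolvent V c f :=
    hV.eq_resolvent ⟨isWeakLaplacian_testVec hφ, hfe⟩
  obtain ⟨l, hl, hs⟩ := hV.resolvent_isSol (mulOp (ind S) f)
  rw [← h, ← h1] at hl hs
  have : l = mulOp (ind S) (testVec (laplacian φ)) := by
    refine Lp.ext ?_
    filter_upwards [hs, hfe, mulOp_ae hB f, mulOp_ae hB (testVec φ),
      mulOp_ae hB (testVec (laplacian φ))] with x h1 h2 h3 h4 h5
    rw [h3, h4, h2] at h1
    rw [h5]
    linear_combination h1
  rwa [← this]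

lemma IsRealVec.neg {f : L2 N} (hf : IsRealVec f) : IsRealVec (-f) := by
  filter_upwards [hf, Lp.coeFn_neg f] with x h1 h2
  rw [h2, Pi.neg_apply, Complex.neg_im, h1, neg_zero]

/-- A real eigenvector of the resolvent for its largest eigenvalue does not change sign. -/
lemma isNonneg_or_neg_of_eigenvector {V : Config N → ℝ} {c r κ : ℝ} (hV : IsSmall V c r)
    (hpos : PosPres (schrodingerResolvent V c)) (hκ : 0 < κ)
    (hle : ∀ f, ‖schrodingerResolvent V c f‖ ≤ κ * ‖f‖) {f : L2 N} (hreal : IsRealVec f)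
    (hf : schrodingerResolvent V c f = (κ : ℂ) • f) : IsNonneg f ∨ IsNonneg (-f) := by
  set u := posCut f f with hu
  have hun : IsNonneg u := isNonneg_posCut hreal
  have hKu := posCut_eigenvector hpos hV.inner_resolvent hκ hle hreal hf
  rw [← hu] at hKu
  have hsub : ∀ᵐ x, x ∈ posSet u → (u x : ℂ) = f x := by
    filter_upwards [posCut_ae f f] with x h1 hx
    rw [← hu] at h1
    by_cases h : x ∈ posSet f
    · rw [h1, ind_of_mem h, Complex.ofReal_one, one_mul]
    · rw [ind_of_notMem h, Complex.ofReal_zero, zero_mul] at h1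
      have : 0 < (u x).re := hx
      rw [h1] at this
      exact absurd this (lt_irrefl _)
  rcases null_or_conull_of_resolvent_comm hV (measurableSet_posSet u)
    (fun g => posCut_comm hpos hV.inner_resolvent hun hKu g) with h | h
  · left
    filter_upwards [h, hsub, hun] with x h1 h2 h3
    rw [← h2 h1]
    exact h3
  · right
    filter_upwards [h, hun, isNonneg_posCut_sub hreal, Lp.coeFn_sub (posCut f f) f,
      Lp.coeFn_neg f] with x h1 h2 h3 h4 h5
    rw [← hu] at h3 h4
    have hz : (u x : ℂ) = 0 := Complex.ext (le_antisymm (not_lt.1 h1) h2.1) h2.2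
    rw [h4, Pi.sub_apply, hz, zero_sub] at h3
    rw [h5, Pi.neg_apply]
    exact h3

end Irreducible

/-! ### Rotations of configuration space -/

lemma rotatePoint_symm_apply (y : Space) (R : Space ≃ₗᵢ[ℝ] Space) (z : Space) :
    rotatePoint y R.symm (rotatePoint y R z) = z := by
  simp [rotatePoint]

lemma rotatePoint_apply_symm (y : Space) (R : Space ≃ₗᵢ[ℝ] Space) (z : Space) :
    rotatePoint y R (rotatePoint y R.symm z) = z := by
  simp [rotatePoint]

lemma continuous_rotatePoint (y : Space) (R : Space ≃ₗᵢ[ℝ] Space) :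
    Continuous (rotatePoint y R) :=
  continuous_const.add (R.continuous.comp (continuous_id.sub continuous_const))

/-- The simultaneous rotation of all electrons about `y`. -/
def rotateConfig {N : ℕ} (y : Space) (R : Space ≃ₗᵢ[ℝ] Space) : Config N ≃ₜ Config N where
  toFun x i := rotatePoint y R (x i)
  invFun x i := rotatePoint y R.symm (x i)
  left_inv x := funext fun i => rotatePoint_symm_apply y R (x i)
  right_inv x := funext fun i => rotatePoint_apply_symm y R (x i)
  continuous_toFun := continuous_pi fun i => (continuous_rotatePoint y R).comp (continuous_apply i)
  continuous_invFun :=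
    continuous_pi fun i => (continuous_rotatePoint y R.symm).comp (continuous_apply i)

lemma rotateConfig_apply {N : ℕ} (y : Space) (R : Space ≃ₗᵢ[ℝ] Space) (x : Config N) (i : Fin N) :
    rotateConfig y R x i = rotatePoint y R (x i) := rfl

lemma rotateConfig_symm_apply {N : ℕ} (y : Space) (R : Space ≃ₗᵢ[ℝ] Space) (x : Config N) :
    rotateConfig y R.symm (rotateConfig y R x) = x := (rotateConfig y R).left_inv x

lemma rotateConfig_apply_symm {N : ℕ} (y : Space) (R : Space ≃ₗᵢ[ℝ] Space) (x : Config N) :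
    rotateConfig y R (rotateConfig y R.symm x) = x := (rotateConfig y R).right_inv x

lemma measurePreserving_rotateConfig {N : ℕ} (y : Space) (R : Space ≃ₗᵢ[ℝ] Space) :
    MeasurePreserving (rotateConfig (N := N) y R) :=
  volume_preserving_pi fun _ => measurePreserving_rotatePoint y R

lemma rotate_ae {N : ℕ} (y : Space) (R : Space ≃ₗᵢ[ℝ] Space) (ψ : L2 N) :
    ∀ᵐ x, (rotate y R ψ x : ℂ) = ψ (rotateConfig y R.symm x) :=
  Lp.coeFn_compMeasurePreserving ψ (measurePreserving_rotateConfig y R.symm)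

lemma rotateOne_ae (y : Space) (R : Space ≃ₗᵢ[ℝ] Space) (f : L2One) :
    ∀ᵐ z, (rotateOne y R f z : ℂ) = f (rotatePoint y R.symm z) :=
  Lp.coeFn_compMeasurePreserving f (measurePreserving_rotatePoint y R.symm)

lemma norm_rotate {N : ℕ} (y : Space) (R : Space ≃ₗᵢ[ℝ] Space) (ψ : L2 N) :
    ‖rotate y R ψ‖ = ‖ψ‖ :=
  Lp.norm_compMeasurePreserving ψ (measurePreserving_rotateConfig y R.symm)

lemma inner_rotate {N : ℕ} (y : Space) (R : Space ≃ₗᵢ[ℝ] Space) (ψ χ : L2 N) :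
    inner ℂ (rotate y R ψ) (rotate y R χ) = inner ℂ ψ χ :=
  (Lp.compMeasurePreservingₗᵢ ℂ _ (measurePreserving_rotateConfig y R.symm)).inner_map_map ψ χ

lemma inner_rotateOne (y : Space) (R : Space ≃ₗᵢ[ℝ] Space) (f g : L2One) :
    inner ℂ (rotateOne y R f) (rotateOne y R g) = inner ℂ f g :=
  (Lp.compMeasurePreservingₗᵢ ℂ _ (measurePreserving_rotatePoint y R.symm)).inner_map_map f g

lemma rotate_rotate_symm {N : ℕ} (y : Space) (R : Space ≃ₗᵢ[ℝ] Space) (ψ : L2 N) :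
    rotate y R (rotate y R.symm ψ) = ψ := by
  refine Lp.ext ?_
  filter_upwards [rotate_ae y R (rotate y R.symm ψ),
    (measurePreserving_rotateConfig y R.symm).quasiMeasurePreserving.ae
      (rotate_ae y R.symm ψ)] with x h1 h2
  rw [h1, h2, LinearIsometryEquiv.symm_symm, rotateConfig_apply_symm]

lemma rotateOne_rotateOne_symm (y : Space) (R : Space ≃ₗᵢ[ℝ] Space) (f : L2One) :
    rotateOne y R (rotateOne y R.symm f) = f := by
  refine Lp.ext ?_
  filter_upwards [rotateOne_ae y R (rotateOne y R.symm f),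
    (measurePreserving_rotatePoint y R.symm).quasiMeasurePreserving.ae
      (rotateOne_ae y R.symm f)] with x h1 h2
  rw [h1, h2, LinearIsometryEquiv.symm_symm, rotatePoint_apply_symm]

lemma dirDeriv_dirDeriv {N : ℕ} {φ : Config N → ℝ} (h : ContDiff ℝ ∞ φ) (v w x : Config N) :
    dirDeriv v (dirDeriv w φ) x = fderiv ℝ (fderiv ℝ φ) x v w := by
  have hd : DifferentiableAt ℝ (fderiv ℝ φ) x :=
    ((h.fderiv_right (m := ∞) le_rfl).differentiable (by simp)).differentiableAt
  have := (hd.hasFDerivAt.clm_apply (hasFDerivAt_const w x)).fderiv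
  unfold dirDeriv
  rw [this]
  simp

/-- The linear part of a rotation of configuration space. -/
def rotateLin {N : ℕ} (R : Space ≃ₗᵢ[ℝ] Space) : Config N →L[ℝ] Config N :=
  ContinuousLinearMap.pi fun i =>
    (R.toContinuousLinearEquiv : Space →L[ℝ] Space) ∘L ContinuousLinearMap.proj i

lemma rotateLin_apply {N : ℕ} (R : Space ≃ₗᵢ[ℝ] Space) (v : Config N) (i : Fin N) :
    rotateLin R v i = R (v i) := rfl

lemma hasFDerivAt_rotateConfig {N : ℕ} (y : Space) (R : Space ≃ₗᵢ[ℝ] Space) (x : Config N) :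
    HasFDerivAt (rotateConfig (N := N) y R) (rotateLin R) x := by
  refine hasFDerivAt_pi.2 fun i => ?_
  have h1 : HasFDerivAt (fun x : Config N => x i - y) (ContinuousLinearMap.proj i) x :=
    (ContinuousLinearMap.proj (R := ℝ) (φ := fun _ : Fin N => Space) i).hasFDerivAt.sub_const y
  exact ((R.toContinuousLinearEquiv : Space →L[ℝ] Space).hasFDerivAt.comp x h1).const_add y

lemma contDiff_rotateConfig {N : ℕ} (y : Space) (R : Space ≃ₗᵢ[ℝ] Space) :
    ContDiff ℝ ∞ (rotateConfig (N := N) y R) := by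
  refine contDiff_pi.2 fun i => contDiff_const.add (R.contDiff.comp ?_)
  exact (contDiff_apply ℝ Space i).sub contDiff_const

lemma IsTest.comp_rotate {N : ℕ} {φ : Config N → ℝ} (h : IsTest φ) (y : Space)
    (R : Space ≃ₗᵢ[ℝ] Space) : IsTest (fun x => φ (rotateConfig y R x)) :=
  ⟨h.smooth.comp (contDiff_rotateConfig y R), h.compact.comp_homeomorph (rotateConfig y R)⟩

lemma dirDeriv_comp_rotate {N : ℕ} {φ : Config N → ℝ} (h : ContDiff ℝ ∞ φ) (y : Space)
    (R : Space ≃ₗᵢ[ℝ] Space) (v : Config N) :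
    dirDeriv v (fun x => φ (rotateConfig y R x)) =
      fun x => dirDeriv (rotateLin R v) φ (rotateConfig y R x) := by
  funext x
  have hd : DifferentiableAt ℝ φ (rotateConfig y R x) :=
    (h.differentiable (by simp)).differentiableAt
  have := (hd.hasFDerivAt.comp x (hasFDerivAt_rotateConfig y R x)).fderiv
  unfold dirDeriv
  exact congrArg (fun L => L v) this

/-- The trace of a bilinear form does not depend on the orthonormal basis. -/
lemma sum_bilin_rotate (B : Space →ₗ[ℝ] Space →ₗ[ℝ] ℝ) (R : Space ≃ₗᵢ[ℝ] Space) :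
    ∑ k : Fin 3, B (R (EuclideanSpace.single k 1)) (R (EuclideanSpace.single k 1)) =
      ∑ k : Fin 3, B (EuclideanSpace.single k 1) (EuclideanSpace.single k 1) := by
  have h1 := InnerProductSpace.canonicalCovariantTensor_eq_sum Space
    (EuclideanSpace.basisFun (Fin 3) ℝ)
  have h2 := InnerProductSpace.canonicalCovariantTensor_eq_sum Space
    ((EuclideanSpace.basisFun (Fin 3) ℝ).map R)
  have h3 := congrArg (TensorProduct.lift B) (h2.symm.trans h1)
  simpa using h3

lemma laplacian_comp_rotate {N : ℕ} {φ : Config N → ℝ} (h : ContDiff ℝ ∞ φ) (y : Space)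
    (R : Space ≃ₗᵢ[ℝ] Space) (x : Config N) :
    laplacian (fun x => φ (rotateConfig y R x)) x = laplacian φ (rotateConfig y R x) := by
  have hc : ContDiff ℝ ∞ fun x => φ (rotateConfig y R x) := h.comp (contDiff_rotateConfig y R)
  rw [laplacian_eq_sum_dirDeriv hc, laplacian_eq_sum_dirDeriv h]
  refine Finset.sum_congr rfl fun i _ => ?_
  let B : Space →ₗ[ℝ] Space →ₗ[ℝ] ℝ :=
    LinearMap.mk₂ ℝ (fun v w => fderiv ℝ (fderiv ℝ φ) (rotateConfig y R x)
        (Pi.single i v) (Pi.single i w))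
      (fun a b c => by rw [Pi.single_add, map_add, add_apply])
      (fun a b c => by rw [Pi.single_smul, map_smul, smul_apply])
      (fun a b c => by rw [Pi.single_add, map_add])
      (fun a b c => by rw [Pi.single_smul, map_smul])
  have hL : ∀ k, rotateLin (N := N) R (unitVec i k) =
      Pi.single i (R (EuclideanSpace.single k 1)) := by
    intro k
    funext j
    rw [rotateLin_apply, unitVec]
    by_cases hj : j = i
    · subst hj
      simp
    · simp [hj]
  refine Eq.trans (Finset.sum_congr rfl fun k _ => ?_) ((sum_bilin_rotate B R).trans
    (Finset.sum_congr rfl fun k _ => ?_))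
  · rw [dirDeriv_comp_rotate h, dirDeriv_comp_rotate (dirDeriv_contDiff h _)]
    beta_reduce
    rw [dirDeriv_dirDeriv h, hL]
    rfl
  · rw [dirDeriv_dirDeriv h]
    rfl

lemma integral_comp_rotateConfig {N : ℕ} (y : Space) (R : Space ≃ₗᵢ[ℝ] Space) (f : Config N → ℂ) :
    ∫ x, f (rotateConfig y R x) = ∫ x, f x :=
  (measurePreserving_rotateConfig y R).integral_comp
    (rotateConfig y R).measurableEmbedding f

lemma IsWeakLaplacian.rotate {N : ℕ} {ψ l : L2 N} (h : IsWeakLaplacian ψ l) (y : Space)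
    (R : Space ≃ₗᵢ[ℝ] Space) : IsWeakLaplacian (rotate y R ψ) (rotate y R l) := by
  have key : ∀ (f : Config N → ℝ) (χ : L2 N),
      ∫ x, f x • (AtomDensity.rotate y R χ x : ℂ) = ∫ x, f (rotateConfig y R x) • (χ x : ℂ) := by
    intro f χ
    rw [← integral_comp_rotateConfig y R]
    refine integral_congr_ae ?_
    filter_upwards [(measurePreserving_rotateConfig y R).quasiMeasurePreserving.ae
      (rotate_ae y R χ)] with x hx
    rw [hx, rotateConfig_symm_apply]
  intro φ h1 h2
  have ht := IsTest.comp_rotate ⟨h1, h2⟩ y R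
  rw [key, key, ← h _ ht.smooth ht.compact]
  simp only [laplacian_comp_rotate h1]

lemma potential_rotateConfig {N : ℕ} (e Z : ℝ) (y : Space) (R : Space ≃ₗᵢ[ℝ] Space)
    (x : Config N) : potential e Z y (rotateConfig y R x) = potential e Z y x := by
  have h1 : ∀ i, ‖rotateConfig y R x i - y‖ = ‖x i - y‖ := fun i => by
    rw [rotateConfig_apply, rotatePoint, add_sub_cancel_left, R.norm_map]
  have h2 : ∀ i j, ‖rotateConfig y R x i - rotateConfig y R x j‖ = ‖x i - x j‖ := fun i j => by
    rw [rotateConfig_apply, rotateConfig_apply, rotatePoint, rotatePoint, add_sub_add_left_eq_sub,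
      ← map_sub, R.norm_map, sub_sub_sub_cancel_right]
  simp only [potential, h1, h2]

/-- The Hamiltonian commutes with rotations about the nucleus. -/
lemma rotate_mem_hamiltonianGraph {N : ℕ} {e Z : ℝ} {y : Space} (R : Space ≃ₗᵢ[ℝ] Space)
    {ψ g : L2 N} (h : (ψ, g) ∈ hamiltonianGraph N e Z y) :
    (rotate y R ψ, rotate y R g) ∈ hamiltonianGraph N e Z y := by
  obtain ⟨l, hl, hg⟩ := h
  refine ⟨rotate y R l, hl.rotate y R, ?_⟩
  filter_upwards [rotate_ae y R ψ, rotate_ae y R g, rotate_ae y R l,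
    (measurePreserving_rotateConfig y R.symm).quasiMeasurePreserving.ae hg] with x h1 h2 h3 h4
  rw [h1, h2, h3, h4, potential_rotateConfig]

lemma rotate_mem_groundSpace {N : ℕ} {e Z : ℝ} {y : Space} (R : Space ≃ₗᵢ[ℝ] Space) {Φ : L2 N}
    (h : Φ ∈ groundSpace (hamiltonian N e Z y)) :
    rotate y R Φ ∈ groundSpace (hamiltonian N e Z y) := by
  rw [mem_groundSpace_iff] at h ⊢
  rw [← map_smul]
  exact rotate_mem_hamiltonianGraph R h

/-! ### Rotations and symmetry types -/

lemma rotate_permRep {N : ℕ} (y : Space) (R : Space ≃ₗᵢ[ℝ] Space) (π : Equiv.Perm (Fin N))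
    (ψ : L2 N) : rotate y R (permRep N π ψ) = permRep N π (rotate y R ψ) := by
  have hp : ∀ χ : L2 N, ∀ᵐ x, (permRep N π χ x : ℂ) = χ (x ∘ π) := fun χ =>
    Lp.coeFn_compMeasurePreserving χ (measurePreserving_perm π)
  refine Lp.ext ?_
  filter_upwards [rotate_ae y R (permRep N π ψ), hp (rotate y R ψ),
    (measurePreserving_perm π).quasiMeasurePreserving.ae (rotate_ae y R ψ),
    (measurePreserving_rotateConfig y R.symm).quasiMeasurePreserving.ae (hp ψ)] with x h1 h2 h3 h4
  rw [h1, h2, h3, h4]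
  rfl

lemma rotate_mem_symmetrySubspace {N : ℕ} {V : Type*} [AddCommGroup V] [Module ℂ V]
    (α : Representation ℂ (Equiv.Perm (Fin N)) V) (y : Space) (R : Space ≃ₗᵢ[ℝ] Space) {ψ : L2 N}
    (h : ψ ∈ symmetrySubspace α) : rotate y R ψ ∈ symmetrySubspace α := by
  let S : L2 N →ₗ[ℂ] L2 N := (rotate (N := N) y R).toLinearMap
  have hS : ∀ π, S ∘ₗ permRep N π = permRep N π ∘ₗ S := fun π =>
    LinearMap.ext fun χ => rotate_permRep y R π χ
  let T : Representation.IntertwiningMap (permRep N) (permRep N) :=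
    { toLinearMap := S, isIntertwining' := hS }
  have hle : symmetrySubspace α ≤ (symmetrySubspace α).comap S := by
    refine iSup_le fun f => ?_
    rintro _ ⟨v, rfl⟩
    exact Submodule.mem_iSup_of_mem (T.comp f) ⟨v, rfl⟩
  exact hle h

lemma mem_groundSpaceOn_iff {N : ℕ} {e Z : ℝ} {y : Space} {K : Submodule ℂ (L2 N)} {Φ : L2 N} :
    Φ ∈ groundSpaceOn e Z y K ↔ Φ ∈ K ∧
      (Φ, (groundEnergy (restrict (hamiltonian N e Z y) K) : ℂ) • Φ) ∈
        hamiltonianGraph N e Z y := by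
  constructor
  · rintro ⟨ψ, ⟨h, h'⟩, rfl⟩
    refine ⟨ψ.2, hamiltonian_apply_iff.1 ⟨h.choose, ?_⟩⟩
    exact congrArg Subtype.val h'
  · rintro ⟨hK, hG⟩
    obtain ⟨h, h'⟩ := hamiltonian_apply_iff.2 hG
    refine ⟨⟨Φ, hK⟩, ⟨⟨h, ?_⟩, Subtype.ext h'⟩, rfl⟩
    rw [h']
    exact K.smul_mem _ hK

lemma rotate_mem_groundSpaceOn {N : ℕ} {e Z : ℝ} {y : Space} {V : Type*} [AddCommGroup V]
    [Module ℂ V] (α : Representation ℂ (Equiv.Perm (Fin N)) V) (R : Space ≃ₗᵢ[ℝ] Space) {Φ : L2 N}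
    (h : Φ ∈ groundSpaceOn e Z y (symmetrySubspace α)) :
    rotate y R Φ ∈ groundSpaceOn e Z y (symmetrySubspace α) := by
  rw [mem_groundSpaceOn_iff] at h ⊢
  refine ⟨rotate_mem_symmetrySubspace α y R h.1, ?_⟩
  rw [← map_smul]
  exact rotate_mem_hamiltonianGraph R h.2

/-! ### Without a symmetry restriction, the ground state is spherically symmetric -/

/-- The real part of a wave function. -/
def reVec {N : ℕ} (ψ : L2 N) : L2 N := ((re_memLp ψ).ofReal (K := ℂ)).toLp _

/-- The imaginary part of a wave function. -/
def imVec {N : ℕ} (ψ : L2 N) : L2 N := ((im_memLp ψ).ofReal (K := ℂ)).toLp _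

lemma reVec_ae {N : ℕ} (ψ : L2 N) : ∀ᵐ x, (reVec ψ x : ℂ) = ((ψ x).re : ℂ) :=
  ((re_memLp ψ).ofReal (K := ℂ)).coeFn_toLp

lemma imVec_ae {N : ℕ} (ψ : L2 N) : ∀ᵐ x, (imVec ψ x : ℂ) = ((ψ x).im : ℂ) :=
  ((im_memLp ψ).ofReal (K := ℂ)).coeFn_toLp

lemma reVec_add_I_smul_imVec {N : ℕ} (ψ : L2 N) : reVec ψ + Complex.I • imVec ψ = ψ := by
  refine Lp.ext ?_
  filter_upwards [Lp.coeFn_add (reVec ψ) (Complex.I • imVec ψ),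
    Lp.coeFn_smul Complex.I (imVec ψ), reVec_ae ψ, imVec_ae ψ] with x h1 h2 h3 h4
  rw [h1, Pi.add_apply, h2, Pi.smul_apply, h3, h4, smul_eq_mul, mul_comm, Complex.re_add_im]

lemma integral_smul_reVec {N : ℕ} {φ : Config N → ℝ} (h : IsTest φ) (ψ : L2 N) :
    ∫ x, φ x • (reVec ψ x : ℂ) = ((∫ x, φ x • (ψ x : ℂ)).re : ℂ) := by
  rw [re_integral_smul h]
  refine Eq.trans (integral_congr_ae ?_) (integral_ofReal (𝕜 := ℂ))
  filter_upwards [reVec_ae ψ] with x hx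
  rw [hx, Complex.real_smul, mul_comm]
  exact (Complex.ofReal_mul _ _).symm

lemma integral_smul_imVec {N : ℕ} {φ : Config N → ℝ} (h : IsTest φ) (ψ : L2 N) :
    ∫ x, φ x • (imVec ψ x : ℂ) = ((∫ x, φ x • (ψ x : ℂ)).im : ℂ) := by
  rw [im_integral_smul h]
  refine Eq.trans (integral_congr_ae ?_) (integral_ofReal (𝕜 := ℂ))
  filter_upwards [imVec_ae ψ] with x hx
  rw [hx, Complex.real_smul, mul_comm]
  exact (Complex.ofReal_mul _ _).symm

/-- The Hamiltonian is real: it commutes with taking real parts. -/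
lemma reVec_mem_hamiltonianGraph {N : ℕ} {e Z : ℝ} {y : Space} {ψ g : L2 N}
    (h : (ψ, g) ∈ hamiltonianGraph N e Z y) : (reVec ψ, reVec g) ∈ hamiltonianGraph N e Z y := by
  obtain ⟨l, hl, hg⟩ := h
  refine ⟨reVec l, fun φ h1 h2 => ?_, ?_⟩
  · have hφ : IsTest φ := ⟨h1, h2⟩
    exact (integral_smul_reVec hφ.laplacian ψ).trans
      ((congrArg (fun z : ℂ => (z.re : ℂ)) (hl φ h1 h2)).trans (integral_smul_reVec hφ l).symm)
  · filter_upwards [reVec_ae ψ, reVec_ae g, reVec_ae l, hg] with x h1 h2 h3 h4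
    change (g x : ℂ) = -(l x) + (potential e Z y x : ℂ) * ψ x at h4
    rw [h1, h2, h3, h4, Complex.add_re, Complex.neg_re, Complex.re_ofReal_mul]
    push_cast
    rfl

lemma imVec_mem_hamiltonianGraph {N : ℕ} {e Z : ℝ} {y : Space} {ψ g : L2 N}
    (h : (ψ, g) ∈ hamiltonianGraph N e Z y) : (imVec ψ, imVec g) ∈ hamiltonianGraph N e Z y := by
  obtain ⟨l, hl, hg⟩ := h
  refine ⟨imVec l, fun φ h1 h2 => ?_, ?_⟩
  · have hφ : IsTest φ := ⟨h1, h2⟩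
    exact (integral_smul_imVec hφ.laplacian ψ).trans
      ((congrArg (fun z : ℂ => (z.im : ℂ)) (hl φ h1 h2)).trans (integral_smul_imVec hφ l).symm)
  · filter_upwards [imVec_ae ψ, imVec_ae g, imVec_ae l, hg] with x h1 h2 h3 h4
    change (g x : ℂ) = -(l x) + (potential e Z y x : ℂ) * ψ x at h4
    rw [h1, h2, h3, h4, Complex.add_im, Complex.neg_im, Complex.im_ofReal_mul]
    push_cast
    rfl

lemma reVec_real_smul {N : ℕ} (E : ℝ) (ψ : L2 N) : reVec ((E : ℂ) • ψ) = (E : ℂ) • reVec ψ := by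
  refine Lp.ext ?_
  filter_upwards [reVec_ae ((E : ℂ) • ψ), Lp.coeFn_smul (E : ℂ) ψ, Lp.coeFn_smul (E : ℂ) (reVec ψ),
    reVec_ae ψ] with x h1 h2 h3 h4
  rw [h1, h2, h3, Pi.smul_apply, Pi.smul_apply, h4, smul_eq_mul, smul_eq_mul,
    Complex.re_ofReal_mul, Complex.ofReal_mul]

lemma imVec_real_smul {N : ℕ} (E : ℝ) (ψ : L2 N) : imVec ((E : ℂ) • ψ) = (E : ℂ) • imVec ψ := by
  refine Lp.ext ?_
  filter_upwards [imVec_ae ((E : ℂ) • ψ), Lp.coeFn_smul (E : ℂ) ψ, Lp.coeFn_smul (E : ℂ) (imVec ψ),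
    imVec_ae ψ] with x h1 h2 h3 h4
  rw [h1, h2, h3, Pi.smul_apply, Pi.smul_apply, h4, smul_eq_mul, smul_eq_mul,
    Complex.im_ofReal_mul, Complex.ofReal_mul]

lemma reVec_mem_groundSpace {N : ℕ} {e Z : ℝ} {y : Space} {Φ : L2 N}
    (h : Φ ∈ groundSpace (hamiltonian N e Z y)) : reVec Φ ∈ groundSpace (hamiltonian N e Z y) := by
  rw [mem_groundSpace_iff] at h ⊢
  rw [← reVec_real_smul]
  exact reVec_mem_hamiltonianGraph h

lemma imVec_mem_groundSpace {N : ℕ} {e Z : ℝ} {y : Space} {Φ : L2 N}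
    (h : Φ ∈ groundSpace (hamiltonian N e Z y)) : imVec Φ ∈ groundSpace (hamiltonian N e Z y) := by
  rw [mem_groundSpace_iff] at h ⊢
  rw [← imVec_real_smul]
  exact imVec_mem_hamiltonianGraph h

lemma isRealVec_reVec {N : ℕ} (ψ : L2 N) : IsRealVec (reVec ψ) := by
  filter_upwards [reVec_ae ψ] with x hx
  rw [hx, Complex.ofReal_im]

lemma isRealVec_imVec {N : ℕ} (ψ : L2 N) : IsRealVec (imVec ψ) := by
  filter_upwards [imVec_ae ψ] with x hx
  rw [hx, Complex.ofReal_im]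

lemma IsRealVec.rotate {N : ℕ} {ψ : L2 N} (h : IsRealVec ψ) (y : Space) (R : Space ≃ₗᵢ[ℝ] Space) :
    IsRealVec (rotate y R ψ) := by
  filter_upwards [rotate_ae y R ψ,
    (measurePreserving_rotateConfig y R.symm).quasiMeasurePreserving.ae h] with x h1 h2
  rw [h1, h2]

lemma IsRealVec.sub {N : ℕ} {ψ χ : L2 N} (h : IsRealVec ψ) (h' : IsRealVec χ) :
    IsRealVec (ψ - χ) := by
  filter_upwards [h, h', Lp.coeFn_sub ψ χ] with x h1 h2 h3
  rw [h3, Pi.sub_apply, Complex.sub_im, h1, h2, sub_zero]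

lemma IsNonneg.rotate {N : ℕ} {ψ : L2 N} (h : IsNonneg ψ) (y : Space) (R : Space ≃ₗᵢ[ℝ] Space) :
    IsNonneg (rotate y R ψ) := by
  filter_upwards [rotate_ae y R ψ,
    (measurePreserving_rotateConfig y R.symm).quasiMeasurePreserving.ae h] with x h1 h2
  rw [h1]
  exact h2

/-- Adding a nonnegative function to a nonnegative function increases the norm strictly, unless
the added function vanishes. -/
lemma IsNonneg.eq_of_norm_eq {N : ℕ} {u v : L2 N} (hu : IsNonneg u) (hv : IsNonneg (v - u))
    (h : ‖v‖ = ‖u‖) : v = u := by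
  have h1 := norm_add_sq (𝕜 := ℂ) u (v - u)
  rw [add_sub_cancel, h] at h1
  have h2 : 0 ≤ (inner ℂ u (v - u)).re := re_inner_nonneg hu hv
  rw [RCLike.re_eq_complex_re] at h1
  have h3 : ‖v - u‖ ^ 2 ≤ 0 := by linarith
  exact sub_eq_zero.1 (norm_eq_zero.1 (pow_eq_zero_iff two_ne_zero |>.1 (h3.antisymm (sq_nonneg _))))

lemma rotate_eq_self_of_mem_groundSpace {N : ℕ} {e Z : ℝ} {y : Space} (hZ : 0 < Z) {Φ : L2 N}
    (h : Φ ∈ groundSpace (hamiltonian N e Z y)) (R : Space ≃ₗᵢ[ℝ] Space) : rotate y R Φ = Φ := by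
  by_cases h0 : Φ = 0
  · rw [h0, map_zero]
  obtain ⟨c, r, κ, hs, hpos, hκ, hle, hK⟩ := exists_resolvent_of_groundState hZ h0 h
  have sign : ∀ u ∈ groundSpace (hamiltonian N e Z y), IsRealVec u → IsNonneg u ∨ IsNonneg (-u) :=
    fun u hu hr => isNonneg_or_neg_of_eigenvector hs hpos hκ hle hr (hK u hu)
  -- Both `u` and `rotate u - u` have a constant sign, while the norms of `u` and `rotate u` agree.
  have key : ∀ u ∈ groundSpace (hamiltonian N e Z y), IsRealVec u → IsNonneg u →
      rotate y R u = u := by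
    intro u hu hr hn
    have hd := Submodule.sub_mem _ (rotate_mem_groundSpace R hu) hu
    rcases sign _ hd ((hr.rotate y R).sub hr) with h1 | h1
    · exact hn.eq_of_norm_eq h1 (norm_rotate y R u)
    · rw [neg_sub] at h1
      exact ((hn.rotate y R).eq_of_norm_eq h1 (norm_rotate y R u).symm).symm
  have key' : ∀ u ∈ groundSpace (hamiltonian N e Z y), IsRealVec u → rotate y R u = u := by
    intro u hu hr
    rcases sign u hu hr with h1 | h1
    · exact key u hu hr h1
    · have := key (-u) (Submodule.neg_mem _ hu) hr.neg h1
      rwa [map_neg, neg_inj] at this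
  rw [← reVec_add_I_smul_imVec Φ, map_add, map_smul,
    key' _ (reVec_mem_groundSpace h) (isRealVec_reVec Φ),
    key' _ (imVec_mem_groundSpace h) (isRealVec_imVec Φ)]

/-! ### Tensor products of wave functions -/

/-- A configuration of `n + 1` electrons as the first electron together with the others. -/
def splitConfig (n : ℕ) : Config (n + 1) ≃ᵐ Space × Config n :=
  MeasurableEquiv.piFinSuccAbove (fun _ => Space) 0

lemma splitConfig_apply {n : ℕ} (x : Config (n + 1)) : splitConfig n x = (x 0, Fin.tail x) := by
  refine Prod.ext rfl (funext fun i => ?_)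
  change x (Fin.succAbove 0 i) = x i.succ
  rw [Fin.succAbove_zero]

lemma splitConfig_symm_apply {n : ℕ} (z : Space) (x : Config n) :
    (splitConfig n).symm (z, x) = (Fin.cons z x : Config (n + 1)) := by
  rw [MeasurableEquiv.symm_apply_eq, splitConfig_apply, Fin.cons_zero, Fin.tail_cons]

lemma measurePreserving_splitConfig (n : ℕ) : MeasurePreserving (splitConfig n) :=
  volume_preserving_piFinSuccAbove (fun _ : Fin (n + 1) => Space) 0

lemma quasiMeasurePreserving_zero (n : ℕ) :
    Measure.QuasiMeasurePreserving (fun x : Config (n + 1) => x 0) :=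
  Measure.quasiMeasurePreserving_fst.comp (measurePreserving_splitConfig n).quasiMeasurePreserving

lemma quasiMeasurePreserving_tail (n : ℕ) :
    Measure.QuasiMeasurePreserving (fun x : Config (n + 1) => (Fin.tail x : Config n)) := by
  have h := Measure.quasiMeasurePreserving_snd.comp
    (measurePreserving_splitConfig n).quasiMeasurePreserving
  have e : (Prod.snd ∘ splitConfig n) = fun x : Config (n + 1) => (Fin.tail x : Config n) :=
    funext fun x => by rw [Function.comp_apply, splitConfig_apply]
  rwa [e] at h

lemma integral_zero_mul_tail {n : ℕ} (f : Space → ℂ) (g : Config n → ℂ) :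
    ∫ x : Config (n + 1), f (x 0) * g (Fin.tail x) = (∫ z, f z) * ∫ x, g x := by
  rw [← integral_prod_mul f g]
  have h := (measurePreserving_splitConfig n).integral_comp
    (splitConfig n).measurableEmbedding (fun p : Space × Config n => f p.1 * g p.2)
  simp only [splitConfig_apply] at h
  exact h

lemma memLp_tensor {n : ℕ} (f : L2One) (g : L2 n) :
    MemLp (fun x : Config (n + 1) => (f (x 0) * g (Fin.tail x) : ℂ)) 2 volume := by
  have hm : AEStronglyMeasurable
      (fun x : Config (n + 1) => (f (x 0) * g (Fin.tail x) : ℂ)) volume :=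
    ((Lp.aestronglyMeasurable f).comp_quasiMeasurePreserving (quasiMeasurePreserving_zero n)).mul
      ((Lp.aestronglyMeasurable g).comp_quasiMeasurePreserving (quasiMeasurePreserving_tail n))
  rw [memLp_two_iff_integrable_sq_norm hm]
  have h := ((memLp_two_iff_integrable_sq_norm (Lp.aestronglyMeasurable f)).1 (Lp.memLp f)).mul_prod
    ((memLp_two_iff_integrable_sq_norm (Lp.aestronglyMeasurable g)).1 (Lp.memLp g))
  have h' := (measurePreserving_splitConfig n).integrable_comp_of_integrable h
  refine h'.congr (Eventually.of_forall fun x => ?_)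
  simp only [Function.comp_apply, splitConfig_apply, norm_mul, mul_pow]

/-- The tensor product `f ⊗ g` of a function of the first electron and a function of the others. -/
def tensorVec {n : ℕ} (f : L2One) (g : L2 n) : L2 (n + 1) := (memLp_tensor f g).toLp _

lemma tensorVec_ae {n : ℕ} (f : L2One) (g : L2 n) :
    ∀ᵐ x : Config (n + 1), (tensorVec f g x : ℂ) = f (x 0) * g (Fin.tail x) :=
  (memLp_tensor f g).coeFn_toLp

lemma inner_tensorVec {n : ℕ} (f f' : L2One) (g g' : L2 n) :
    inner ℂ (tensorVec f g) (tensorVec f' g') = inner ℂ f f' * inner ℂ g g' := by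
  rw [L2.inner_def, L2.inner_def, L2.inner_def, ← integral_zero_mul_tail]
  refine integral_congr_ae ?_
  filter_upwards [tensorVec_ae f g, tensorVec_ae f' g'] with x h1 h2
  rw [h1, h2]
  simp only [RCLike.inner_apply, map_mul]
  ring

lemma norm_tensorVec {n : ℕ} (f : L2One) (g : L2 n) : ‖tensorVec f g‖ = ‖f‖ * ‖g‖ := by
  have h := inner_tensorVec f f g g
  rw [inner_self_eq_norm_sq_to_K, inner_self_eq_norm_sq_to_K, inner_self_eq_norm_sq_to_K] at h
  have h' : ‖tensorVec f g‖ ^ 2 = (‖f‖ * ‖g‖) ^ 2 := by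
    rw [mul_pow]
    exact_mod_cast h
  exact (pow_left_inj₀ (norm_nonneg _) (by positivity) two_ne_zero).1 h'

lemma tensorVec_add_left {n : ℕ} (f f' : L2One) (g : L2 n) :
    tensorVec (f + f') g = tensorVec f g + tensorVec f' g := by
  refine Lp.ext ?_
  filter_upwards [tensorVec_ae (f + f') g, tensorVec_ae f g, tensorVec_ae f' g,
    Lp.coeFn_add (tensorVec f g) (tensorVec f' g),
    (quasiMeasurePreserving_zero n).ae (Lp.coeFn_add f f')] with x h1 h2 h3 h4 h5
  rw [h1, h4, h5, Pi.add_apply, Pi.add_apply, h2, h3, add_mul]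

lemma tensorVec_smul_left {n : ℕ} (c : ℂ) (f : L2One) (g : L2 n) :
    tensorVec (c • f) g = c • tensorVec f g := by
  refine Lp.ext ?_
  filter_upwards [tensorVec_ae (c • f) g, tensorVec_ae f g, Lp.coeFn_smul c (tensorVec f g),
    (quasiMeasurePreserving_zero n).ae (Lp.coeFn_smul c f)] with x h1 h2 h3 h4
  rw [h1, h3, h4, Pi.smul_apply, Pi.smul_apply, h2, smul_eq_mul, smul_eq_mul, mul_assoc]

lemma tensorVec_add_right {n : ℕ} (f : L2One) (g g' : L2 n) :
    tensorVec f (g + g') = tensorVec f g + tensorVec f g' := by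
  refine Lp.ext ?_
  filter_upwards [tensorVec_ae f (g + g'), tensorVec_ae f g, tensorVec_ae f g',
    Lp.coeFn_add (tensorVec f g) (tensorVec f g'),
    (quasiMeasurePreserving_tail n).ae (Lp.coeFn_add g g')] with x h1 h2 h3 h4 h5
  rw [h1, h4, h5, Pi.add_apply, Pi.add_apply, h2, h3, mul_add]

lemma tensorVec_smul_right {n : ℕ} (c : ℂ) (f : L2One) (g : L2 n) :
    tensorVec f (c • g) = c • tensorVec f g := by
  refine Lp.ext ?_
  filter_upwards [tensorVec_ae f (c • g), tensorVec_ae f g, Lp.coeFn_smul c (tensorVec f g),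
    (quasiMeasurePreserving_tail n).ae (Lp.coeFn_smul c g)] with x h1 h2 h3 h4
  rw [h1, h3, h4, Pi.smul_apply, Pi.smul_apply, h2, smul_eq_mul, smul_eq_mul, mul_left_comm]

/-- The tensor product as a bounded bilinear map. -/
def tensor (n : ℕ) : L2One →L[ℂ] L2 n →L[ℂ] L2 (n + 1) :=
  (LinearMap.mk₂ ℂ (tensorVec (n := n)) tensorVec_add_left tensorVec_smul_left
    tensorVec_add_right tensorVec_smul_right).mkContinuous₂ 1
    fun f g => by rw [one_mul]; exact (norm_tensorVec f g).le

variable {n : ℕ}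

lemma isTensor_tensor (f : L2One) (g : L2 n) : IsTensor f g (tensor n f g) := tensorVec_ae f g

lemma isTensor_iff {f : L2One} {g : L2 n} {F : L2 (n + 1)} :
    IsTensor f g F ↔ F = tensor n f g := by
  constructor
  · intro h
    refine Lp.ext ?_
    filter_upwards [h, isTensor_tensor f g] with x h1 h2
    rw [h1, h2]
  · rintro rfl
    exact isTensor_tensor f g

lemma isOneElectronLift_iff {b : L2One →L[ℂ] L2One} {B : L2 (n + 1) →L[ℂ] L2 (n + 1)} :
    IsOneElectronLift b B ↔ ∀ f g, B (tensor n f g) = tensor n (b f) g := by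
  simp only [IsOneElectronLift, isTensor_iff, forall_eq]

lemma inner_tensor (f f' : L2One) (g g' : L2 n) :
    inner ℂ (tensor n f g) (tensor n f' g') = inner ℂ f f' * inner ℂ g g' :=
  inner_tensorVec f f' g g'

lemma rotate_tensor (y : Space) (R : Space ≃ₗᵢ[ℝ] Space) (f : L2One) (g : L2 n) :
    rotate y R (tensor n f g) = tensor n (rotateOne y R f) (rotate y R g) := by
  refine isTensor_iff.1 ?_
  filter_upwards [rotate_ae y R (tensor n f g),
    (measurePreserving_rotateConfig y R.symm).quasiMeasurePreserving.ae (isTensor_tensor f g),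
    (quasiMeasurePreserving_zero n).ae (rotateOne_ae y R f),
    (quasiMeasurePreserving_tail n).ae (rotate_ae y R g)] with x h1 h2 h3 h4
  rw [h1, h2, h3, h4]
  rfl

/-- Tensor products span a dense subspace: closed balls of the sup norm on `Config (n + 1)` are
product sets, so that a function orthogonal to all tensor products has mean zero on every ball. -/
lemma eq_zero_of_inner_tensor {H : L2 (n + 1)} (h : ∀ f g, inner ℂ (tensor n f g) H = 0) :
    H = 0 := by
  have hball : ∀ (c : Config (n + 1)) (r : ℝ), 0 ≤ r →
      ∫ x in Metric.closedBall c r, (H x : ℂ) = 0 := by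
    intro c r hr
    let f : L2One := indicatorConstLp 2 (measurableSet_closedBall (x := c 0) (ε := r))
      measure_closedBall_lt_top.ne (1 : ℂ)
    let g : L2 n := indicatorConstLp 2 (measurableSet_closedBall (x := (Fin.tail c : Config n))
      (ε := r)) measure_closedBall_lt_top.ne (1 : ℂ)
    have hf : ∀ᵐ z, (f z : ℂ) = (Metric.closedBall (c 0) r).indicator (fun _ => 1) z :=
      indicatorConstLp_coeFn
    have hg : ∀ᵐ x, (g x : ℂ) =
        (Metric.closedBall (Fin.tail c : Config n) r).indicator (fun _ => 1) x :=
      indicatorConstLp_coeFn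
    rw [← h f g, L2.inner_def, ← integral_indicator measurableSet_closedBall]
    refine integral_congr_ae ?_
    filter_upwards [isTensor_tensor f g, (quasiMeasurePreserving_zero n).ae hf,
      (quasiMeasurePreserving_tail n).ae hg] with x h1 h2 h3
    rw [h1, h2, h3]
    have hmem : x ∈ Metric.closedBall c r ↔ x 0 ∈ Metric.closedBall (c 0) r ∧
        (Fin.tail x : Config n) ∈ Metric.closedBall (Fin.tail c : Config n) r := by
      simp only [Metric.mem_closedBall, dist_pi_le_iff hr]
      rw [Fin.forall_fin_succ]
      rfl
    by_cases hx0 : x 0 ∈ Metric.closedBall (c 0) r <;>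
      by_cases hx1 : (Fin.tail x : Config n) ∈ Metric.closedBall (Fin.tail c : Config n) r <;>
      simp [Set.indicator, hmem, hx0, hx1]
  have hloc : LocallyIntegrable (fun x => (H x : ℂ)) :=
    (Lp.memLp H).locallyIntegrable (by norm_num)
  refine (Lp.eq_zero_iff_ae_eq_zero).2 ?_
  filter_upwards [IsUnifLocDoublingMeasure.ae_tendsto_average volume hloc 1] with x hx
  have h1 := hx (fun _ : ℝ => x) (fun r => r) (l := 𝓝[>] (0 : ℝ)) tendsto_id (by
    filter_upwards [self_mem_nhdsWithin] with r hr
    exact Metric.mem_closedBall_self (by simpa using le_of_lt hr))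
  have h2 : ∀ᶠ r in 𝓝[>] (0 : ℝ), (⨍ y in Metric.closedBall x r, (H y : ℂ)) = 0 := by
    filter_upwards [self_mem_nhdsWithin] with r hr
    rw [average_eq, hball x r (le_of_lt hr), smul_zero]
  exact tendsto_nhds_unique (h1.congr' h2) tendsto_const_nhds |>.trans rfl

lemma ext_inner_tensor {F H : L2 (n + 1)}
    (h : ∀ f g, inner ℂ (tensor n f g) F = inner ℂ (tensor n f g) H) : F = H :=
  sub_eq_zero.1 <| eq_zero_of_inner_tensor fun f g => by rw [inner_sub_right, h, sub_self]

/-- The partial inner product of `Ψ` with a function `f` of the first electron, the adjoint of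
`g ↦ f ⊗ g`. -/
def slice (f : L2One) (Ψ : L2 (n + 1)) : L2 n := ContinuousLinearMap.adjoint (tensor n f) Ψ

lemma inner_slice_right (f : L2One) (g : L2 n) (Ψ : L2 (n + 1)) :
    inner ℂ g (slice f Ψ) = inner ℂ (tensor n f g) Ψ :=
  ContinuousLinearMap.adjoint_inner_right _ _ _

lemma inner_slice_left (f : L2One) (g : L2 n) (Ψ : L2 (n + 1)) :
    inner ℂ (slice f Ψ) g = inner ℂ Ψ (tensor n f g) :=
  ContinuousLinearMap.adjoint_inner_left _ _ _

lemma slice_tensor (f f' : L2One) (g : L2 n) : slice f (tensor n f' g) = inner ℂ f f' • g := by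
  refine ext_inner_left ℂ fun h => ?_
  rw [inner_slice_right, inner_tensor, inner_smul_right]

lemma slice_add_left (f f' : L2One) (Ψ : L2 (n + 1)) :
    slice (f + f') Ψ = slice f Ψ + slice f' Ψ := by
  rw [slice, map_add, map_add]
  rfl

lemma slice_smul_left (c : ℂ) (f : L2One) (Ψ : L2 (n + 1)) :
    slice (c • f) Ψ = (starRingEnd ℂ) c • slice f Ψ := by
  rw [slice, map_smul, map_smulₛₗ]
  rfl

lemma norm_slice_le (f : L2One) (Ψ : L2 (n + 1)) : ‖slice f Ψ‖ ≤ ‖f‖ * ‖Ψ‖ := by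
  refine (ContinuousLinearMap.le_opNorm _ _).trans ?_
  rw [LinearIsometryEquiv.norm_map]
  refine mul_le_mul_of_nonneg_right ?_ (norm_nonneg _)
  exact (tensor n f).opNorm_le_bound (norm_nonneg _) fun g => (norm_tensorVec f g).le

/-- The vectors `e_k ⊗ d_j` form an orthonormal basis. -/
lemma orthonormal_tensor {ι κ : Type*} (b : HilbertBasis ι ℂ L2One) (d : HilbertBasis κ ℂ (L2 n)) :
    Orthonormal ℂ (fun p : ι × κ => tensor n (b p.1) (d p.2)) := by
  classical
  rw [orthonormal_iff_ite]
  rintro ⟨k, j⟩ ⟨k', j'⟩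
  rw [inner_tensor, orthonormal_iff_ite.1 b.orthonormal, orthonormal_iff_ite.1 d.orthonormal]
  by_cases h1 : k = k' <;> by_cases h2 : j = j' <;> simp [h1, h2]

lemma eq_zero_of_inner_basis {X ι : Type*} [NormedAddCommGroup X] [InnerProductSpace ℂ X]
    (b : HilbertBasis ι ℂ X) {v : X} (h : ∀ k, inner ℂ (b k) v = 0) : v = 0 :=
  b.repr.map_eq_zero_iff.1 <| lp.ext <| funext fun k => by
    rw [b.repr_apply_apply, h]; rfl

/-- The partial inner products with an orthonormal basis determine the inner product. -/
lemma hasSum_inner_slice {ι : Type*} (b : HilbertBasis ι ℂ L2One) (Ψ Ψ' : L2 (n + 1)) :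
    HasSum (fun k => inner ℂ (slice (b k) Ψ) (slice (b k) Ψ')) (inner ℂ Ψ Ψ') := by
  obtain ⟨w, d, -⟩ := exists_hilbertBasis ℂ (L2 n)
  have hbot : (Submodule.span ℂ
      (Set.range fun p : ι × w => tensor n (b p.1) (d p.2)))ᗮ = ⊥ := by
    refine (Submodule.eq_bot_iff _).2 fun H hH => eq_zero_of_inner_tensor fun f g => ?_
    have h0 : ∀ k j, inner ℂ (tensor n (b k) (d j)) H = 0 := fun k j =>
      (Submodule.mem_orthogonal _ _).1 hH _ (Submodule.subset_span ⟨(k, j), rfl⟩)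
    have h1 : ∀ k, slice (b k) H = 0 := fun k =>
      eq_zero_of_inner_basis d fun j => by rw [inner_slice_right, h0]
    have h2 : ContinuousLinearMap.adjoint ((tensor n).flip g) H = 0 :=
      eq_zero_of_inner_basis b fun k => by
        rw [ContinuousLinearMap.adjoint_inner_right, ContinuousLinearMap.flip_apply,
          ← inner_slice_right, h1, inner_zero_right]
    rw [← ContinuousLinearMap.flip_apply, ← ContinuousLinearMap.adjoint_inner_right, h2,
      inner_zero_right]
  -- Parseval's identity for the basis `b k ⊗ d j`, summed over `j` first.
  have h := (HilbertBasis.mkOfOrthogonalEqBot (orthonormal_tensor b d) hbot).hasSum_inner_mul_inner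
    Ψ Ψ'
  rw [HilbertBasis.coe_mkOfOrthogonalEqBot] at h
  refine h.prod_fiberwise fun k => ?_
  have h' := d.hasSum_inner_mul_inner (slice (b k) Ψ) (slice (b k) Ψ')
  simpa only [inner_slice_left, inner_slice_right] using h'

/-- The adjoint of `b ⊗ 1` is `b† ⊗ 1`. -/
lemma slice_adjoint_of_lift {b : L2One →L[ℂ] L2One} {B : L2 (n + 1) →L[ℂ] L2 (n + 1)}
    (h : IsOneElectronLift b B) (f : L2One) (Ψ : L2 (n + 1)) :
    slice (ContinuousLinearMap.adjoint b f) Ψ = slice f (B Ψ) := by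
  have hB : ∀ g, ContinuousLinearMap.adjoint B (tensor n f g) =
      tensor n (ContinuousLinearMap.adjoint b f) g := by
    intro g
    refine ext_inner_tensor fun f' g' => ?_
    rw [ContinuousLinearMap.adjoint_inner_right, isOneElectronLift_iff.1 h, inner_tensor,
      inner_tensor, ContinuousLinearMap.adjoint_inner_right]
  refine ext_inner_left ℂ fun g => ?_
  rw [inner_slice_right, inner_slice_right, ← hB, ContinuousLinearMap.adjoint_inner_left]


/-! ### The one-electron density operator -/


/-- The partial inner product of `Ψ` with a function `h` of all electrons but the first, the
adjoint of `f ↦ f ⊗ h`. -/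
def coslice (h : L2 n) (Ψ : L2 (n + 1)) : L2One :=
  ContinuousLinearMap.adjoint ((tensor n).flip h) Ψ

lemma inner_coslice_right (f : L2One) (h : L2 n) (Ψ : L2 (n + 1)) :
    inner ℂ f (coslice h Ψ) = inner ℂ (tensor n f h) Ψ :=
  ContinuousLinearMap.adjoint_inner_right _ _ _

lemma norm_coslice_le (h : L2 n) (Ψ : L2 (n + 1)) : ‖coslice h Ψ‖ ≤ ‖h‖ * ‖Ψ‖ := by
  refine (ContinuousLinearMap.le_opNorm (ContinuousLinearMap.adjoint ((tensor n).flip h)) Ψ).trans ?_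
  rw [LinearIsometryEquiv.norm_map]
  refine mul_le_mul_of_nonneg_right ?_ (norm_nonneg _)
  exact ((tensor n).flip h).opNorm_le_bound (norm_nonneg _) fun f =>
    (norm_tensorVec f h).le.trans_eq (mul_comm _ _)

lemma inner_coslice_slice (Ψ : L2 (n + 1)) (f g : L2One) :
    inner ℂ f (coslice (slice g Ψ) Ψ) = inner ℂ (slice g Ψ) (slice f Ψ) := by
  rw [inner_slice_right, inner_coslice_right]

/-- The one-electron density operator of a single wave function `Ψ`, given by
`⟨f, ρ g⟩ = ⟨Ψ_g, Ψ_f⟩` with `Ψ_f` the partial inner product of `Ψ` with `f`. -/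
def densityOpLin (Ψ : L2 (n + 1)) : L2One →ₗ[ℂ] L2One where
  toFun g := coslice (slice g Ψ) Ψ
  map_add' g g' := by
    refine ext_inner_left ℂ fun f => ?_
    rw [inner_coslice_slice, inner_add_right, inner_coslice_slice, inner_coslice_slice,
      slice_add_left, inner_add_left]
  map_smul' c g := by
    refine ext_inner_left ℂ fun f => ?_
    rw [inner_coslice_slice, RingHom.id_apply, inner_smul_right, inner_coslice_slice,
      slice_smul_left, inner_smul_left, Complex.conj_conj]

/-- The one-electron density operator of a single wave function as a bounded operator. -/
def densityOp (Ψ : L2 (n + 1)) : L2One →L[ℂ] L2One :=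
  (densityOpLin Ψ).mkContinuous (‖Ψ‖ * ‖Ψ‖) fun g => by
    refine (norm_coslice_le _ _).trans ((mul_le_mul_of_nonneg_right (norm_slice_le g Ψ)
      (norm_nonneg _)).trans_eq ?_)
    ring

lemma inner_densityOp (Ψ : L2 (n + 1)) (f g : L2One) :
    inner ℂ f (densityOp Ψ g) = inner ℂ (slice g Ψ) (slice f Ψ) :=
  inner_coslice_slice Ψ f g

lemma hasTrace_densityOp {b : L2One →L[ℂ] L2One} {B : L2 (n + 1) →L[ℂ] L2 (n + 1)}
    (h : IsOneElectronLift b B) (Ψ : L2 (n + 1)) :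
    HasTrace (b ∘L densityOp Ψ) (inner ℂ Ψ (B Ψ)) := by
  intro ι e
  have h1 := hasSum_inner_slice e Ψ (B Ψ)
  have h2 : ∀ k, inner ℂ (slice (e k) Ψ) (slice (e k) (B Ψ)) =
      inner ℂ (e k) ((b ∘L densityOp Ψ) (e k)) := fun k => by
    rw [← slice_adjoint_of_lift h, ← inner_densityOp, ContinuousLinearMap.adjoint_inner_left]
    rfl
  simpa only [h2] using h1

lemma hasSum_of_eq {ι : Type*} {f g : ι → ℂ} {t : ℂ} (h : HasSum g t) (e : ∀ k, f k = g k) :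
    HasSum f t := by
  rwa [funext e]

lemma HasTrace.unique {X : Type} [NormedAddCommGroup X] [InnerProductSpace ℂ X] [CompleteSpace X]
    {A : X →L[ℂ] X} {s t : ℂ} (hs : HasTrace A s) (ht : HasTrace A t) : s = t := by
  obtain ⟨w, b, -⟩ := exists_hilbertBasis ℂ X
  exact (hs w b).unique (ht w b)

/-- The trace is invariant under conjugation with a unitary operator. -/
lemma HasTrace.conj {X : Type} [NormedAddCommGroup X] [InnerProductSpace ℂ X]
    {A : X →L[ℂ] X} {t : ℂ} (h : HasTrace A t) (U : X ≃ₗᵢ[ℂ] X) {A' : X →L[ℂ] X}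
    (hA : ∀ x, A' x = U (A (U.symm x))) : HasTrace A' t := by
  intro ι b
  have hb := h ι (HilbertBasis.ofRepr (U.trans b.repr))
  have hk : ∀ k, (HilbertBasis.ofRepr (U.trans b.repr) : HilbertBasis ι ℂ X) k = U.symm (b k) :=
    fun k => rfl
  refine hasSum_of_eq hb fun k => ?_
  rw [hk, hA, ← U.inner_map_map (U.symm (b k)), U.apply_symm_apply]

/-- The operator `|u⟩⟨v|`. -/
def rankOne (u v : L2One) : L2One →L[ℂ] L2One := (innerSL ℂ v).smulRight u

lemma rankOne_apply (u v f : L2One) : rankOne u v f = inner ℂ v f • u := rfl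

/-- The operator `|u⟩⟨v| ⊗ 1`. -/
def rankOneLift (n : ℕ) (u v : L2One) : L2 (n + 1) →L[ℂ] L2 (n + 1) :=
  tensor n u ∘L ContinuousLinearMap.adjoint (tensor n v)

lemma rankOneLift_apply (u v : L2One) (Ψ : L2 (n + 1)) :
    rankOneLift n u v Ψ = tensor n u (slice v Ψ) := rfl

lemma isOneElectronLift_rankOne (u v : L2One) :
    IsOneElectronLift (rankOne u v) (rankOneLift n u v) := by
  rw [isOneElectronLift_iff]
  intro f g
  rw [rankOneLift_apply, slice_tensor, rankOne_apply, map_smul, map_smul, smul_apply]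

lemma hasTrace_rankOne_comp (u v : L2One) (ρ : L2One →L[ℂ] L2One) :
    HasTrace (rankOne u v ∘L ρ) (inner ℂ v (ρ u)) := by
  intro ι b
  have h := b.hasSum_inner_mul_inner (ContinuousLinearMap.adjoint ρ v) u
  rw [ContinuousLinearMap.adjoint_inner_left] at h
  refine hasSum_of_eq h fun k => ?_
  rw [ContinuousLinearMap.comp_apply, rankOne_apply, inner_smul_right,
    ContinuousLinearMap.adjoint_inner_left]

/-- The matrix elements of a one-electron density are traces of `P` against rank one lifts. -/
lemma IsOneElectronDensity.hasTrace_rankOneLift {P : L2 (n + 1) →L[ℂ] L2 (n + 1)}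
    {ρ : L2One →L[ℂ] L2One} (h : IsOneElectronDensity P ρ) (u v : L2One) :
    HasTrace (rankOneLift n u v ∘L P) (inner ℂ v (ρ u)) := by
  obtain ⟨t, h1, h2⟩ := h _ _ (isOneElectronLift_rankOne u v)
  rwa [← h2.unique (hasTrace_rankOne_comp u v ρ)]

lemma IsOneElectronDensity.unique {P : L2 (n + 1) →L[ℂ] L2 (n + 1)} {ρ ρ' : L2One →L[ℂ] L2One}
    (h : IsOneElectronDensity P ρ) (h' : IsOneElectronDensity P ρ') : ρ = ρ' :=
  ContinuousLinearMap.ext fun u => ext_inner_left ℂ fun v =>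
    (h.hasTrace_rankOneLift u v).unique (h'.hasTrace_rankOneLift u v)

lemma isOneElectronDensity_starProjection (G : Submodule ℂ (L2 (n + 1))) [FiniteDimensional ℂ G] :
    IsOneElectronDensity G.starProjection
      (∑ i, densityOp (stdOrthonormalBasis ℂ G i : L2 (n + 1))) := by
  intro b B hB
  refine ⟨∑ i, inner ℂ (stdOrthonormalBasis ℂ G i : L2 (n + 1))
    (B (stdOrthonormalBasis ℂ G i)), fun ι e => ?_, fun ι e => ?_⟩
  · have h : ∀ i, HasSum (fun k => inner ℂ (stdOrthonormalBasis ℂ G i : L2 (n + 1)) (e k) *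
        inner ℂ (e k) (B (stdOrthonormalBasis ℂ G i))) _ := fun i =>
      e.hasSum_inner_mul_inner _ _
    refine hasSum_of_eq (hasSum_sum fun i (_ : i ∈ Finset.univ) => h i) fun k => ?_
    have hP : G.starProjection (e k) =
        ∑ i, inner ℂ (stdOrthonormalBasis ℂ G i : L2 (n + 1)) (e k) •
          (stdOrthonormalBasis ℂ G i : L2 (n + 1)) := by
      rw [(stdOrthonormalBasis ℂ G).starProjection_eq_sum_rankOne, sum_apply]
      rfl
    rw [ContinuousLinearMap.comp_apply, hP, map_sum, inner_sum]
    exact Finset.sum_congr rfl fun i _ => by rw [map_smul, inner_smul_right]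
  · have h : ∀ i, HasSum _ _ := fun i => hasTrace_densityOp hB (stdOrthonormalBasis ℂ G i : L2 (n + 1)) ι e
    refine hasSum_of_eq (hasSum_sum fun i (_ : i ∈ Finset.univ) => h i) fun k => ?_
    simp only [ContinuousLinearMap.comp_apply, sum_apply, map_sum, inner_sum]

/-! ### Rotations and the one-electron density -/

/-- A rotation as a unitary operator. -/
def rotateEquiv (n : ℕ) (y : Space) (R : Space ≃ₗᵢ[ℝ] Space) : L2 n ≃ₗᵢ[ℂ] L2 n where
  toFun := rotate y R
  map_add' := map_add _
  map_smul' := map_smul _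
  invFun := rotate y R.symm
  left_inv ψ := by simpa using rotate_rotate_symm y R.symm ψ
  right_inv := rotate_rotate_symm y R
  norm_map' := norm_rotate y R

lemma rotateEquiv_apply (y : Space) (R : Space ≃ₗᵢ[ℝ] Space) (ψ : L2 n) :
    rotateEquiv n y R ψ = rotate y R ψ := rfl

lemma rotateEquiv_symm_apply (y : Space) (R : Space ≃ₗᵢ[ℝ] Space) (ψ : L2 n) :
    (rotateEquiv n y R).symm ψ = rotate y R.symm ψ := rfl

lemma inner_rotate_left (y : Space) (R : Space ≃ₗᵢ[ℝ] Space) (ψ χ : L2 n) :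
    inner ℂ (rotate y R ψ) χ = inner ℂ ψ (rotate y R.symm χ) := by
  rw [← inner_rotate y R ψ, rotate_rotate_symm]

lemma slice_rotateOne (y : Space) (R : Space ≃ₗᵢ[ℝ] Space) (f : L2One) (Ψ : L2 (n + 1)) :
    slice (rotateOne y R f) Ψ = rotate y R (slice f (rotate y R.symm Ψ)) := by
  refine ext_inner_left ℂ fun g => ?_
  rw [inner_slice_right, ← rotate_rotate_symm y R g, ← rotate_tensor, inner_rotate_left,
    inner_rotate, inner_slice_right]

/-- The orthogonal projection onto a rotation invariant subspace commutes with rotations. -/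
lemma IsOrthogonalProjectionOnto.comm_rotate {G : Submodule ℂ (L2 n)} {P : L2 n →L[ℂ] L2 n}
    (hP : IsOrthogonalProjectionOnto P G) {y : Space}
    (hG : ∀ R : Space ≃ₗᵢ[ℝ] Space, ∀ Φ ∈ G, rotate y R Φ ∈ G) (R : Space ≃ₗᵢ[ℝ] Space)
    (ψ : L2 n) : P (rotate y R ψ) = rotate y R (P ψ) := by
  have hsa : ∀ a b, inner ℂ (P a) b = inner ℂ a (P b) := hP.1.isSelfAdjoint.isSymmetric
  have hmem : ∀ a, P a ∈ G := fun a => hP.2 ▸ ⟨a, rfl⟩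
  have hid : ∀ a ∈ G, P a = a := by
    intro a ha
    rw [← hP.2] at ha
    obtain ⟨c, rfl⟩ := ha
    exact congrArg (fun L : L2 n →L[ℂ] L2 n => L c) hP.1.isIdempotentElem
  refine ext_inner_left ℂ fun χ => ?_
  rw [← hsa, ← inner_rotate y R.symm, ← inner_rotate y R.symm χ]
  have e : ∀ a : L2 n, rotate y R.symm (rotate y R a) = a := fun a => by
    simpa using rotate_rotate_symm y R.symm a
  rw [e, e, ← hid _ (hG R.symm _ (hmem χ)), hsa, ← sub_eq_zero, ← inner_sub_left]
  have h0 : ∀ a ∈ G, inner ℂ (rotate y R.symm (P χ) - rotate y R.symm χ) a = 0 := by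
    intro a ha
    rw [← map_sub, inner_rotate_left, LinearIsometryEquiv.symm_symm, ← hid _ (hG R a ha), ← hsa,
      map_sub, hid _ (hmem χ), sub_self, inner_zero_left]
  exact h0 _ (hmem ψ)

/-- A density operator of a rotation invariant projection is rotation invariant. -/
lemma IsOneElectronDensity.comm_rotateOne {P : L2 (n + 1) →L[ℂ] L2 (n + 1)}
    {ρ : L2One →L[ℂ] L2One} (h : IsOneElectronDensity P ρ) {y : Space}
    (hP : ∀ (R : Space ≃ₗᵢ[ℝ] Space) ψ, P (rotate y R ψ) = rotate y R (P ψ))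
    (R : Space ≃ₗᵢ[ℝ] Space) : rotateOne y R ∘L ρ = ρ ∘L rotateOne y R := by
  refine ContinuousLinearMap.ext fun u => ext_inner_left ℂ fun v => ?_
  obtain ⟨w, rfl⟩ : ∃ w, rotateOne y R w = v := ⟨_, rotateOne_rotateOne_symm y R v⟩
  rw [ContinuousLinearMap.comp_apply, ContinuousLinearMap.comp_apply, inner_rotateOne]
  have hconj : ∀ Ψ, (rankOneLift n (rotateOne y R u) (rotateOne y R w) ∘L P) Ψ =
      rotateEquiv (n + 1) y R
        ((rankOneLift n u w ∘L P) ((rotateEquiv (n + 1) y R).symm Ψ)) := fun Ψ => by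
    rw [ContinuousLinearMap.comp_apply, ContinuousLinearMap.comp_apply, rotateEquiv_apply,
      rotateEquiv_symm_apply, rankOneLift_apply, rankOneLift_apply, slice_rotateOne, hP,
      rotate_tensor]
  exact ((h.hasTrace_rankOneLift u w).conj _ hconj).unique (h.hasTrace_rankOneLift _ _)

/-! ### Rotations and the density function -/

/-- The sum `∑ᵢ |Ψᵢ|²` does not depend on the orthonormal basis: the scalar product of the vector
`∑ⱼ conj (Ψⱼ x) Ψⱼ` with `Ψᵢ` is `Ψᵢ x`, for both bases. -/
lemma sum_enorm_sq_orthonormalBasis {ι : Type} [Fintype ι] {G : Submodule ℂ (L2 n)}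
    (Ψ Ψ' : OrthonormalBasis ι ℂ G) :
    ∀ᵐ x, ∑ i, ‖((Ψ' i : L2 n) x : ℂ)‖ₑ ^ 2 = ∑ i, ‖((Ψ i : L2 n) x : ℂ)‖ₑ ^ 2 := by
  have hexp : ∀ i, ∀ᵐ x, ((Ψ' i : L2 n) x : ℂ) =
      ∑ j, inner ℂ (Ψ j) (Ψ' i) * ((Ψ j : L2 n) x : ℂ) := by
    intro i
    have h1 : (Ψ' i : L2 n) = ∑ j, inner ℂ (Ψ j) (Ψ' i) • (Ψ j : L2 n) := by
      conv_lhs => rw [← Ψ.sum_repr' (Ψ' i)]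
      simp only [Submodule.coe_sum, Submodule.coe_smul]
    have h2 : ∀ᵐ x, ∀ j, ((inner ℂ (Ψ j) (Ψ' i) • (Ψ j : L2 n) : L2 n) x : ℂ) =
        inner ℂ (Ψ j) (Ψ' i) * ((Ψ j : L2 n) x : ℂ) :=
      ae_all_iff.2 fun j => Lp.coeFn_smul _ _
    have h3 : ∀ᵐ x, ((∑ j, inner ℂ (Ψ j) (Ψ' i) • (Ψ j : L2 n) : L2 n) x : ℂ) =
        ∑ j, ((inner ℂ (Ψ j) (Ψ' i) • (Ψ j : L2 n) : L2 n) x : ℂ) := by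
      filter_upwards [Lp.coeFn_finsetSum Finset.univ
        fun j => inner ℂ (Ψ j) (Ψ' i) • (Ψ j : L2 n)] with x hx
      rw [hx, Finset.sum_apply]
    filter_upwards [h2, h3] with x hx2 hx3
    rw [h1, hx3]
    exact Finset.sum_congr rfl fun j _ => hx2 j
  filter_upwards [ae_all_iff.2 hexp] with x hx
  -- Both sums are equal to `‖w‖²`.
  let w : G := ∑ j, (starRingEnd ℂ) ((Ψ j : L2 n) x : ℂ) • Ψ j
  have hw : ∀ v : G, inner ℂ w v = ∑ j, ((Ψ j : L2 n) x : ℂ) * inner ℂ (Ψ j) v := fun v => by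
    rw [sum_inner]
    exact Finset.sum_congr rfl fun j _ => by
      rw [Submodule.coe_inner, Submodule.coe_smul, inner_smul_left, Complex.conj_conj,
        Submodule.coe_inner]
  have h1 : ∀ i, inner ℂ w (Ψ' i) = ((Ψ' i : L2 n) x : ℂ) := fun i => by
    rw [hw, hx]
    exact Finset.sum_congr rfl fun j _ => mul_comm _ _
  have h2 : ∀ i, inner ℂ w (Ψ i) = ((Ψ i : L2 n) x : ℂ) := fun i => by
    classical
    rw [hw]
    simp [orthonormal_iff_ite.1 Ψ.orthonormal]
  have h3 : ∑ i, ‖((Ψ' i : L2 n) x : ℂ)‖ ^ 2 = ∑ i, ‖((Ψ i : L2 n) x : ℂ)‖ ^ 2 := by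
    simp only [← h1, ← h2]
    rw [Ψ'.sum_sq_norm_inner_left, Ψ.sum_sq_norm_inner_left]
  have e : ∀ z : ℂ, ‖z‖ₑ ^ 2 = ENNReal.ofReal (‖z‖ ^ 2) := fun z => by
    rw [ENNReal.ofReal_pow (norm_nonneg _), ofReal_norm]
  simp only [e]
  rw [← ENNReal.ofReal_sum_of_nonneg fun i _ => sq_nonneg _, h3,
    ENNReal.ofReal_sum_of_nonneg fun i _ => sq_nonneg _]

lemma ae_ae_cons {p : Config (n + 1) → Prop} (h : ∀ᵐ x, p x) :
    ∀ᵐ z : Space, ∀ᵐ x : Config n, p (Fin.cons z x) := by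
  have h1 := (measurePreserving_splitConfig n).symm.quasiMeasurePreserving.ae h
  have h2 := Measure.ae_ae_of_ae_prod (μ := (volume : Measure Space))
    (ν := (volume : Measure (Config n))) h1
  simpa only [splitConfig_symm_apply] using h2

lemma rotateConfig_cons (y : Space) (R : Space ≃ₗᵢ[ℝ] Space) (z : Space) (x : Config n) :
    rotateConfig y R (Fin.cons z x : Config (n + 1)) =
      Fin.cons (rotatePoint y R z) (rotateConfig y R x) := by
  funext i
  refine Fin.cases ?_ (fun j => ?_) i
  · rfl
  · rfl

lemma densityFunction_eq_lintegral {ι : Type} [Fintype ι] (Ψ : ι → L2 (n + 1)) (z : Space) :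
    densityFunction Ψ z =
      ∫⁻ x : Config n, ∑ i, ‖(Ψ i (Fin.cons z x : Config (n + 1)) : ℂ)‖ₑ ^ 2 := by
  rw [densityFunction, lintegral_finsetSum]
  intro i _
  have hc : Measurable fun x : Config n => (Fin.cons z x : Config (n + 1)) := by
    refine measurable_pi_lambda _ fun j => ?_
    refine Fin.cases ?_ (fun k => ?_) j
    · exact measurable_const
    · exact measurable_pi_apply k
  exact (((Lp.stronglyMeasurable (Ψ i)).measurable.comp hc).enorm).pow_const 2

/-- The density function of a rotation invariant subspace is rotation invariant. -/
lemma densityFunction_rotatePoint {ι : Type} [Fintype ι] {G : Submodule ℂ (L2 (n + 1))}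
    {y : Space} (hG : ∀ R : Space ≃ₗᵢ[ℝ] Space, ∀ Φ ∈ G, rotate y R Φ ∈ G)
    (Ψ : OrthonormalBasis ι ℂ G) (R : Space ≃ₗᵢ[ℝ] Space) :
    ∀ᵐ z : Space, densityFunction (fun i => (Ψ i : L2 (n + 1))) (rotatePoint y R z) =
      densityFunction (fun i => (Ψ i : L2 (n + 1))) z := by
  -- Composition with the rotation by `R` maps the basis `Ψ` to another orthonormal basis of `G`.
  let U : G ≃ₗᵢ[ℂ] G :=
    { toFun := fun Φ => ⟨rotate y R.symm Φ, hG R.symm _ Φ.2⟩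
      map_add' := fun a b => Subtype.ext (map_add _ _ _)
      map_smul' := fun c a => Subtype.ext (map_smul _ _ _)
      invFun := fun Φ => ⟨rotate y R Φ, hG R _ Φ.2⟩
      left_inv := fun Φ => Subtype.ext (rotate_rotate_symm y R _)
      right_inv := fun Φ => Subtype.ext (by simpa using rotate_rotate_symm y R.symm (Φ : L2 (n + 1)))
      norm_map' := fun Φ => norm_rotate y R.symm _ }
  have hU : ∀ᵐ x, ∀ i, (((Ψ.map U) i : L2 (n + 1)) x : ℂ) =
      (Ψ i : L2 (n + 1)) (rotateConfig y R x) :=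
    ae_all_iff.2 fun i => by
      filter_upwards [rotate_ae y R.symm (Ψ i : L2 (n + 1))] with x hx
      rw [OrthonormalBasis.map_apply]
      exact hx
  have h : ∀ᵐ x, ∑ i, ‖((Ψ i : L2 (n + 1)) (rotateConfig y R x) : ℂ)‖ₑ ^ 2 =
      ∑ i, ‖((Ψ i : L2 (n + 1)) x : ℂ)‖ₑ ^ 2 := by
    filter_upwards [hU, sum_enorm_sq_orthonormalBasis Ψ (Ψ.map U)] with x h1 h2
    rw [← h2]
    simp only [h1]
  filter_upwards [ae_ae_cons h] with z hz
  rw [densityFunction_eq_lintegral, densityFunction_eq_lintegral, ← lintegral_congr_ae hz,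
    ← (measurePreserving_rotateConfig y R).lintegral_comp_emb
      (rotateConfig y R).measurableEmbedding]
  simp only [rotateConfig_cons]

/-- Every rotation invariant subspace has a spherically symmetric one-electron density. -/
lemma hasSphericalDensity_of_rotate_mem {G : Submodule ℂ (L2 (n + 1))} {y : Space}
    (hG : ∀ R : Space ≃ₗᵢ[ℝ] Space, ∀ Φ ∈ G, rotate y R Φ ∈ G) : HasSphericalDensity y G :=
  ⟨fun _ => ⟨G.starProjection, ⟨isStarProjection_starProjection, G.range_starProjection⟩, _,
      isOneElectronDensity_starProjection G, fun _ h => h.unique (isOneElectronDensity_starProjection G)⟩,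
    fun _ _ hP hρ R => hρ.comm_rotateOne (hP.comm_rotate hG) R,
    fun _ _ Ψ R => densityFunction_rotatePoint hG Ψ R⟩

end AtomDensity

end

theorem mainTheorem7 {V : Type*} [AddCommGroup V] [Module ℂ V] (n : ℕ) (e Z : ℝ)
    (he : 0 < e) (hZ : 0 < Z) (y : AtomDensity.Space)
    (α : Representation ℂ (Equiv.Perm (Fin (n + 1))) V) (hα : α.IsIrreducible) :
    AtomDensity.HasSphericalDensity y
      (AtomDensity.groundSpaceOn e Z y (AtomDensity.symmetrySubspace α)) ∧
    AtomDensity.HasSphericalDensity y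
      (AtomDensity.groundSpace (AtomDensity.hamiltonian (n + 1) e Z y)) ∧
    ∀ Φ ∈ AtomDensity.groundSpace (AtomDensity.hamiltonian (n + 1) e Z y),
      ∀ R : AtomDensity.Space ≃ₗᵢ[ℝ] AtomDensity.Space, AtomDensity.rotate y R Φ = Φ :=
  ⟨AtomDensity.hasSphericalDensity_of_rotate_mem fun R _ hΦ =>
      AtomDensity.rotate_mem_groundSpaceOn α R hΦ,
    AtomDensity.hasSphericalDensity_of_rotate_mem fun R _ hΦ =>
      AtomDensity.rotate_mem_groundSpace R hΦ,
    fun _ hΦ R => AtomDensity.rotate_eq_self_of_mem_groundSpace hZ hΦ R⟩
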